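/- Let $k\ge 1$ be a fixed integer. An instance of $k$-SUM on $n\ge 1$ numbers consists of $k$ arrays $S_1,\dots,S_k$ of $n$ integers each and a target integer $t$; the task is to find $a_1\in S_1,\dots,a_k\in S_k$ with $a_1+\cdots+a_k=t$, or to report that there are none. The model of computation is the randomized word RAM with word length $w$: all input integers are $w$-bit signed integers, the usual arithmetic, bitwise, shift and comparison operations on words, reads and writes of memory cells, and drawing a uniformly random word take unit time, and space is counted in words and includes the input. Then there are a program $P_k$ and constants $C_k,c_k\in\mathbb N$, depending only on $k$, such that for all $n\ge 1$, all $w$ with $2^w\ge C_k n$ (so that $C_k n$ words of memory can be addressed), and every $k$-SUM instance with arrays of $n$ $w$-bit integers, the following holds for $P_k$ on this instance: 1. (Las Vegas) whenever $P_k$ halts, its answer is correct: it outputs a solution $(a_1,\dots,a_k)$ if there is one, and otherwise reports that there is none; 2. (space) in every run $P_k$ uses at most $C_k\, n$ words of space; 3. (time) the expected number of steps until $P_k$ halts is at most $C_k\, n^{\,k-\sqrt{k}+2}\,(\log(n+1))^{c_k}$; in particular $P_k$ halts with probability $1$. That is, $k$-SUM on $n$ numbers can be solved by a Las Vegas algorithm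 in $\tilde O(n^{k-\sqrt{k}+2})$ time and $O(n)$ space. -/

import Mathlib

open scoped ENNReal

/-! A randomized word RAM.  For a word length `w`, a state has registers and a random access
memory whose cells and addresses are `w`-bit words.  Every instruction takes one step, and so does
every evaluation of a control construct. -/

namespace WordRAM

/-- The binary word operations.  Arithmetic is modulo `2 ^ w`, and `div`, `mod`, `lt` are unsigned.
The comparisons (`slt` is the signed one) return `1` or `0`. -/
inductive Op where
  | add | sub | mul | div | mod | and | or | xor | shl | shr | eq | lt | slt

def Op.eval {w : ℕ} : Op → BitVec w → BitVec w → BitVec w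
  | .add, x, y => x + y
  | .sub, x, y => x - y
  | .mul, x, y => x * y
  | .div, x, y => x / y
  | .mod, x, y => x % y
  | .and, x, y => x &&& y
  | .or, x, y => x ||| y
  | .xor, x, y => x ^^^ y
  | .shl, x, y => x <<< y
  | .shr, x, y => x >>> y
  | .eq, x, y => if x = y then 1#w else 0#w
  | .lt, x, y => if x.ult y then 1#w else 0#w
  | .slt, x, y => if x.slt y then 1#w else 0#w

/-- Programs.  A program is a finite object that depends neither on the input nor on the word
length; `d`, `a`, `b`, `r` are numbers of registers. -/
inductive Cmd where
  /-- write the constant `c` to register `d` -/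
  | const (d c : ℕ)
  /-- register `d` := `o` applied to registers `a` and `b` -/
  | op (o : Op) (d a b : ℕ)
  /-- register `d` := the memory cell whose address is in register `a` -/
  | load (d a : ℕ)
  /-- the memory cell whose address is in register `a` := register `b` -/
  | store (a b : ℕ)
  /-- register `d` := a fresh uniformly random word -/
  | rand (d : ℕ)
  /-- run `p`, then `q` -/
  | seq (p q : Cmd)
  /-- run `p` if register `r` is nonzero, otherwise `q` -/
  | branch (r : ℕ) (p q : Cmd)
  /-- run `p` as long as register `r` is nonzero -/
  | loop (r : ℕ) (p : Cmd)

/-- The registers that a program mentions all have numbers smaller than `regCount`. -/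
def Cmd.regCount : Cmd → ℕ
  | .const d _ => d + 1
  | .op _ d a b => max (d + 1) (max (a + 1) (b + 1))
  | .load d a => max (d + 1) (a + 1)
  | .store a b => max (a + 1) (b + 1)
  | .rand d => d + 1
  | .seq p q => max p.regCount q.regCount
  | .branch r p q => max (r + 1) (max p.regCount q.regCount)
  | .loop r p => max (r + 1) p.regCount

structure State (w : ℕ) where
  reg : ℕ → BitVec w
  mem : BitVec w → BitVec w
  /-- all memory cells occupied by the input or accessed so far have addresses below `peak` -/
  peak : ℕ

def State.setReg {w : ℕ} (s : State w) (d : ℕ) (x : BitVec w) : State w :=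
  { s with reg := Function.update s.reg d x }

def State.load {w : ℕ} (s : State w) (d : ℕ) (addr : BitVec w) : State w :=
  { s with
    reg := Function.update s.reg d (s.mem addr)
    peak := max s.peak (addr.toNat + 1) }

def State.store {w : ℕ} (s : State w) (addr x : BitVec w) : State w :=
  { s with
    mem := Function.update s.mem addr x
    peak := max s.peak (addr.toNat + 1) }

/-- A configuration: the commands that remain to be run, in order (the control state, one of
finitely many for a given program), and the state.  It is halted when no command remains. -/
structure Config (w : ℕ) where
  todo : List Cmd
  state : State w

def Config.Halted {w : ℕ} (d : Config w) : Prop := d.todo = []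

/-- One step of the machine, as a probability distribution on configurations. -/
noncomputable def step {w : ℕ} : Config w → PMF (Config w)
  | ⟨[], s⟩ => PMF.pure ⟨[], s⟩
  | ⟨.const d c :: K, s⟩ => PMF.pure ⟨K, s.setReg d (BitVec.ofNat w c)⟩
  | ⟨.op o d a b :: K, s⟩ => PMF.pure ⟨K, s.setReg d (o.eval (s.reg a) (s.reg b))⟩
  | ⟨.load d a :: K, s⟩ => PMF.pure ⟨K, s.load d (s.reg a)⟩
  | ⟨.store a b :: K, s⟩ => PMF.pure ⟨K, s.store (s.reg a) (s.reg b)⟩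
  | ⟨.rand d :: K, s⟩ =>
      (PMF.uniformOfFintype (BitVec w)).map fun x => ⟨K, s.setReg d x⟩
  | ⟨.seq p q :: K, s⟩ => PMF.pure ⟨p :: q :: K, s⟩
  | ⟨.branch r p q :: K, s⟩ => PMF.pure ⟨(if s.reg r ≠ 0#w then p else q) :: K, s⟩
  | ⟨.loop r p :: K, s⟩ =>
      PMF.pure ⟨if s.reg r ≠ 0#w then p :: .loop r p :: K else K, s⟩

/-- The distribution of the configuration after `m` steps. -/
noncomputable def after {w : ℕ} (d : Config w) : ℕ → PMF (Config w)
  | 0 => PMF.pure d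
  | m + 1 => (after d m).bind step

/-- `d'` occurs with positive probability in a run from `d`. -/
def Reachable {w : ℕ} (d d' : Config w) : Prop := ∃ m, d' ∈ (after d m).support

/-- The expected number of steps until the machine halts, `∑ m, ℙ (not halted after m steps)`. -/
noncomputable def expectedTime {w : ℕ} (d : Config w) : ℝ≥0∞ :=
  ∑' m : ℕ, (after d m).toOuterMeasure {d' | ¬ d'.Halted}

/-- The number of words in use: the registers of the program `P` and the initial segment of the
memory that contains the input and all cells accessed so far. -/
def Config.space {w : ℕ} (P : Cmd) (d : Config w) : ℕ := P.regCount + d.state.peak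

end WordRAM

namespace KSum

open WordRAM

/-- A choice of one entry from each of `k` arrays whose sum, in `ℤ`, is the target.  Words stand
for signed integers (two's complement). -/
def IsSolution {k n w : ℕ} (S : Fin k → Fin n → BitVec w) (t : BitVec w)
    (j : Fin k → Fin n) : Prop :=
  ∑ i, (S i (j i)).toInt = t.toInt

/-- The initial configuration of the program `P`.  Registers 0, 1, 2 contain the number `n`,
the target and the word length; the `k` arrays of `n` words are stored one after the other from
address 0 on; everything else is zero. -/
def init (P : Cmd) {k n w : ℕ} (S : Fin k → Fin n → BitVec w) (t : BitVec w) : Config w where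
  todo := [P]
  state :=
    { reg := fun r =>
        if r = 0 then BitVec.ofNat w n
        else if r = 1 then t
        else if r = 2 then BitVec.ofNat w w
        else 0#w
      mem := fun a =>
        if h : a.toNat < k * n then
          S (finProdFinEquiv.symm ⟨a.toNat, h⟩).1 (finProdFinEquiv.symm ⟨a.toNat, h⟩).2
        else 0#w
      peak := k * n }

/-- The answer in a final state is right: either register 0 contains 1 and registers `1, …, k`
contain the entries of a solution, or register 0 contains 0 and there is no solution. -/
def CorrectOutput {k n w : ℕ} (S : Fin k → Fin n → BitVec w) (t : BitVec w)
    (s : State w) : Prop :=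
  (s.reg 0 = 1#w ∧ ∃ j, IsSolution S t j ∧ ∀ i : Fin k, s.reg (i + 1) = S i (j i)) ∨
  (s.reg 0 = 0#w ∧ ¬ ∃ j, IsSolution S t j)

/-- `P` is a Las Vegas algorithm for `k`-SUM with space bound `space n` (on every run) and expected
time bound `time n`.  It works for all `n ≥ 1` and all word lengths for which `space n` words of
memory can be addressed.  A finite expected time implies that it halts almost surely. -/
def IsLasVegas (k : ℕ) (P : Cmd) (time : ℕ → ℝ) (space : ℕ → ℕ) : Prop :=
  ∀ n w : ℕ, 1 ≤ n → space n ≤ 2 ^ w →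
    ∀ (S : Fin k → Fin n → BitVec w) (t : BitVec w),
      (∀ d, Reachable (init P S t) d → d.Halted → CorrectOutput S t d.state) ∧
      (∀ d, Reachable (init P S t) d → d.space P ≤ space n) ∧
      expectedTime (init P S t) ≤ ENNReal.ofReal (time n)

end KSum

/-! The algorithm is deterministic. Put `g = ⌊√k⌋` and `r = g - 1`; form `r` groups of `g` arrays
each and leave the other `k - r * g` arrays single. The sums of a group, at most `n ^ g` of them,
are regarded as an increasing list cut into `B = n ^ (g - 1)` blocks of length `n`, padded at the
end with a sentinel larger than the target. Linear space is enough for one block of every group at a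
time. The list itself is never stored: the next sum is found by running through all `n ^ g` choices
(`search_spec`), so a block costs about `n ^ (g + 1)` steps (`Params.fetch_spec`).

For each of the `B ^ r` combinations of blocks, all choices of entries from the single arrays are
run through. Let `y` be the sum of such a choice. If it is completed to a solution by entries of the
current blocks, then `T - y` lies between the sum of the lower bounds and the sum of the last
entries of the blocks. Only when this test succeeds are the `n ^ r` choices of block entries tried
(`Params.stream_spec`, `Params.join_spec`).

The gain comes from counting successful tests. Fix `y`. The blocks of one group are disjoint and
increasing, so two combinations that pass cannot have all coordinates of one strictly larger than
those of the other. In the grid of side `B` and dimension `r` such a set meets every diagonal at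
most once and has only `O(B ^ (r - 1))` points (`card_le_of_forall_exists_le`,
`nestSum_intervals_le`).

Up to constant factors the tests cost `B ^ r * n ^ (k - r * g) = n ^ (k - g + 1)`, the trials of
block entries cost `n ^ (k - r * g) * B ^ (r - 1) * n ^ r = n ^ (k - g + 1)` when `r ≥ 1`, and
fetching blocks costs `B ^ r * n ^ (g + 1) = n ^ (g * g - g + 2)`. Since `g ≤ √k ≤ g + 1`, both
exponents are at most `k - √k + 2` (`exponent_le`), without a logarithm.

Blocks contain only sums. A hit therefore saves the group sums, and at the end one further search
per group finds entries with these sums (`Params.recover_spec`). Adding `2 ^ (w - 1)` to every entry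
makes all numbers nonnegative, and sums are kept in double words. -/

namespace WordRAM

/-! ### Runs without random words, and frame rules. -/

variable {w : ℕ}

/-- `BigStep p s s' m`: the command `p`, started in the state `s`, ends in the state `s'` after
exactly `m` steps, without using random words. -/
inductive BigStep : Cmd → State w → State w → ℕ → Prop
  | const (d c : ℕ) (s : State w) : BigStep (.const d c) s (s.setReg d (BitVec.ofNat w c)) 1
  | op (o : Op) (d a b : ℕ) (s : State w) :
      BigStep (.op o d a b) s (s.setReg d (o.eval (s.reg a) (s.reg b))) 1
  | load (d a : ℕ) (s : State w) : BigStep (.load d a) s (s.load d (s.reg a)) 1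
  | store (a b : ℕ) (s : State w) : BigStep (.store a b) s (s.store (s.reg a) (s.reg b)) 1
  | seq {p q : Cmd} {s s₁ s₂ : State w} {m₁ m₂ : ℕ} :
      BigStep p s s₁ m₁ → BigStep q s₁ s₂ m₂ → BigStep (.seq p q) s s₂ (m₁ + m₂ + 1)
  | branch_true {r : ℕ} {p : Cmd} (q : Cmd) {s s' : State w} {m : ℕ} :
      s.reg r ≠ 0#w → BigStep p s s' m → BigStep (.branch r p q) s s' (m + 1)
  | branch_false {r : ℕ} (p : Cmd) {q : Cmd} {s s' : State w} {m : ℕ} :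
      s.reg r = 0#w → BigStep q s s' m → BigStep (.branch r p q) s s' (m + 1)
  | loop_done {r : ℕ} (p : Cmd) {s : State w} : s.reg r = 0#w → BigStep (.loop r p) s s 1
  | loop_step {r : ℕ} {p : Cmd} {s s₁ s₂ : State w} {m₁ m₂ : ℕ} :
      s.reg r ≠ 0#w → BigStep p s s₁ m₁ → BigStep (.loop r p) s₁ s₂ m₂ →
      BigStep (.loop r p) s s₂ (m₁ + m₂ + 1)

theorem after_add (d : Config w) (a b : ℕ) :
    after d (a + b) = (after d a).bind fun d' => after d' b := by
  induction b with
  | zero => simp [after]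
  | succ b ih => rw [← Nat.add_assoc, after, ih, PMF.bind_bind]; rfl

theorem after_one (d : Config w) : after d 1 = step d := by simp [after]

theorem after_of_step_eq_pure {d d' : Config w} (h : step d = PMF.pure d') (m : ℕ) :
    after d (m + 1) = after d' m := by
  rw [Nat.add_comm, after_add, after_one, h, PMF.pure_bind]

/-- Without random words every step is a point mass, so the whole run is. The pending commands `K`
are arbitrary because sequences and loops run their parts with more commands waiting. -/
theorem BigStep.after_eq {p : Cmd} {s s' : State w} {m : ℕ} (h : BigStep p s s' m) :
    ∀ K, after ⟨p :: K, s⟩ m = PMF.pure ⟨K, s'⟩ := by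
  induction h with
  | const | op | load | store => intro K; rw [after_one]; rfl
  | seq _ _ ih₁ ih₂ =>
    intro K
    rw [after_of_step_eq_pure (d' := ⟨_ :: _ :: K, _⟩) rfl, after_add, ih₁, PMF.pure_bind, ih₂]
  | branch_true q h _ ih =>
    intro K
    rw [after_of_step_eq_pure (d' := ⟨_ :: K, _⟩) (by simp only [step, if_pos h]; rfl), ih]
  | branch_false p h _ ih =>
    intro K
    rw [after_of_step_eq_pure (d' := ⟨_ :: K, _⟩) (by simp only [step, if_neg (not_not.2 h)]; rfl), ih]
  | loop_done p h =>
    intro K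
    rw [after_one]; simp only [step, if_neg (not_not.2 h)]
  | loop_step h _ _ ih₁ ih₂ =>
    intro K
    rw [after_of_step_eq_pure (d' := ⟨_ :: _ :: K, _⟩) (by simp only [step, if_pos h]; rfl),
      after_add, ih₁, PMF.pure_bind, ih₂]

/-- Monotonicity of `peak` reduces the space bound for every moment of a run to the final state. -/
theorem peak_le_of_mem_support_step {d d' : Config w} (h : d' ∈ (step d).support) :
    d.state.peak ≤ d'.state.peak := by
  rcases d with ⟨_ | ⟨p, K⟩, s⟩
  · simp only [step, PMF.support_pure, Set.mem_singleton_iff] at h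
    rw [h]
  · cases p with
    | rand d =>
      simp only [step, PMF.support_map, Set.mem_image] at h
      obtain ⟨x, _, rfl⟩ := h
      exact le_rfl
    | _ =>
      simp only [step, PMF.support_pure, Set.mem_singleton_iff] at h
      rw [h] <;> simp [State.setReg, State.load, State.store]

theorem peak_le_of_mem_support_after {d d' : Config w} {m : ℕ}
    (h : d' ∈ (after d m).support) : d.state.peak ≤ d'.state.peak := by
  induction m generalizing d' with
  | zero => simp only [after, PMF.support_pure, Set.mem_singleton_iff] at h; rw [h]
  | succ m ih =>
    simp only [after, PMF.mem_support_bind_iff] at h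
    obtain ⟨e, he, h⟩ := h
    exact (ih he).trans (peak_le_of_mem_support_step h)

theorem after_halted (s : State w) (m : ℕ) : after ⟨[], s⟩ m = PMF.pure ⟨[], s⟩ := by
  induction m with
  | zero => rfl
  | succ m ih => rw [after, ih, PMF.pure_bind]; rfl

theorem mem_support_after_add {d d' e : Config w} {a b : ℕ} (h : d' ∈ (after d a).support)
    (he : e ∈ (after d' b).support) : e ∈ (after d (a + b)).support := by
  rw [after_add, PMF.mem_support_bind_iff]
  exact ⟨d', h, he⟩

section Whole

variable {p : Cmd} {s s' : State w} {m : ℕ}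

theorem BigStep.after_of_le (h : BigStep p s s' m) {M : ℕ} (hM : m ≤ M) :
    after ⟨[p], s⟩ M = PMF.pure ⟨[], s'⟩ := by
  obtain ⟨b, rfl⟩ := Nat.exists_eq_add_of_le hM
  rw [after_add, h.after_eq, PMF.pure_bind, after_halted]

/-- A halted configuration persists, so any run that reaches it can be prolonged past step `m`,
where the distribution is the point mass at the final state. -/
theorem BigStep.eq_of_reachable_of_halted (h : BigStep p s s' m) {d : Config w}
    (hd : Reachable ⟨[p], s⟩ d) (hh : d.Halted) : d.state = s' := by
  obtain ⟨M, hM⟩ := hd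
  rcases d with ⟨K, e⟩
  obtain rfl : K = [] := hh
  have := mem_support_after_add hM (b := m) (e := ⟨[], e⟩) (by simp [after_halted])
  rw [h.after_of_le (Nat.le_add_left m M)] at this
  simp only [PMF.support_pure, Set.mem_singleton_iff, Config.mk.injEq, true_and] at this
  exact this

theorem BigStep.peak_le_of_reachable (h : BigStep p s s' m) {d : Config w}
    (hd : Reachable ⟨[p], s⟩ d) : d.state.peak ≤ s'.peak := by
  obtain ⟨M, hM⟩ := hd
  obtain ⟨e, he⟩ := (after d m).support_nonempty
  have h1 := mem_support_after_add hM he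
  rw [h.after_of_le (Nat.le_add_left m M)] at h1
  simp only [PMF.support_pure, Set.mem_singleton_iff] at h1
  have h2 := peak_le_of_mem_support_after he
  rwa [h1] at h2

/-- The first `m` terms of the series are probabilities, and all later terms vanish. -/
theorem BigStep.expectedTime_le (h : BigStep p s s' m) : expectedTime ⟨[p], s⟩ ≤ m := by
  unfold expectedTime
  rw [tsum_eq_sum (s := Finset.range m)]
  · refine (Finset.sum_le_card_nsmul _ _ 1 fun M _ => ?_).trans (by simp)
    rw [PMF.toOuterMeasure_apply, ← (after _ M).tsum_coe]
    exact ENNReal.tsum_le_tsum fun d => Set.indicator_le_self _ _ d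
  · intro M hM
    rw [h.after_of_le (by simpa using hM), PMF.toOuterMeasure_pure_apply]
    simp [Config.Halted]

end Whole

/-- `p.Writes ρ`: the command `p` has an instruction whose destination is the register `ρ`. -/
def Cmd.Writes : Cmd → ℕ → Prop
  | .const d _, ρ => ρ = d
  | .op _ d _ _, ρ => ρ = d
  | .load d _, ρ => ρ = d
  | .store _ _, _ => False
  | .rand d, ρ => ρ = d
  | .seq p q, ρ => p.Writes ρ ∨ q.Writes ρ
  | .branch _ p q, ρ => p.Writes ρ ∨ q.Writes ρ
  | .loop _ p, ρ => p.Writes ρ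

def Cmd.NoStore : Cmd → Prop
  | .store _ _ => False
  | .seq p q => p.NoStore ∧ q.NoStore
  | .branch _ p q => p.NoStore ∧ q.NoStore
  | .loop _ p => p.NoStore
  | _ => True

def Cmd.NoLoad : Cmd → Prop
  | .load _ _ => False
  | .seq p q => p.NoLoad ∧ q.NoLoad
  | .branch _ p q => p.NoLoad ∧ q.NoLoad
  | .loop _ p => p.NoLoad
  | _ => True

/-- The frame rule: most invariants below survive a command because the syntactic set of its
destination registers avoids the registers they mention. -/
theorem BigStep.reg_eq {p : Cmd} {s s' : State w} {m : ℕ} (h : BigStep p s s' m) {ρ : ℕ}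
    (hρ : ¬ p.Writes ρ) : s'.reg ρ = s.reg ρ := by
  induction h with
  | const | op | load =>
    exact Function.update_of_ne hρ _ _
  | store | loop_done => rfl
  | seq _ _ ih₁ ih₂ =>
    simp only [Cmd.Writes, not_or] at hρ
    rw [ih₂ hρ.2, ih₁ hρ.1]
  | branch_true _ _ _ ih => simp only [Cmd.Writes, not_or] at hρ; exact ih hρ.1
  | branch_false _ _ _ ih => simp only [Cmd.Writes, not_or] at hρ; exact ih hρ.2
  | loop_step _ _ _ ih₁ ih₂ => rw [ih₂ hρ, ih₁ hρ]

theorem BigStep.mem_eq {p : Cmd} {s s' : State w} {m : ℕ} (h : BigStep p s s' m)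
    (hp : p.NoStore) : s'.mem = s.mem := by
  induction h with
  | const | op | load | loop_done => rfl
  | store => exact hp.elim
  | seq _ _ ih₁ ih₂ => rw [ih₂ hp.2, ih₁ hp.1]
  | branch_true _ _ _ ih => exact ih hp.1
  | branch_false _ _ _ ih => exact ih hp.2
  | loop_step _ _ _ ih₁ ih₂ => rw [ih₂ hp, ih₁ hp]

theorem BigStep.peak_eq {p : Cmd} {s s' : State w} {m : ℕ} (h : BigStep p s s' m)
    (hp : p.NoStore) (hl : p.NoLoad) : s'.peak = s.peak := by
  induction h with
  | const | op | loop_done => rfl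
  | load => exact hl.elim
  | store => exact hp.elim
  | seq _ _ ih₁ ih₂ => rw [ih₂ hp.2 hl.2, ih₁ hp.1 hl.1]
  | branch_true _ _ _ ih => exact ih hp.1 hl.1
  | branch_false _ _ _ ih => exact ih hp.2 hl.2
  | loop_step _ _ _ ih₁ ih₂ => rw [ih₂ hp hl, ih₁ hp hl]

end WordRAM

/-! ### Double word arithmetic. -/

namespace WordRAM

infixr:60 " ;; " => Cmd.seq

variable {w : ℕ}

/-- The natural number with high word `h` and low word `l`. -/
def dword (h l : BitVec w) : ℕ := h.toNat * 2 ^ w + l.toNat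

/-- The low sum wraps around exactly when it ends up smaller than `l₁`, so that comparison is the
carry; the size hypothesis keeps the high words from wrapping. -/
theorem dword_add_with_carry (h₁ l₁ h₂ l₂ : BitVec w)
    (hlt : dword h₁ l₁ + dword h₂ l₂ < 2 ^ w * 2 ^ w) :
    dword (h₁ + h₂ + if (l₁ + l₂).ult l₁ then 1#w else 0#w) (l₁ + l₂) =
      dword h₁ l₁ + dword h₂ l₂ := by
  unfold dword at *
  have a1 := h₁.isLt
  have a2 := l₁.isLt
  have a3 := h₂.isLt
  have a4 := l₂.isLt
  have hW : 0 < 2 ^ w := Nat.two_pow_pos w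
  simp only [BitVec.ult, BitVec.toNat_add, decide_eq_true_eq]
  generalize h₁.toNat = a at *
  generalize h₂.toNat = b at *
  generalize l₁.toNat = c at *
  generalize l₂.toNat = d at *
  by_cases hcd : c + d < 2 ^ w
  · rw [Nat.mod_eq_of_lt hcd, if_neg (by omega)]
    have : a + b < 2 ^ w := by
      by_contra hab
      have := Nat.mul_le_mul_right (2 ^ w) (not_lt.1 hab)
      rw [Nat.add_mul] at this
      omega
    simp only [BitVec.toNat_ofNat, Nat.zero_mod, Nat.add_zero, Nat.mod_mod]
    rw [Nat.mod_eq_of_lt this]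
    ring
  · have hm : (c + d) % 2 ^ w = c + d - 2 ^ w := by
      rw [Nat.mod_eq_sub_mod (by omega), Nat.mod_eq_of_lt (by omega)]
    rw [hm, if_pos (by omega)]
    have : a + b + 1 < 2 ^ w := by
      by_contra hab
      have := Nat.mul_le_mul_right (2 ^ w) (not_lt.1 hab)
      rw [Nat.add_mul, Nat.add_mul] at this
      omega
    have h1 : 1 % 2 ^ w = 1 := Nat.mod_eq_of_lt (by omega)
    simp only [BitVec.toNat_ofNat, h1]
    rw [Nat.mod_eq_of_lt (by omega : a + b < 2 ^ w), Nat.mod_eq_of_lt this, Nat.add_mul,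
      Nat.add_mul]
    omega

theorem dword_lt_dword {h₁ l₁ h₂ l₂ : BitVec w} :
    dword h₁ l₁ < dword h₂ l₂ ↔
      h₁.toNat < h₂.toNat ∨ h₁ = h₂ ∧ l₁.toNat < l₂.toNat := by
  unfold dword
  have a2 := l₁.isLt
  have a4 := l₂.isLt
  rw [← BitVec.toNat_inj]
  constructor
  · intro h
    rcases lt_trichotomy h₁.toNat h₂.toNat with h' | h' | h'
    · exact .inl h'
    · rw [h'] at h; exact .inr ⟨h', by omega⟩
    · have := Nat.mul_le_mul_right (2 ^ w) (Nat.succ_le_of_lt h')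
      rw [Nat.succ_mul] at this
      omega
  · rintro (h' | ⟨h', h⟩)
    · have := Nat.mul_le_mul_right (2 ^ w) (Nat.succ_le_of_lt h')
      rw [Nat.succ_mul] at this
      omega
    · rw [h']; omega

theorem dword_inj {h₁ l₁ h₂ l₂ : BitVec w} :
    dword h₁ l₁ = dword h₂ l₂ ↔ h₁ = h₂ ∧ l₁ = l₂ := by
  refine ⟨fun h => ?_, fun h => by rw [h.1, h.2]⟩
  have h1 := mt dword_lt_dword.2 h.not_lt
  have h2 := mt dword_lt_dword.2 h.not_gt
  have : h₁ = h₂ := by rw [← BitVec.toNat_inj]; omega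
  refine ⟨this, ?_⟩
  rw [← BitVec.toNat_inj]
  subst this
  simp only [true_and] at h1 h2
  omega

/-! Registers are used in pairs: the pair number `x` has the low word in register `lo k x` and the
high word in register `hi k x`.  The registers up to `k` are kept for the output. -/

def lo (k x : ℕ) : ℕ := k + 3 + 2 * x

def hi (k x : ℕ) : ℕ := k + 4 + 2 * x

variable {k : ℕ}

@[simp] theorem lo_inj {x y : ℕ} : lo k x = lo k y ↔ x = y := by unfold lo; omega

@[simp] theorem hi_inj {x y : ℕ} : hi k x = hi k y ↔ x = y := by unfold hi; omega

@[simp] theorem lo_ne_hi {x y : ℕ} : lo k x ≠ hi k y := by unfold lo hi; omega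

@[simp] theorem hi_ne_lo {x y : ℕ} : hi k x ≠ lo k y := by unfold lo hi; omega

theorem lo_gt (k x : ℕ) : k + 2 < lo k x := by unfold lo; omega

theorem hi_gt (k x : ℕ) : k + 2 < hi k x := by unfold hi; omega

/-- The value of the register pair number `x`. -/
def State.dbl (s : State w) (k x : ℕ) : ℕ := dword (s.reg (hi k x)) (s.reg (lo k x))

theorem BigStep.dbl_eq {p : Cmd} {s s' : State w} {m : ℕ} (h : BigStep p s s' m) {x : ℕ}
    (hl : ¬ p.Writes (lo k x)) (hh : ¬ p.Writes (hi k x)) : s'.dbl k x = s.dbl k x := by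
  unfold State.dbl
  rw [h.reg_eq hl, h.reg_eq hh]

/-- The scratch register pair. -/
abbrev vTmp : ℕ := Nat.pair 0 0

def setD (k x h l : ℕ) : Cmd := .const (hi k x) h ;; .const (lo k x) l

def copyD (k x a : ℕ) : Cmd :=
  .op .or (hi k x) (hi k a) (hi k a) ;; .op .or (lo k x) (lo k a) (lo k a)

def addD (k x a b : ℕ) : Cmd :=
  .op .add (lo k x) (lo k a) (lo k b) ;; .op .lt (lo k vTmp) (lo k x) (lo k a) ;;
    .op .add (hi k x) (hi k a) (hi k b) ;; .op .add (hi k x) (hi k x) (lo k vTmp)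

def ltD (k a b : ℕ) : Cmd :=
  .op .lt (lo k vTmp) (lo k a) (lo k b) ;; .op .eq (hi k vTmp) (hi k a) (hi k b) ;;
    .op .and (lo k vTmp) (lo k vTmp) (hi k vTmp) ;; .op .lt (hi k vTmp) (hi k a) (hi k b) ;;
      .op .or (lo k vTmp) (lo k vTmp) (hi k vTmp)

def eqD (k a b : ℕ) : Cmd :=
  .op .eq (lo k vTmp) (lo k a) (lo k b) ;; .op .eq (hi k vTmp) (hi k a) (hi k b) ;;
    .op .and (lo k vTmp) (lo k vTmp) (hi k vTmp)

def skip (k : ℕ) : Cmd := .const (lo k vTmp) 0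

theorem skip_spec (k : ℕ) (s : State w) : ∃ s', BigStep (skip k) s s' 1 :=
  ⟨_, .const _ _ _⟩

theorem setD_spec (k x : ℕ) {h l : ℕ} (hh : h < 2 ^ w) (hl : l < 2 ^ w) (s : State w) :
    ∃ s', BigStep (setD k x h l) s s' 3 ∧ s'.dbl k x = h * 2 ^ w + l ∧
      s'.reg (lo k x) = BitVec.ofNat w l ∧ s'.reg (hi k x) = BitVec.ofNat w h := by
  refine ⟨_, .seq (.const _ _ _) (.const _ _ _), ?_⟩
  simp [State.dbl, dword, State.setReg, Nat.mod_eq_of_lt hh, Nat.mod_eq_of_lt hl]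

theorem copyD_spec (k x a : ℕ) (s : State w) :
    ∃ s', BigStep (copyD k x a) s s' 3 ∧ s'.dbl k x = s.dbl k a := by
  refine ⟨_, .seq (.op _ _ _ _ _) (.op _ _ _ _ _), ?_⟩
  simp [State.dbl, State.setReg, Op.eval]

/-- The carry test reads the low word of `a` after that of `x` has been written, whence `x ≠ a`; the
scratch pair holds the carry, whence `x ≠ vTmp`. The target may coincide with `b`. -/
theorem addD_spec {k x a b : ℕ} (s : State w) (hxa : x ≠ a) (hxt : x ≠ vTmp)
    (hlt : s.dbl k a + s.dbl k b < 2 ^ w * 2 ^ w) :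
    ∃ s', BigStep (addD k x a b) s s' 7 ∧ s'.dbl k x = s.dbl k a + s.dbl k b := by
  refine ⟨_, .seq (.op _ _ _ _ _) (.seq (.op _ _ _ _ _) (.seq (.op _ _ _ _ _)
    (.op _ _ _ _ _))), ?_⟩
  refine Eq.trans ?_ (dword_add_with_carry _ _ _ _ hlt)
  simp [State.dbl, State.setReg, Op.eval, hxa.symm, hxt]

theorem one_ne_zero_of_pos (hw : 0 < w) : (1#w) ≠ 0#w := by
  intro h
  have := congrArg BitVec.toNat h
  simp at this
  omega

theorem ltD_spec {k a b : ℕ} (hw : 0 < w) (s : State w) (hat : a ≠ vTmp) (hbt : b ≠ vTmp) :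
    ∃ s', BigStep (ltD k a b) s s' 9 ∧
      (s'.reg (lo k vTmp) ≠ 0#w ↔ s.dbl k a < s.dbl k b) := by
  refine ⟨_, .seq (.op _ _ _ _ _) (.seq (.op _ _ _ _ _) (.seq (.op _ _ _ _ _)
    (.seq (.op _ _ _ _ _) (.op _ _ _ _ _)))), ?_⟩
  have := one_ne_zero_of_pos hw
  simp only [State.dbl, dword_lt_dword]
  simp only [State.setReg, Op.eval, Function.update_apply, hi_inj, hat, hbt,
    lo_ne_hi, hi_ne_lo, if_true, if_false, BitVec.ult, decide_eq_true_eq]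
  by_cases h1 : (s.reg (lo k a)).toNat < (s.reg (lo k b)).toNat <;>
  by_cases h2 : s.reg (hi k a) = s.reg (hi k b) <;>
  by_cases h3 : (s.reg (hi k a)).toNat < (s.reg (hi k b)).toNat <;>
  simp [h1, h2, h3, this]

theorem eqD_spec {k a b : ℕ} (hw : 0 < w) (s : State w) :
    ∃ s', BigStep (eqD k a b) s s' 5 ∧
      (s'.reg (lo k vTmp) ≠ 0#w ↔ s.dbl k a = s.dbl k b) := by
  refine ⟨_, .seq (.op _ _ _ _ _) (.seq (.op _ _ _ _ _) (.op _ _ _ _ _)), ?_⟩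
  have := one_ne_zero_of_pos hw
  simp only [State.dbl, dword_inj]
  simp only [State.setReg, Op.eval, Function.update_apply, lo_ne_hi, hi_ne_lo, if_true, if_false]
  by_cases h1 : s.reg (lo k a) = s.reg (lo k b) <;>
  by_cases h2 : s.reg (hi k a) = s.reg (hi k b) <;>
  simp [h1, h2, this]

/-- Both arms are led to one postcondition that includes the step count, so a branch can be verified
in the middle of a program; the `+ 1` pays for the test. -/
theorem BigStep.branch {r : ℕ} {p q : Cmd} {s : State w} {c : Prop} (hc : s.reg r ≠ 0#w ↔ c)
    {Q : State w → ℕ → Prop} (hp : c → ∃ s' m, BigStep p s s' m ∧ Q s' (m + 1))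
    (hq : ¬ c → ∃ s' m, BigStep q s s' m ∧ Q s' (m + 1)) :
    ∃ s' m, BigStep (.branch r p q) s s' m ∧ Q s' m := by
  by_cases h : c
  · obtain ⟨s', m, h1, h2⟩ := hp h
    exact ⟨s', _, .branch_true _ (hc.2 h) h1, h2⟩
  · obtain ⟨s', m, h1, h2⟩ := hq h
    exact ⟨s', _, .branch_false _ (not_not.1 (mt hc.1 h)) h1, h2⟩

/-! Which registers the macros write. -/

section Writes

variable {x a b h l ρ : ℕ}

@[simp] theorem writes_const : (Cmd.const a b).Writes ρ ↔ ρ = a := Iff.rfl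

@[simp] theorem writes_op {o : Op} : (Cmd.op o x a b).Writes ρ ↔ ρ = x := Iff.rfl

@[simp] theorem writes_load : (Cmd.load a b).Writes ρ ↔ ρ = a := Iff.rfl

@[simp] theorem writes_store : (Cmd.store a b).Writes ρ ↔ False := Iff.rfl

@[simp] theorem writes_seq {p q : Cmd} : (p ;; q).Writes ρ ↔ p.Writes ρ ∨ q.Writes ρ := Iff.rfl

@[simp] theorem writes_branch {p q : Cmd} :
    (Cmd.branch a p q).Writes ρ ↔ p.Writes ρ ∨ q.Writes ρ := Iff.rfl

@[simp] theorem writes_loop {p : Cmd} : (Cmd.loop a p).Writes ρ ↔ p.Writes ρ := Iff.rfl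

@[simp] theorem writes_setD : (setD k x h l).Writes ρ ↔ ρ = hi k x ∨ ρ = lo k x := Iff.rfl

@[simp] theorem writes_copyD : (copyD k x a).Writes ρ ↔ ρ = hi k x ∨ ρ = lo k x := Iff.rfl

@[simp] theorem writes_addD :
    (addD k x a b).Writes ρ ↔ ρ = lo k x ∨ ρ = lo k vTmp ∨ ρ = hi k x := by
  simp [addD]

@[simp] theorem writes_ltD : (ltD k a b).Writes ρ ↔ ρ = lo k vTmp ∨ ρ = hi k vTmp := by
  simp [ltD]; tauto

@[simp] theorem writes_eqD : (eqD k a b).Writes ρ ↔ ρ = lo k vTmp ∨ ρ = hi k vTmp := by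
  simp [eqD]; tauto

@[simp] theorem writes_skip : (skip k).Writes ρ ↔ ρ = lo k vTmp := Iff.rfl

attribute [simp] Cmd.NoStore Cmd.NoLoad

@[simp] theorem noStore_setD : (setD k x h l).NoStore := by simp [setD]

@[simp] theorem noStore_copyD : (copyD k x a).NoStore := by simp [copyD]

@[simp] theorem noStore_addD : (addD k x a b).NoStore := by simp [addD]

@[simp] theorem noStore_ltD : (ltD k a b).NoStore := by simp [ltD]

@[simp] theorem noStore_eqD : (eqD k a b).NoStore := by simp [eqD]

@[simp] theorem noStore_skip : (skip k).NoStore := by simp [skip]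

@[simp] theorem noLoad_setD : (setD k x h l).NoLoad := by simp [setD]

@[simp] theorem noLoad_copyD : (copyD k x a).NoLoad := by simp [copyD]

@[simp] theorem noLoad_addD : (addD k x a b).NoLoad := by simp [addD]

@[simp] theorem noLoad_ltD : (ltD k a b).NoLoad := by simp [ltD]

@[simp] theorem noLoad_eqD : (eqD k a b).NoLoad := by simp [eqD]

@[simp] theorem noLoad_skip : (skip k).NoLoad := by simp [skip]

end Writes

end WordRAM

/-! ### Counting loops and access to the arrays. -/

namespace WordRAM

variable {w : ℕ} {k : ℕ}

/-! The register pairs with a fixed meaning. -/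

abbrev vN : ℕ := Nat.pair 0 1

abbrev vOne : ℕ := Nat.pair 0 2

abbrev vMsb : ℕ := Nat.pair 0 3

abbrev vT : ℕ := Nat.pair 0 4

/-- The loop counter of level `l`. -/
abbrev vIdx (l : ℕ) : ℕ := Nat.pair 1 l

/-- The current array entry of level `l`. -/
abbrev vE (l : ℕ) : ℕ := Nat.pair 2 l

/-- The sum of the current entries of the levels below `l`. -/
abbrev vA (l : ℕ) : ℕ := Nat.pair 3 l

/-- The registers that are constant in the main part of the program. -/
def ConstReg (k ρ : ℕ) : Prop :=
  ρ = lo k vN ∨ ρ = lo k vOne ∨ ρ = hi k vOne ∨ ρ = lo k vMsb ∨ ρ = lo k vT ∨ ρ = hi k vT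

/-- The constant registers have their intended values and at most `pk` memory cells are in use. -/
structure Base (k n T pk : ℕ) (s : State w) : Prop where
  n_eq : s.reg (lo k vN) = BitVec.ofNat w n
  one_lo : s.reg (lo k vOne) = 1#w
  one_hi : s.reg (hi k vOne) = 0#w
  msb : s.reg (lo k vMsb) = BitVec.ofNat w (2 ^ (w - 1))
  target : s.dbl k vT = T
  peak_le : s.peak ≤ pk

theorem Base.of_reg_eq {n T pk : ℕ} {s s' : State w} (h : Base k n T pk s)
    (hreg : ∀ ρ, ConstReg k ρ → s'.reg ρ = s.reg ρ) (hp : s'.peak ≤ pk) :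
    Base k n T pk s' where
  n_eq := by rw [hreg _ (by simp [ConstReg]), h.n_eq]
  one_lo := by rw [hreg _ (by simp [ConstReg]), h.one_lo]
  one_hi := by rw [hreg _ (by simp [ConstReg]), h.one_hi]
  msb := by rw [hreg _ (by simp [ConstReg]), h.msb]
  target := by
    rw [← h.target]
    unfold State.dbl
    rw [hreg _ (by simp [ConstReg]), hreg _ (by simp [ConstReg])]
  peak_le := hp

theorem Base.of_bigStep {n T pk : ℕ} {p : Cmd} {s s' : State w} {m : ℕ}
    (h : Base k n T pk s) (hb : BigStep p s s' m) (hp : ∀ ρ, ConstReg k ρ → ¬ p.Writes ρ)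
    (hpk : s'.peak ≤ pk) : Base k n T pk s' :=
  h.of_reg_eq (fun ρ hρ => hb.reg_eq (hp ρ hρ)) hpk

/-- Run `body` with the counter `i` running from `n - 1` down to `0`. -/
def forN (k i : ℕ) (body : Cmd) : Cmd :=
  .op .or (lo k i) (lo k vN) (lo k vN) ;;
    .loop (lo k i) (.op .sub (lo k i) (lo k i) (lo k vOne) ;; body)

@[simp] theorem writes_forN {i ρ : ℕ} {body : Cmd} :
    (forN k i body).Writes ρ ↔ ρ = lo k i ∨ body.Writes ρ := by
  simp [forN]

@[simp] theorem noStore_forN {i : ℕ} {body : Cmd} :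
    (forN k i body).NoStore ↔ body.NoStore := by
  simp [forN]

/-- `Inv a` is to hold when `a` passes remain. The counter is decremented before each pass, so `Inv`
must tolerate any change of the counter; `hbody` receives its value separately. Loop control costs
three steps per pass and three more in all. -/
theorem forN_spec {i n : ℕ} {body : Cmd} (f : ℕ → ℕ) (Inv : ℕ → State w → Prop)
    (hn : n < 2 ^ w) (hi1 : i ≠ vOne) (hwi : ¬ body.Writes (lo k i))
    (hw1 : ¬ body.Writes (lo k vOne))
    (hstab : ∀ a s x, Inv a s → Inv a (s.setReg (lo k i) x))
    (hbody : ∀ a s, a < n → Inv (a + 1) s → s.reg (lo k i) = BitVec.ofNat w a →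
      ∃ s' m, BigStep body s s' m ∧ m ≤ f a ∧ Inv a s')
    {s : State w} (hN : s.reg (lo k vN) = BitVec.ofNat w n) (h1 : s.reg (lo k vOne) = 1#w)
    (h0 : Inv n s) :
    ∃ s' m, BigStep (forN k i body) s s' m ∧ m ≤ ∑ a ∈ Finset.range n, (f a + 3) + 3 ∧
      Inv 0 s' := by
  have key : ∀ a s, a ≤ n → Inv a s → s.reg (lo k i) = BitVec.ofNat w a →
      s.reg (lo k vOne) = 1#w →
      ∃ s' m, BigStep (.loop (lo k i) (.op .sub (lo k i) (lo k i) (lo k vOne) ;; body)) s s' m ∧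
        m ≤ ∑ a ∈ Finset.range a, (f a + 3) + 1 ∧ Inv 0 s' := by
    intro a
    induction a with
    | zero =>
      intro s _ hI hs _
      exact ⟨s, 1, .loop_done _ (by simpa using hs), by simp, hI⟩
    | succ a ih =>
      intro s ha hI hs h1
      have hsub : BitVec.ofNat w (a + 1) - 1#w = BitVec.ofNat w a := by
        apply BitVec.eq_of_toNat_eq
        rw [BitVec.toNat_sub]
        simp only [BitVec.toNat_ofNat]
        rw [Nat.mod_eq_of_lt (by omega : a + 1 < 2 ^ w), Nat.mod_eq_of_lt (by omega : 1 < 2 ^ w),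
          Nat.mod_eq_of_lt (by omega : a < 2 ^ w),
          show 2 ^ w - 1 + (a + 1) = a + 2 ^ w by omega, Nat.add_mod_right,
          Nat.mod_eq_of_lt (by omega)]
      obtain ⟨s₁, m₁, hb, hm, hI₁⟩ := hbody a (s.setReg (lo k i) (BitVec.ofNat w a)) (by omega)
        (hstab _ _ _ hI) (by simp [State.setReg])
      obtain ⟨s₂, m₂, hb₂, hm₂, hI₂⟩ := ih s₁ (by omega) hI₁
        (by rw [hb.reg_eq hwi]; simp [State.setReg])
        (by rw [hb.reg_eq hw1]; simpa [State.setReg, hi1.symm] using h1)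
      refine ⟨s₂, 1 + m₁ + 1 + m₂ + 1, .loop_step ?_ (.seq (.op _ _ _ _ _) ?_) hb₂, ?_, hI₂⟩
      · rw [hs]
        intro h
        have := congrArg BitVec.toNat h
        simp only [BitVec.toNat_ofNat] at this
        rw [Nat.mod_eq_of_lt (by omega)] at this
        simp at this
      · simp only [Op.eval, hs, h1, hsub]
        exact hb
      · rw [Finset.sum_range_succ]
        omega
  obtain ⟨s', m, hb, hm, hI⟩ := key n (s.setReg (lo k i) (BitVec.ofNat w n)) le_rfl
    (hstab _ _ _ h0) (by simp [State.setReg]) (by simpa [State.setReg, hi1.symm] using h1)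
  refine ⟨s', 1 + m + 1, .seq (.op _ _ _ _ _) ?_, ?_, hI⟩
  · simp only [Op.eval, hN, BitVec.or_self]
    exact hb
  · omega

/-- Load the entry number `i` of the array number `a` into register `d`. -/
def loadCell (k d a i : ℕ) : Cmd :=
  .const (lo k vTmp) a ;; .op .mul (lo k vTmp) (lo k vTmp) (lo k vN) ;;
    .op .add (lo k vTmp) (lo k vTmp) (lo k i) ;; .load d (lo k vTmp)

/-- Store register `d` as the entry number `i` of the array number `a`. -/
def storeCell (k d a i : ℕ) : Cmd :=
  .const (lo k vTmp) a ;; .op .mul (lo k vTmp) (lo k vTmp) (lo k vN) ;;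
    .op .add (lo k vTmp) (lo k vTmp) (lo k i) ;; .store (lo k vTmp) d

@[simp] theorem writes_loadCell {d a i ρ : ℕ} :
    (loadCell k d a i).Writes ρ ↔ ρ = lo k vTmp ∨ ρ = d := by
  simp [loadCell]

@[simp] theorem writes_storeCell {d a i ρ : ℕ} :
    (storeCell k d a i).Writes ρ ↔ ρ = lo k vTmp := by
  simp [storeCell]

@[simp] theorem noStore_loadCell {d a i : ℕ} : (loadCell k d a i).NoStore := by
  simp [loadCell]

theorem loadCell_spec {n d a i j : ℕ} {s : State w} (hi : i ≠ vTmp)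
    (hN : s.reg (lo k vN) = BitVec.ofNat w n) (hj : s.reg (lo k i) = BitVec.ofNat w j) :
    ∃ s', BigStep (loadCell k d a i) s s' 7 ∧ s'.reg d = s.mem (BitVec.ofNat w (a * n + j)) ∧
      s'.peak ≤ max s.peak (a * n + j + 1) := by
  refine ⟨_, .seq (.const _ _ _) (.seq (.op _ _ _ _ _) (.seq (.op _ _ _ _ _) (.load _ _ _))), ?_⟩
  simp [State.setReg, State.load, Op.eval, hi, hN, hj, ← BitVec.ofNat_add, ← BitVec.ofNat_mul]
  have := Nat.mod_le (a * n + j) (2 ^ w)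
  omega

theorem storeCell_spec {n d a i j : ℕ} {s : State w} (hi : i ≠ vTmp) (hd : d ≠ lo k vTmp)
    (hN : s.reg (lo k vN) = BitVec.ofNat w n) (hj : s.reg (lo k i) = BitVec.ofNat w j) :
    ∃ s', BigStep (storeCell k d a i) s s' 7 ∧
      s'.mem = Function.update s.mem (BitVec.ofNat w (a * n + j)) (s.reg d) ∧
      s'.peak ≤ max s.peak (a * n + j + 1) := by
  refine ⟨_, .seq (.const _ _ _) (.seq (.op _ _ _ _ _) (.seq (.op _ _ _ _ _) (.store _ _ _))), ?_⟩
  simp [State.setReg, State.store, Op.eval, hi, hd, hN, hj, ← BitVec.ofNat_add,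
    ← BitVec.ofNat_mul]
  have := Nat.mod_le (a * n + j) (2 ^ w)
  omega

/-- The value of the entry number `j` at level `l`.  The levels `l < k` are the input arrays, whose
entries are shifted by `2 ^ (w - 1)` to make them nonnegative.  The levels from `k` on are arrays of
double words. -/
def levelVal (k n : ℕ) (μ : BitVec w → BitVec w) (l j : ℕ) : ℕ :=
  if l < k then (μ (BitVec.ofNat w (l * n + j)) + BitVec.ofNat w (2 ^ (w - 1))).toNat
  else dword (μ (BitVec.ofNat w ((k + 2 * (l - k) + 1) * n + j)))
    (μ (BitVec.ofNat w ((k + 2 * (l - k)) * n + j)))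

def loadLevel (k l : ℕ) : Cmd :=
  if l < k then
    loadCell k (lo k (vE l)) l (vIdx l) ;; .op .add (lo k (vE l)) (lo k (vE l)) (lo k vMsb) ;;
      .const (hi k (vE l)) 0
  else
    loadCell k (lo k (vE l)) (k + 2 * (l - k)) (vIdx l) ;;
      loadCell k (hi k (vE l)) (k + 2 * (l - k) + 1) (vIdx l)

theorem writes_loadLevel {l ρ : ℕ} :
    (loadLevel k l).Writes ρ ↔ ρ = lo k vTmp ∨ ρ = lo k (vE l) ∨ ρ = hi k (vE l) := by
  unfold loadLevel
  split_ifs <;> simp <;> tauto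

theorem noStore_loadLevel {l : ℕ} : (loadLevel k l).NoStore := by
  unfold loadLevel
  split_ifs <;> simp

theorem loadLevel_spec {n T pk l j r : ℕ} {s : State w} (hs : Base k n T pk s)
    (hj : s.reg (lo k (vIdx l)) = BitVec.ofNat w j) (hjn : j < n) (hl : l < k + r)
    (hpk : (k + 2 * r) * n ≤ pk) :
    ∃ s' m, BigStep (loadLevel k l) s s' m ∧ m ≤ 15 ∧ s'.dbl k (vE l) = levelVal k n s.mem l j ∧
      s'.peak ≤ pk := by
  have cell : ∀ a, a < k + 2 * r → a * n + j + 1 ≤ pk := by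
    intro a ha
    have := Nat.mul_le_mul_right n (Nat.succ_le_of_lt ha)
    rw [Nat.succ_mul] at this
    omega
  unfold loadLevel levelVal
  split_ifs with h
  · obtain ⟨s₁, h₁, hv, hp⟩ := loadCell_spec (d := lo k (vE l)) (a := l) (i := vIdx l) (by simp)
      hs.n_eq hj
    refine ⟨_, _, .seq h₁ (.seq (.op _ _ _ _ _) (.const _ _ _)), by omega, ?_, ?_⟩
    · have : s₁.reg (lo k vMsb) = BitVec.ofNat w (2 ^ (w - 1)) := by
        rw [h₁.reg_eq (by simp), hs.msb]
      simp [State.dbl, State.setReg, Op.eval, hv, this, dword]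
    · have := cell l (by omega)
      have := hs.peak_le
      simp only [State.setReg]
      omega
  · obtain ⟨s₁, h₁, hv, hp⟩ := loadCell_spec (d := lo k (vE l)) (a := k + 2 * (l - k))
      (i := vIdx l) (by simp) hs.n_eq hj
    obtain ⟨s₂, h₂, hv₂, hp₂⟩ := loadCell_spec (k := k) (s := s₁) (n := n) (j := j) (d := hi k (vE l))
      (a := k + 2 * (l - k) + 1) (i := vIdx l) (by simp) (by rw [h₁.reg_eq (by simp), hs.n_eq])
      (by rw [h₁.reg_eq (by simp), hj])
    refine ⟨_, _, .seq h₁ h₂, by omega, ?_, ?_⟩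
    · unfold State.dbl
      rw [hv₂, h₂.reg_eq (by simp), hv, h₁.mem_eq (by simp)]
    · have := cell (k + 2 * (l - k)) (by omega)
      have := cell (k + 2 * (l - k) + 1) (by omega)
      have := hs.peak_le
      omega

end WordRAM

/-! ### Nested loops over all choices of entries. -/

namespace WordRAM

variable {w : ℕ} {k : ℕ}

/-- The sum of `f` over all sequences that arise from `j` by changing the `c` entries from position
`l` on to numbers below `n`. -/
def nestSum (n : ℕ) : ℕ → ℕ → ((ℕ → ℕ) → ℕ) → (ℕ → ℕ) → ℕ
  | 0, _, f, j => f j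
  | c + 1, l, f, j => ∑ a ∈ Finset.range n, nestSum n c (l + 1) f (Function.update j l a)

/-- The sequences that arise from `j₀` by changing the `c` entries from position `l` on to numbers
below `n`. -/
def tuples (n c l : ℕ) (j₀ : ℕ → ℕ) : Set (ℕ → ℕ) :=
  {j | (∀ x, l ≤ x → x < l + c → j x < n) ∧ ∀ x, ¬ (l ≤ x ∧ x < l + c) → j x = j₀ x}

theorem tuples_zero (n l : ℕ) (j₀ : ℕ → ℕ) : tuples n 0 l j₀ = {j₀} := by
  ext j
  simp only [tuples, Set.mem_ofPred_eq, Set.mem_singleton_iff]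
  constructor
  · rintro ⟨_, h⟩
    exact funext fun x => h x (by omega)
  · rintro rfl
    exact ⟨fun x _ _ => by omega, fun _ _ => rfl⟩

theorem mem_tuples_succ {n c l : ℕ} {j₀ j : ℕ → ℕ} {a : ℕ} :
    j ∈ tuples n c (l + 1) (Function.update j₀ l a) ∧ a < n ↔
      j ∈ tuples n (c + 1) l j₀ ∧ j l = a := by
  simp only [tuples, Set.mem_ofPred_eq]
  constructor
  · rintro ⟨⟨h1, h2⟩, ha⟩
    have hl : j l = a := by rw [h2 l (by omega)]; simp
    refine ⟨⟨fun x hx hx' => ?_, fun x hx => ?_⟩, hl⟩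
    · rcases eq_or_ne x l with rfl | hne
      · omega
      · exact h1 x (by omega) (by omega)
    · rw [h2 x (by omega), Function.update_of_ne (by omega)]
  · rintro ⟨⟨h1, h2⟩, rfl⟩
    refine ⟨⟨fun x hx hx' => h1 x (by omega) (by omega), fun x hx => ?_⟩,
      h1 l le_rfl (by omega)⟩
    rcases eq_or_ne x l with rfl | hne
    · simp
    · rw [Function.update_of_ne hne, h2 x (by omega)]

/-- Counters run downwards, so the choices already treated are those with a large entry at level
`l`; one more pass adds the slice `j l = a`. -/
theorem tuples_step {n c l a : ℕ} {j₀ : ℕ → ℕ} (ha : a < n) :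
    {j | j ∈ tuples n (c + 1) l j₀ ∧ a + 1 ≤ j l} ∪ tuples n c (l + 1) (Function.update j₀ l a) =
      {j | j ∈ tuples n (c + 1) l j₀ ∧ a ≤ j l} := by
  ext j
  have := mem_tuples_succ (n := n) (c := c) (l := l) (j₀ := j₀) (j := j) (a := a)
  simp only [ha, and_true] at this
  simp only [Set.mem_union, Set.mem_ofPred_eq, this]
  constructor
  · rintro (⟨h, h'⟩ | ⟨h, rfl⟩)
    · exact ⟨h, by omega⟩
    · exact ⟨h, le_rfl⟩
  · rintro ⟨h, h'⟩
    rcases h'.eq_or_lt with h' | h'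
    · exact .inr ⟨h, h'.symm⟩
    · exact .inl ⟨h, h'⟩

/-- Run `body` for all choices of one entry at each of the `c` levels from `l` on, with the entry
of level `x` in the register pair `vE x` and their sum, added to the value of `vA l`,
in `vA (l + c)`. -/
def nest (k : ℕ) : ℕ → ℕ → Cmd → Cmd
  | 0, _, body => body
  | c + 1, l, body =>
    forN k (vIdx l) (loadLevel k l ;; addD k (vA (l + 1)) (vA l) (vE l) ;; nest k c (l + 1) body)

/-- The registers that `nest k c l body` uses itself. -/
def NestReg (k c l ρ : ℕ) : Prop :=
  ρ = lo k vTmp ∨ ρ = hi k vTmp ∨ ∃ x, l ≤ x ∧ x < l + c ∧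
    (ρ = lo k (vIdx x) ∨ ρ = lo k (vE x) ∨ ρ = hi k (vE x) ∨
      ρ = lo k (vA (x + 1)) ∨ ρ = hi k (vA (x + 1)))

theorem NestReg.succ {c l ρ : ℕ} (h : NestReg k c (l + 1) ρ) : NestReg k (c + 1) l ρ := by
  rcases h with h | h | ⟨x, h1, h2, h3⟩
  · exact .inl h
  · exact .inr (.inl h)
  · exact .inr (.inr ⟨x, by omega, by omega, h3⟩)

theorem writes_nest {c l ρ : ℕ} {body : Cmd} (h : (nest k c l body).Writes ρ) :
    NestReg k c l ρ ∨ body.Writes ρ := by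
  induction c generalizing l with
  | zero => exact .inr h
  | succ c ih =>
    simp only [nest, writes_forN, writes_seq, writes_loadLevel, writes_addD] at h
    have hl : ∀ ρ, (ρ = lo k (vIdx l) ∨ ρ = lo k (vE l) ∨ ρ = hi k (vE l) ∨
      ρ = lo k (vA (l + 1)) ∨ ρ = hi k (vA (l + 1))) → NestReg k (c + 1) l ρ := fun ρ h =>
        .inr (.inr ⟨l, by omega, by omega, h⟩)
    rcases h with h | (h | h | h) | (h | h | h) | h
    · exact .inl (hl _ (by tauto))
    · exact .inl (.inl h)
    · exact .inl (hl _ (by tauto))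
    · exact .inl (hl _ (by tauto))
    · exact .inl (hl _ (by tauto))
    · exact .inl (.inl h)
    · exact .inl (hl _ (by tauto))
    · exact (ih h).imp_left NestReg.succ

theorem noStore_nest {c l : ℕ} {body : Cmd} (h : body.NoStore) : (nest k c l body).NoStore := by
  induction c generalizing l with
  | zero => exact h
  | succ c ih => simp [nest, noStore_loadLevel, ih]

/-- Register pairs are numbered by `Nat.pair` of a tag and an index. Names with different tags
cannot collide, and `simp` settles such frame conditions by injectivity of pairing. -/
theorem not_nestReg_constReg {c l ρ : ℕ} (h : ConstReg k ρ) : ¬ NestReg k c l ρ := by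
  rintro (h' | h' | ⟨x, -, -, h'⟩) <;>
  rcases h with rfl | rfl | rfl | rfl | rfl | rfl <;> simp at h'

/-- The registers that the body of `nest k c l body` must not write. -/
def NestKeep (k c l ρ : ℕ) : Prop :=
  ConstReg k ρ ∨ ∃ x, l ≤ x ∧ x < l + c ∧
    (ρ = lo k (vIdx x) ∨ ρ = lo k (vE x) ∨ ρ = hi k (vE x) ∨ ρ = lo k (vA x) ∨ ρ = hi k (vA x))

theorem NestKeep.succ {c l ρ : ℕ} (h : NestKeep k c (l + 1) ρ) : NestKeep k (c + 1) l ρ := by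
  rcases h with h | ⟨x, h1, h2, h3⟩
  · exact .inl h
  · exact .inr ⟨x, by omega, by omega, h3⟩

/-- The work horse for all exhaustive searches. `Inv` is told the set of choices treated so far, and
the body only has to enlarge it by one choice. `Inv`, `X` and `j₀` are quantified inside the
induction, because the inner loops are used with an invariant that also fixes the entry and the
partial sum of the outer level. `bnd` bounds the entries and thereby excludes overflow of the
partial sums. -/
theorem nest_spec {n T pk r bnd : ℕ} {μ : BitVec w → BitVec w} {body : Cmd} (hn : n < 2 ^ w)
    (hpk : (k + 2 * r) * n ≤ pk) (hn0 : 1 ≤ n) (hns : body.NoStore) (f : (ℕ → ℕ) → ℕ) (c : ℕ) :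
    ∀ (l a₀ : ℕ) (Inv : Set (ℕ → ℕ) → State w → Prop) (X : Set (ℕ → ℕ)) (j₀ : ℕ → ℕ) (s : State w)
    (_ : l + c ≤ k + r)
    (_ : ∀ x, l ≤ x → x < l + c → ∀ j, j < n → levelVal k n μ x j ≤ bnd)
    (_ : a₀ + c * bnd < 2 ^ w * 2 ^ w)
    (_ : ∀ ρ, NestKeep k c l ρ → ¬ body.Writes ρ)
    (_ : ∀ X s s', (∀ ρ, ¬ NestReg k c l ρ → s'.reg ρ = s.reg ρ) → s'.mem = s.mem →
      Inv X s → Inv X s')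
    (_ : ∀ X j s, j ∈ tuples n c l j₀ → Base k n T pk s → s.mem = μ → Inv X s →
      (∀ x, l ≤ x → x < l + c → s.dbl k (vE x) = levelVal k n μ x (j x)) →
      s.dbl k (vA (l + c)) = a₀ + ∑ x ∈ Finset.Ico l (l + c), levelVal k n μ x (j x) →
      ∃ s' m, BigStep body s s' m ∧ m ≤ f j ∧ s'.peak ≤ pk ∧ Inv (X ∪ {j}) s')
    (_ : Base k n T pk s) (_ : s.mem = μ) (_ : Inv X s) (_ : s.dbl k (vA l) = a₀),
    ∃ s' m, BigStep (nest k c l body) s s' m ∧ m ≤ nestSum n c l f j₀ + 30 * c * n ^ c ∧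
      s'.peak ≤ pk ∧ Inv (X ∪ tuples n c l j₀) s' := by
  induction c with
  | zero =>
    intro l a₀ Inv X j₀ s _ _ _ _ _ hbody hs hμ hI ha
    obtain ⟨s', m, h1, h2, h3, h4⟩ := hbody X j₀ s (by simp [tuples_zero]) hs hμ hI
      (fun x _ _ => by omega) (by simpa using ha)
    exact ⟨s', m, h1, by simpa [nestSum] using h2, h3, by rwa [tuples_zero]⟩
  | succ c ih =>
    intro l a₀ Inv X j₀ s hlr hval ha₀ hkeep hstab hbody hs hμ hI ha
    have hlc : l + 1 + c = l + (c + 1) := by omega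
    have hkeepl : ∀ ρ, (ρ = lo k (vIdx l) ∨ ρ = lo k (vE l) ∨ ρ = hi k (vE l) ∨ ρ = lo k (vA l) ∨
        ρ = hi k (vA l)) → ¬ (nest k c (l + 1) body).Writes ρ := by
      intro ρ h hw
      rcases writes_nest hw with h' | h'
      · rcases h' with h' | h' | ⟨x, h1, -, h'⟩
        · subst h'; simp at h
        · subst h'; simp at h
        · rcases h with rfl | rfl | rfl | rfl | rfl <;> simp at h' <;> omega
      · exact hkeep ρ (.inr ⟨l, by omega, by omega, h⟩) h'
    have hconst : ∀ ρ, ConstReg k ρ → ¬ (nest k c (l + 1) body).Writes ρ := by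
      intro ρ h hw
      rcases writes_nest hw with h' | h'
      · exact not_nestReg_constReg h h'
      · exact hkeep ρ (.inl h) h'
    have hin : ∀ ρ, (ρ = lo k (vIdx l) ∨ ρ = lo k (vE l) ∨ ρ = hi k (vE l) ∨
        ρ = lo k (vA (l + 1)) ∨ ρ = hi k (vA (l + 1))) → NestReg k (c + 1) l ρ := fun ρ h =>
      .inr (.inr ⟨l, by omega, by omega, h⟩)
    let Inv' : ℕ → State w → Prop := fun a s =>
      Base k n T pk s ∧ s.mem = μ ∧ s.dbl k (vA l) = a₀ ∧
        Inv (X ∪ {j | j ∈ tuples n (c + 1) l j₀ ∧ a ≤ j l}) s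
    obtain ⟨s', m, h1, h2, h3, h4, h5, h6⟩ := forN_spec (k := k) (i := vIdx l)
      (body := loadLevel k l ;; addD k (vA (l + 1)) (vA l) (vE l) ;; nest k c (l + 1) body)
      (fun a => nestSum n c (l + 1) f (Function.update j₀ l a) + 30 * c * n ^ c + 24) Inv' hn
      (by simp) (by
        simp only [writes_seq, writes_loadLevel, writes_addD]
        simp [hkeepl (lo k (vIdx l))]) (by
        simp only [writes_seq, writes_loadLevel, writes_addD]
        simp [hconst (lo k vOne) (by simp [ConstReg])]) (by
        rintro a s x ⟨h1, h2, h3, h4⟩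
        refine ⟨h1.of_reg_eq (fun ρ hρ => ?_) h1.peak_le, h2, ?_, hstab _ s _ ?_ rfl h4⟩
        · exact Function.update_of_ne (by rcases hρ with rfl | rfl | rfl | rfl | rfl | rfl <;> simp)
            _ _
        · simpa [State.dbl, State.setReg] using h3
        · intro ρ hρ
          exact Function.update_of_ne (fun h => hρ (hin _ (.inl h))) _ _)
      (by
        rintro a s han ⟨hs, hμ, ha, hI⟩ hidx
        obtain ⟨s₁, m₁, hb₁, hm₁, hv₁, hp₁⟩ := loadLevel_spec (l := l) hs hidx han (by omega) hpk
        have hs₁ := hs.of_bigStep hb₁ (fun ρ hρ => by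
          rw [writes_loadLevel]
          rcases hρ with rfl | rfl | rfl | rfl | rfl | rfl <;> simp) hp₁
        have hμ₁ : s₁.mem = μ := (hb₁.mem_eq noStore_loadLevel).trans hμ
        have ha₁ : s₁.dbl k (vA l) = a₀ := by
          rw [hb₁.dbl_eq (by simp [writes_loadLevel]) (by simp [writes_loadLevel]), ha]
        rw [hμ] at hv₁
        have hle := hval l le_rfl (by omega) a han
        have hlt : a₀ + levelVal k n μ l a + c * bnd < 2 ^ w * 2 ^ w := by
          rw [Nat.succ_mul] at ha₀; omega
        obtain ⟨s₂, hb₂, hv₂⟩ := addD_spec (k := k) (x := vA (l + 1)) (a := vA l) (b := vE l) s₁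
          (by simp) (by simp) (by omega)
        have hs₂ := hs₁.of_bigStep hb₂ (fun ρ hρ => by
          rw [writes_addD]
          rcases hρ with rfl | rfl | rfl | rfl | rfl | rfl <;> simp)
          ((hb₂.peak_eq (by simp) (by simp)).le.trans hp₁)
        have hμ₂ : s₂.mem = μ := (hb₂.mem_eq (by simp)).trans hμ₁
        have ha₂ : s₂.dbl k (vA l) = a₀ := by
          rw [hb₂.dbl_eq (by simp) (by simp), ha₁]
        have he₂ : s₂.dbl k (vE l) = levelVal k n μ l a := by
          rw [hb₂.dbl_eq (by simp) (by simp), hv₁]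
        have hI₂ : Inv (X ∪ {j | j ∈ tuples n (c + 1) l j₀ ∧ a + 1 ≤ j l}) s₂ := by
          refine hstab _ s s₂ (fun ρ hρ => ?_) (hμ₂.trans hμ.symm) hI
          rw [hb₂.reg_eq, hb₁.reg_eq]
          · rw [writes_loadLevel]
            rintro (h | h | h)
            · exact hρ (.inl h)
            · exact hρ (hin _ (by tauto))
            · exact hρ (hin _ (by tauto))
          · rw [writes_addD]
            rintro (h | h | h)
            · exact hρ (hin _ (by tauto))
            · exact hρ (.inl h)
            · exact hρ (hin _ (by tauto))
        have hstabE : ∀ s s' : State w, (∀ ρ, ¬ NestReg k c (l + 1) ρ → s'.reg ρ = s.reg ρ) →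
            s'.dbl k (vE l) = s.dbl k (vE l) ∧ s'.dbl k (vA l) = s.dbl k (vA l) := by
          intro s s' h
          unfold State.dbl
          have : ∀ ρ, (ρ = lo k (vE l) ∨ ρ = hi k (vE l) ∨ ρ = lo k (vA l) ∨
              ρ = hi k (vA l)) → s'.reg ρ = s.reg ρ := by
            intro ρ hρ
            apply h
            rintro (h' | h' | ⟨x, h1, -, h'⟩) <;> rcases hρ with rfl | rfl | rfl | rfl <;>
              simp at h' <;> omega
          rw [this (lo k (vE l)) (by tauto), this (hi k (vE l)) (by tauto),
            this (lo k (vA l)) (by tauto), this (hi k (vA l)) (by tauto)]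
          exact ⟨rfl, rfl⟩
        obtain ⟨s₃, m₃, hb₃, hm₃, hp₃, ⟨hI₃, -, -⟩⟩ := ih (l + 1) (a₀ + levelVal k n μ l a)
          (fun X s => Inv X s ∧ s.dbl k (vE l) = levelVal k n μ l a ∧ s.dbl k (vA l) = a₀)
          (X ∪ {j | j ∈ tuples n (c + 1) l j₀ ∧ a + 1 ≤ j l}) (Function.update j₀ l a) s₂
          (by omega) (fun x hx hx' => hval x (by omega) (by omega)) hlt
          (fun ρ hρ => hkeep ρ hρ.succ)
          (by
            rintro X s s' hreg hmem ⟨h, h', h''⟩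
            obtain ⟨e1, e2⟩ := hstabE s s' hreg
            exact ⟨hstab X s s' (fun ρ hρ => hreg ρ fun h => hρ h.succ) hmem h, e1.trans h',
              e2.trans h''⟩)
          (by
            rintro X j s hj hs hμ ⟨hI, hE, hA⟩ hEx hsum
            obtain ⟨hj', hjl⟩ := mem_tuples_succ.1 ⟨hj, han⟩
            obtain ⟨s', m, h1, h2, h3, h4⟩ := hbody X j s hj' hs hμ hI (by
              intro x hx hx'
              rcases hx.eq_or_lt with rfl | hx
              · rw [hE, hjl]
              · exact hEx x hx (by omega)) (by
              rw [← hlc, hsum, Finset.sum_eq_sum_Ico_succ_bot (by omega : l < l + 1 + c), hjl,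
                Nat.add_assoc])
            refine ⟨s', m, h1, h2, h3, h4, ?_, ?_⟩
            · rw [h1.dbl_eq, hE] <;>
              exact hkeep _ (.inr ⟨l, by omega, by omega, by tauto⟩)
            · rw [h1.dbl_eq, hA] <;>
              exact hkeep _ (.inr ⟨l, by omega, by omega, by tauto⟩))
          hs₂ hμ₂ ⟨hI₂, he₂, ha₂⟩ (by rw [hv₂, ha₁, hv₁])
        refine ⟨s₃, _, .seq hb₁ (.seq hb₂ hb₃), by omega, ?_, ?_, ?_, ?_⟩
        · exact hs₂.of_bigStep hb₃ hconst hp₃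
        · exact (hb₃.mem_eq (noStore_nest hns)).trans hμ₂
        · rw [hb₃.dbl_eq (hkeepl _ (by tauto)) (hkeepl _ (by tauto)), ha₂]
        · rwa [Set.union_assoc, tuples_step han] at hI₃)
      hs.n_eq hs.one_lo (s := s) ⟨hs, hμ, ha, by
        convert hI using 1
        -- At the start the counter is `n`, and no admissible entry is at least `n`.
        rw [Set.union_eq_left]
        rintro j ⟨hj, hj'⟩
        have := hj.1 l le_rfl (by omega)
        omega⟩
    refine ⟨s', m, h1, h2.trans ?_, h3.peak_le, ?_⟩
    · rw [Finset.sum_add_distrib, Finset.sum_add_distrib, Finset.sum_add_distrib]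
      simp only [Finset.sum_const, Finset.card_range, smul_eq_mul, nestSum]
      -- Loading and adding cost 24 steps per pass and the loop 3 per pass plus 3, and `27 * n + 3 ≤
      -- 30 * n ^ (c + 1)`.
      have hnc : 1 * n ≤ n ^ c * n := Nat.mul_le_mul_right n (Nat.one_le_pow _ _ hn0)
      have : 30 * (c + 1) * n ^ (c + 1) = n * (30 * c * n ^ c) + 30 * (n ^ c * n) := by ring
      rw [this]
      omega
    · simpa using h6

end WordRAM

/-! ### Counting: nested sums, the antichain bound and sorted enumeration. -/

namespace WordRAM

/-- As one sum over `Fin c → Fin n`, nested sums inherit monotonicity, linearity and exchange of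
summation from finite sums. -/
theorem nestSum_eq_sum (n c l : ℕ) (f : (ℕ → ℕ) → ℕ) (j : ℕ → ℕ) :
    nestSum n c l f j = ∑ φ : Fin c → Fin n,
      f fun x => if h : l ≤ x ∧ x < l + c then φ ⟨x - l, by omega⟩ else j x := by
  induction c generalizing l j with
  | zero =>
    simp only [nestSum, Finset.univ_unique, Finset.sum_singleton]
    congr 1
    funext x
    rw [dif_neg (by omega)]
  | succ c ih =>
    rw [nestSum, ← (Fin.consEquiv fun _ => Fin n).sum_comp, Fintype.sum_prod_type,
      Finset.sum_range]
    refine Finset.sum_congr rfl fun a _ => ?_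
    rw [ih]
    refine Finset.sum_congr rfl fun φ _ => ?_
    congr 1
    funext x
    simp only [Fin.consEquiv_apply]
    rcases lt_trichotomy x l with h | rfl | h
    · rw [dif_neg (by omega), dif_neg (by omega), Function.update_of_ne (by omega)]
    · rw [dif_neg (by omega), dif_pos (by omega), Function.update_self]
      have : (⟨x - x, by omega⟩ : Fin (c + 1)) = 0 := by ext; simp
      rw [this, Fin.cons_zero]
    · by_cases hx : x < l + (c + 1)
      · rw [dif_pos (by omega), dif_pos (by omega)]
        have : (⟨x - l, by omega⟩ : Fin (c + 1)) = Fin.succ ⟨x - (l + 1), by omega⟩ := by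
          ext; simp; omega
        rw [this, Fin.cons_succ]
      · rw [dif_neg (by omega), dif_neg (by omega), Function.update_of_ne (by omega)]

theorem nestSum_mono {n c l : ℕ} {f g : (ℕ → ℕ) → ℕ} (h : ∀ j, f j ≤ g j) (j : ℕ → ℕ) :
    nestSum n c l f j ≤ nestSum n c l g j := by
  simp only [nestSum_eq_sum]
  exact Finset.sum_le_sum fun _ _ => h _

theorem nestSum_const (n c l a : ℕ) (j : ℕ → ℕ) : nestSum n c l (fun _ => a) j = n ^ c * a := by
  simp [nestSum_eq_sum]

theorem nestSum_add (n c l : ℕ) (f g : (ℕ → ℕ) → ℕ) (j : ℕ → ℕ) :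
    nestSum n c l (fun j => f j + g j) j = nestSum n c l f j + nestSum n c l g j := by
  simp only [nestSum_eq_sum, Finset.sum_add_distrib]

theorem nestSum_mul_const (n c l a : ℕ) (f : (ℕ → ℕ) → ℕ) (j : ℕ → ℕ) :
    nestSum n c l (fun j => f j * a) j = nestSum n c l f j * a := by
  simp only [nestSum_eq_sum, Finset.sum_mul]

theorem nestSum_comm (n c l m d l' : ℕ) (h : (ℕ → ℕ) → (ℕ → ℕ) → ℕ) (j j' : ℕ → ℕ) :
    nestSum n c l (fun x => nestSum m d l' (fun y => h x y) j') j =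
      nestSum m d l' (fun y => nestSum n c l (fun x => h x y) j) j' := by
  simp only [nestSum_eq_sum]
  exact Finset.sum_comm

/-- In a grid of side length `B`, a set without two points of which one is smaller in every
coordinate meets every diagonal at most once. -/
theorem card_le_of_forall_exists_le {r B : ℕ} (A : Finset (Fin (r + 1) → Fin B))
    (hA : ∀ J ∈ A, ∀ J' ∈ A, ∃ i, J' i ≤ J i) : A.card ≤ (r + 1) * B ^ r := by
  classical
  have hmin : ∀ J : Fin (r + 1) → Fin B, ∃ i, ∀ i', J i ≤ J i' := fun J => by
    simpa using Finset.exists_min_image Finset.univ J Finset.univ_nonempty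
  choose m hm using hmin
  -- The label of the diagonal through `J`: the position of a least coordinate and the offsets of
  -- the other coordinates from it, which are below `B`.
  let F : (Fin (r + 1) → Fin B) → Fin (r + 1) × (Fin r → Fin B) := fun J =>
    (m J, fun e => ⟨J ((m J).succAbove e) - J (m J),
      (Nat.sub_le _ _).trans_lt (J ((m J).succAbove e)).isLt⟩)
  have hinj : Set.InjOn F A := by
    intro J hJ J' hJ' h
    simp only [F, Prod.mk.injEq] at h
    obtain ⟨h1, h2⟩ := h
    have hdiff : ∀ i, (J i : ℕ) - J (m J) = J' i - J' (m J) := by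
      intro i
      rcases Fin.eq_self_or_eq_succAbove (m J) i with rfl | ⟨e, rfl⟩
      · simp
      · have := congrArg Fin.val (congrFun h2 e)
        simp only [← h1] at this
        exact this
    have hJm : ∀ i, (J (m J) : ℕ) ≤ J i := fun i => hm J i
    have hJm' : ∀ i, (J' (m J) : ℕ) ≤ J' i := fun i => by rw [h1]; exact hm J' i
    obtain ⟨i, hi⟩ := hA J hJ J' hJ'
    obtain ⟨i', hi'⟩ := hA J' hJ' J hJ
    have e1 := hdiff i
    have e2 := hdiff i'
    have hi : (J' i : ℕ) ≤ J i := hi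
    have hi' : (J i' : ℕ) ≤ J' i' := hi'
    have := hJm i
    have := hJm i'
    have := hJm' i
    have := hJm' i'
    -- Equal labels mean that `J` and `J'` differ by a constant vector. The inequalities at `i` and
    -- `i'` force this constant to be zero.
    funext x
    ext
    have := hdiff x
    have := hJm x
    have := hJm' x
    omega
  have := Finset.card_le_card_of_injOn F (fun _ _ => Finset.mem_coe.2 (Finset.mem_univ _)) hinj
  simpa using this

/-- If the intervals `[L i p, M i p]`, `p = 0, 1, …`, are disjoint and increasing for every `i`,
then few sums of one interval for each `i < r` contain a given number. -/
theorem nestSum_intervals_le {r B T y : ℕ} {L M : ℕ → ℕ → ℕ}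
    (h : ∀ i p p', p < p' → M i p < L i p') (j₀ : ℕ → ℕ) :
    nestSum B r 0 (fun J => if ∑ i ∈ Finset.range r, L i (J i) + y ≤ T ∧
      T ≤ ∑ i ∈ Finset.range r, M i (J i) + y then 1 else 0) j₀ ≤ (r + 1) * B ^ (r - 1) := by
  -- For `r = 0` the single empty choice may count; the factor `r + 1` instead of `r` allows for
  -- this.
  rcases r with _ | r
  · simp only [nestSum]
    split_ifs <;> simp
  · rw [nestSum_eq_sum, Finset.sum_boole]
    refine le_trans (Nat.cast_le.2 (card_le_of_forall_exists_le _ ?_)) ?_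
    · intro J hJ J' hJ'
      simp only [Finset.mem_filter, Finset.mem_univ, true_and] at hJ hJ'
      by_contra! hlt
      rw [Finset.sum_range, Finset.sum_range] at hJ hJ'
      -- If `J'` were larger everywhere, the upper end for `J` would lie strictly below the lower
      -- end for `J'`, and `T` could not satisfy both tests.
      have : ∑ i : Fin (r + 1), M i (J i) < ∑ i : Fin (r + 1), L i (J' i) :=
        Finset.sum_lt_sum_of_nonempty Finset.univ_nonempty fun i _ => h i _ _ (hlt i)
      have h1 := hJ.2
      have h2 := hJ'.1
      have e : ∀ (φ : Fin (r + 1) → Fin B) (N : ℕ → ℕ → ℕ), (∑ i : Fin (r + 1), N i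
          (if h : 0 ≤ (i : ℕ) ∧ (i : ℕ) < 0 + (r + 1) then (φ ⟨i - 0, by omega⟩ : ℕ) else j₀ i)) =
          ∑ i : Fin (r + 1), N i (φ i) := by
        intro φ N
        refine Finset.sum_congr rfl fun i _ => ?_
        rw [dif_pos (by omega)]
        rfl
      rw [e] at h1 h2
      omega
    · simp only [Nat.cast_id, Nat.add_sub_cancel]
      exact Nat.mul_le_mul_right _ (by omega)

/-! Listing a set of natural numbers in increasing order. -/

/-- The least element of `D` that is at least `v`, or `b` if there is none below `b`. -/
noncomputable def nextGE (D : Set ℕ) (b v : ℕ) : ℕ := sInf ({x | x ∈ D ∧ v ≤ x} ∪ {b})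

theorem nextGE_eq {D : Set ℕ} {b v x : ℕ} (h1 : x = b ∨ x ∈ D ∧ v ≤ x) (h2 : x ≤ b)
    (h3 : ∀ d ∈ D, v ≤ d → x ≤ d) : nextGE D b v = x := by
  apply le_antisymm
  · apply Nat.sInf_le
    rcases h1 with h1 | h1
    · exact .inr h1
    · exact .inl h1
  · apply le_csInf ⟨b, .inr rfl⟩
    rintro y (hy | rfl)
    · exact h3 y hy.1 hy.2
    · exact h2

theorem nextGE_mem (D : Set ℕ) (b v : ℕ) :
    nextGE D b v = b ∨ nextGE D b v ∈ D ∧ v ≤ nextGE D b v := by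
  have : nextGE D b v ∈ {x | x ∈ D ∧ v ≤ x} ∪ {b} := Nat.sInf_mem ⟨b, .inr rfl⟩
  rcases this with h | h
  · exact .inr h
  · exact .inl h

theorem nextGE_le (D : Set ℕ) (b v : ℕ) : nextGE D b v ≤ b := Nat.sInf_le (.inr rfl)

theorem nextGE_le_of_mem {D : Set ℕ} {b v d : ℕ} (hd : d ∈ D) (hv : v ≤ d) :
    nextGE D b v ≤ d := Nat.sInf_le (.inl ⟨hd, hv⟩)

/-- One more than the last of the `q` least elements of `D` (filled up with `b`). -/
noncomputable def lowerBd (D : Set ℕ) (b : ℕ) : ℕ → ℕ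
  | 0 => 0
  | q + 1 => nextGE D b (lowerBd D b q) + 1

/-- The element number `q` of `D` in increasing order (`b` if there is none below `b`). -/
noncomputable def nthElt (D : Set ℕ) (b q : ℕ) : ℕ := nextGE D b (lowerBd D b q)

section nthElt

variable {D : Set ℕ} {b : ℕ}

theorem lowerBd_succ (q : ℕ) : lowerBd D b (q + 1) = nthElt D b q + 1 := rfl

theorem nthElt_le (q : ℕ) : nthElt D b q ≤ b := nextGE_le _ _ _

theorem lowerBd_le (q : ℕ) : lowerBd D b q ≤ b + 1 := by
  cases q with
  | zero => exact Nat.zero_le _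
  | succ q => rw [lowerBd_succ]; exact Nat.succ_le_succ (nthElt_le q)

theorem nthElt_mem {q : ℕ} (h : nthElt D b q ≠ b) : nthElt D b q ∈ D :=
  ((nextGE_mem D b _).resolve_left h).1

/-- Once `D` is exhausted the value stays at `b + 1`, because every further search returns `b`. -/
theorem lowerBd_mono : Monotone (lowerBd D b) := by
  refine monotone_nat_of_le_succ fun q => ?_
  rw [lowerBd_succ]
  rcases nextGE_mem D b (lowerBd D b q) with h | h
  · rw [nthElt, h]; exact lowerBd_le q
  · exact h.2.trans (Nat.le_succ _)

/-- This separates consecutive blocks, including those padded with `b`. Repeated sentinels would not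
be separated by `nthElt` alone, which is why the lower end of a block is measured by `lowerBd`. -/
theorem nthElt_lt_lowerBd {q q' : ℕ} (h : q < q') : nthElt D b q < lowerBd D b q' := by
  have := lowerBd_mono (D := D) (b := b) (Nat.succ_le_of_lt h)
  rw [lowerBd_succ] at this
  exact this

theorem nthElt_mono : Monotone (nthElt D b) := by
  refine monotone_nat_of_le_succ fun q => ?_
  have := lowerBd_mono (D := D) (b := b) (Nat.le_succ (q + 1))
  rw [lowerBd_succ, lowerBd_succ] at this
  exact Nat.succ_le_succ_iff.1 this

theorem lowerBd_le_nthElt {q : ℕ} (h : nthElt D b q ≠ b) : lowerBd D b q ≤ nthElt D b q :=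
  ((nextGE_mem D b _).resolve_left h).2

/-- If `d` were missing among the first `N` listed elements, all of these would be distinct elements
of `D` below `d`, too many for `F` without `d`. -/
theorem exists_nthElt_eq {N d : ℕ} {F : Finset ℕ} (hF : ∀ x ∈ D, x ∈ F) (hN : F.card ≤ N)
    (hd : d ∈ D) (hdb : d < b) : ∃ q < N, nthElt D b q = d := by
  by_contra! hne
  have hlt : ∀ q, q ≤ N → lowerBd D b q ≤ d := by
    intro q
    induction q with
    | zero => exact fun _ => Nat.zero_le _
    | succ q ih =>
      intro hq
      have h1 := nextGE_le_of_mem (b := b) hd (ih (by omega))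
      have h2 := hne q (by omega)
      exact lt_of_le_of_ne h1 h2
  have hlt' : ∀ q < N, nthElt D b q < d := fun q hq => hlt (q + 1) hq
  have hinj : Set.InjOn (nthElt D b) (Finset.range N) := by
    intro q hq q' hq' h
    by_contra hqq
    rcases lt_or_gt_of_ne hqq with hl | hl
    · have h1 := nthElt_lt_lowerBd (D := D) (b := b) hl
      have := hlt' q' (by simpa using hq')
      -- Elements below `d < b` are not sentinels, and between genuine elements the list is strictly
      -- increasing.
      have := lowerBd_le_nthElt (D := D) (b := b) (q := q') (by omega)
      omega
    · have h1 := nthElt_lt_lowerBd (D := D) (b := b) hl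
      have := hlt' q (by simpa using hq)
      have := lowerBd_le_nthElt (D := D) (b := b) (q := q) (by omega)
      omega
  have hsub : Finset.image (nthElt D b) (Finset.range N) ⊆ F.erase d := by
    intro x hx
    obtain ⟨q, hq, rfl⟩ := Finset.mem_image.1 hx
    have := hlt' q (by simpa using hq)
    exact Finset.mem_erase.2 ⟨by omega, hF _ (nthElt_mem (by omega))⟩
  have h1 := Finset.card_le_card hsub
  rw [Finset.card_image_of_injOn hinj, Finset.card_range, Finset.card_erase_of_mem (hF d hd)] at h1
  have : 0 < F.card := Finset.card_pos.2 ⟨d, hF d hd⟩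
  omega

end nthElt

end WordRAM

/-! ### Finding the next sum of a group. -/

namespace WordRAM

variable {w k g r n T pk : ℕ}

/-- The assumptions on the parameters: `k` arrays of `n` words, `r` groups of `g` arrays, and memory
for `2 * r` further arrays. -/
structure Params (w k g r n T pk : ℕ) : Prop where
  n_pos : 1 ≤ n
  n_lt : n < 2 ^ w
  g_pos : 1 ≤ g
  groups_le : r * g ≤ k
  cells_le : (k + 2 * r) * n ≤ pk
  pk_le : pk ≤ 2 ^ w
  word : (k + 1) * (r + 2) < 2 ^ w
  target_lt : T < k * 2 ^ w

theorem Params.le_of_lt (P : Params w k g r n T pk) : k + 1 < 2 ^ w :=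
  lt_of_le_of_lt (Nat.le_mul_of_pos_right _ (by omega)) P.word

theorem Params.pos (P : Params w k g r n T pk) : 0 < w := by
  have := P.le_of_lt
  rcases w with _ | w <;> simp_all

theorem Params.group_le (P : Params w k g r n T pk) {i : ℕ} (hi : i < r) : i * g + g ≤ k := by
  have := Nat.mul_le_mul_right g (Nat.succ_le_of_lt hi)
  rw [Nat.succ_mul] at this
  exact this.trans P.groups_le

/-- The command `p` does not write the constant registers. -/
def Cmd.KeepsConst (k : ℕ) (p : Cmd) : Prop := ∀ ρ, ConstReg k ρ → ¬ p.Writes ρ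

@[simp] theorem keepsConst_iff {p : Cmd} : p.KeepsConst k ↔
    ¬ p.Writes (lo k vN) ∧ ¬ p.Writes (lo k vOne) ∧ ¬ p.Writes (hi k vOne) ∧
      ¬ p.Writes (lo k vMsb) ∧ ¬ p.Writes (lo k vT) ∧ ¬ p.Writes (hi k vT) := by
  simp only [Cmd.KeepsConst, ConstReg, forall_eq_or_imp, forall_eq]

theorem Base.of_noMem {p : Cmd} {s s' : State w} {m : ℕ} (h : Base k n T pk s)
    (hb : BigStep p s s' m) (hp : p.KeepsConst k) (h1 : p.NoStore)
    (h2 : p.NoLoad) : Base k n T pk s' :=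
  h.of_bigStep hb hp ((hb.peak_eq h1 h2).trans_le h.peak_le)

/-- The memory `μ` contains the input arrays with the shifted entries `U x j`. -/
def HasInput (k n : ℕ) (U : ℕ → ℕ → ℕ) (μ : BitVec w → BitVec w) : Prop :=
  ∀ x < k, ∀ j < n, levelVal k n μ x j = U x j

theorem HasInput.lt {U : ℕ → ℕ → ℕ} {μ : BitVec w → BitVec w} (h : HasInput k n U μ) {x j : ℕ}
    (hx : x < k) (hj : j < n) : U x j < 2 ^ w := by
  rw [← h x hx j hj, levelVal, if_pos hx]
  exact BitVec.isLt _

/-- The sums of one entry from each of the `c` arrays from number `l` on. -/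
def rangeSums (n : ℕ) (U : ℕ → ℕ → ℕ) (c l : ℕ) : Set ℕ :=
  {v | ∃ j : ℕ → ℕ, (∀ x, l ≤ x → x < l + c → j x < n) ∧
    ∑ x ∈ Finset.Ico l (l + c), U x (j x) = v}

theorem HasInput.sum_lt {U : ℕ → ℕ → ℕ} {μ : BitVec w → BitVec w} (h : HasInput k n U μ)
    {c l : ℕ} (hc : 1 ≤ c) (hk : l + c ≤ k) {j : ℕ → ℕ}
    (hj : ∀ x, l ≤ x → x < l + c → j x < n) :
    ∑ x ∈ Finset.Ico l (l + c), U x (j x) < c * 2 ^ w := by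
  have : ∑ x ∈ Finset.Ico l (l + c), U x (j x) < ∑ x ∈ Finset.Ico l (l + c), 2 ^ w :=
    Finset.sum_lt_sum_of_nonempty ⟨l, by simp; omega⟩ fun x hx => by
      rw [Finset.mem_Ico] at hx
      exact h.lt (by omega) (hj x hx.1 hx.2)
  simpa using this

/-- At most `n ^ c` sums exist, so for `c = g` the `n ^ (g - 1)` blocks of length `n` contain them
all. -/
theorem rangeSums_subset (n : ℕ) (U : ℕ → ℕ → ℕ) (c l : ℕ) :
    ∃ F : Finset ℕ, (∀ v ∈ rangeSums n U c l, v ∈ F) ∧ F.card ≤ n ^ c := by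
  refine ⟨Finset.univ.image fun φ : Fin c → Fin n => ∑ x : Fin c, U (l + x) (φ x), ?_,
    Finset.card_image_le.trans (by simp)⟩
  rintro v ⟨j, hj, rfl⟩
  refine Finset.mem_image.2 ⟨fun x => ⟨j (l + x), hj _ (by omega) (by omega)⟩, Finset.mem_univ _, ?_⟩
  rw [Finset.sum_Ico_eq_sum_range, Nat.add_sub_cancel_left, Finset.sum_range]

/-- The register pair of the result of a search. -/
abbrev vBest : ℕ := Nat.pair 0 5

/-- The lower bound for the next search in group `i`. -/
abbrev vV (i : ℕ) : ℕ := Nat.pair 4 i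

/-- The loop counter for filling the block of group `i`. -/
abbrev vF (i : ℕ) : ℕ := Nat.pair 8 i

/-- Find the least sum of group `i` that is at least the value of `vV i`. -/
def search (k g i : ℕ) : Cmd :=
  setD k vBest k 0 ;; setD k (vA (i * g)) 0 0 ;;
    nest k g (i * g) (ltD k (vA (i * g + g)) (vV i) ;;
      .branch (lo k vTmp) (skip k) (ltD k (vA (i * g + g)) vBest ;;
        .branch (lo k vTmp) (copyD k vBest (vA (i * g + g))) (skip k)))

theorem writes_search {i ρ : ℕ} (h : (search k g i).Writes ρ) :
    ρ = lo k vBest ∨ ρ = hi k vBest ∨ ρ = lo k (vA (i * g)) ∨ ρ = hi k (vA (i * g)) ∨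
      NestReg k g (i * g) ρ := by
  simp only [search, writes_seq, writes_setD] at h
  rcases h with h | h | h
  · tauto
  · tauto
  · rcases writes_nest h with h | h
    · tauto
    · simp only [writes_seq, writes_branch, writes_ltD, writes_skip, writes_copyD] at h
      unfold NestReg
      tauto

theorem noStore_search {i : ℕ} : (search k g i).NoStore := by
  exact ⟨by simp, by simp, noStore_nest (by simp)⟩

theorem search_spec (P : Params w k g r n T pk) {U : ℕ → ℕ → ℕ} {i v : ℕ} (hi : i < r)
    {s : State w} (hs : Base k n T pk s) (hU : HasInput k n U s.mem) (hv : s.dbl k (vV i) = v) :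
    ∃ s' m, BigStep (search k g i) s s' m ∧ m ≤ (30 * g + 40) * n ^ g ∧ s'.peak ≤ pk ∧
      s'.dbl k vBest = nextGE (rangeSums n U g (i * g)) (k * 2 ^ w) v := by
  have hk := P.le_of_lt
  have hg := P.group_le hi
  have hw := P.pos
  -- High word `k` and low word `0` form the sentinel `k * 2 ^ w`, which exceeds every sum of a
  -- group and the target.
  obtain ⟨s₁, hb₁, hv₁, -⟩ := setD_spec k vBest (h := k) (l := 0) (by omega) (by omega) s
  obtain ⟨s₂, hb₂, hv₂, -⟩ := setD_spec k (vA (i * g)) (h := 0) (l := 0) (by omega) (by omega) s₁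
  have hmem : s₂.mem = s.mem := (hb₂.mem_eq (by simp)).trans (hb₁.mem_eq (by simp))
  have hs₂ : Base k n T pk s₂ := by
    refine (hs.of_noMem hb₁ ?_ (by simp) (by simp)).of_noMem hb₂ ?_ (by simp) (by simp) <;> simp
  have hsumle : ∀ j : ℕ → ℕ, (∀ x, i * g ≤ x → x < i * g + g → j x < n) →
      ∑ x ∈ Finset.Ico (i * g) (i * g + g), levelVal k n s.mem x (j x) =
        ∑ x ∈ Finset.Ico (i * g) (i * g + g), U x (j x) := fun j hj =>
    Finset.sum_congr rfl fun x hx => by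
      rw [Finset.mem_Ico] at hx
      exact hU x (by omega) _ (hj x hx.1 hx.2)
  -- A running minimum over the treated sums that are at least `v`, with the sentinel as the minimum
  -- of the empty set.
  let Inv : Set (ℕ → ℕ) → State w → Prop := fun X s =>
    s.dbl k (vV i) = v ∧
    (s.dbl k vBest = k * 2 ^ w ∨ s.dbl k vBest ∈ rangeSums n U g (i * g) ∧ v ≤ s.dbl k vBest) ∧
    s.dbl k vBest ≤ k * 2 ^ w ∧
    ∀ j ∈ X, v ≤ ∑ x ∈ Finset.Ico (i * g) (i * g + g), U x (j x) →
      s.dbl k vBest ≤ ∑ x ∈ Finset.Ico (i * g) (i * g + g), U x (j x)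
  obtain ⟨s₃, m, hb₃, hm, hp, hV, hbest, hle, hall⟩ := nest_spec (k := k) (T := T) (pk := pk)
    (r := r) (bnd := 2 ^ w) (μ := s.mem)
    (body := ltD k (vA (i * g + g)) (vV i) ;;
      .branch (lo k vTmp) (skip k) (ltD k (vA (i * g + g)) vBest ;;
        .branch (lo k vTmp) (copyD k vBest (vA (i * g + g))) (skip k)))
    P.n_lt P.cells_le P.n_pos (by simp) (fun _ => 25) g (i * g) 0 Inv ∅ (fun _ => 0) s₂
    (by omega)
    (fun x _ hx j hj => by
      rw [hU x (by omega) j hj]; exact (hU.lt (by omega) hj).le)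
    (by rw [Nat.zero_add]; exact Nat.mul_lt_mul_of_pos_right (by omega) (Nat.two_pow_pos w))
    (by
      rintro ρ (hρ | ⟨x, h1, h2, hρ⟩)
      · rcases hρ with rfl | rfl | rfl | rfl | rfl | rfl <;> simp
      · rcases hρ with rfl | rfl | rfl | rfl | rfl <;> simp)
    (by
      rintro X s s' hreg - ⟨h1, h2⟩
      have e1 : s'.dbl k (vV i) = s.dbl k (vV i) := by
        unfold State.dbl; rw [hreg _ (by simp [NestReg]), hreg _ (by simp [NestReg])]
      have e2 : s'.dbl k vBest = s.dbl k vBest := by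
        unfold State.dbl; rw [hreg _ (by simp [NestReg]), hreg _ (by simp [NestReg])]
      simp only [Inv, e1, e2]
      exact ⟨h1, h2⟩)
    (by
      rintro X j s' hj hs' hμ ⟨h1, h2, h3, h4⟩ - hsum
      rw [hsumle j hj.1, Nat.zero_add] at hsum
      have hmemj : s'.dbl k (vA (i * g + g)) ∈ rangeSums n U g (i * g) := ⟨j, hj.1, hsum.symm⟩
      have hlt : s'.dbl k (vA (i * g + g)) ≤ k * 2 ^ w := by
        rw [hsum]
        exact (hU.sum_lt P.g_pos hg hj.1).le.trans (Nat.mul_le_mul_right _ (by omega))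
      obtain ⟨t₁, hc₁, hlt₁⟩ := ltD_spec (k := k) (a := vA (i * g + g)) (b := vV i) hw s'
        (by simp) (by simp)
      have d1 : t₁.dbl k (vA (i * g + g)) = s'.dbl k (vA (i * g + g)) :=
        hc₁.dbl_eq (by simp) (by simp)
      have d2 : t₁.dbl k vBest = s'.dbl k vBest := hc₁.dbl_eq (by simp) (by simp)
      have d3 : t₁.dbl k (vV i) = s'.dbl k (vV i) := hc₁.dbl_eq (by simp) (by simp)
      have p1 := hc₁.peak_eq (by simp) (by simp)
      obtain ⟨t', m', hc', hm', hp', hI'⟩ := BigStep.branch hlt₁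
        (p := skip k) (q := ltD k (vA (i * g + g)) vBest ;;
          .branch (lo k vTmp) (copyD k vBest (vA (i * g + g))) (skip k))
        (Q := fun t m => m ≤ 15 ∧ t.peak ≤ pk ∧ Inv (X ∪ {j}) t)
        (by
          intro hlt
          obtain ⟨t, hc⟩ := skip_spec k t₁
          have e1 : t.dbl k vBest = s'.dbl k vBest := (hc.dbl_eq (by simp) (by simp)).trans d2
          have e2 : t.dbl k (vV i) = s'.dbl k (vV i) := (hc.dbl_eq (by simp) (by simp)).trans d3
          refine ⟨t, _, hc, by omega, ?_, ?_⟩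
          · rw [hc.peak_eq (by simp) (by simp), p1]; exact hs'.peak_le
          · simp only [Inv, e1, e2]
            refine ⟨h1, h2, h3, ?_⟩
            rintro j' (hj' | rfl) hvj
            · exact h4 j' hj' hvj
            · omega)
        (by
          intro hnlt
          obtain ⟨t₂, hc₂, hlt₂⟩ := ltD_spec (k := k) (a := vA (i * g + g)) (b := vBest) hw t₁
            (by simp) (by simp)
          have f1 : t₂.dbl k (vA (i * g + g)) = s'.dbl k (vA (i * g + g)) :=
            (hc₂.dbl_eq (by simp) (by simp)).trans d1
          have f2 : t₂.dbl k vBest = s'.dbl k vBest :=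
            (hc₂.dbl_eq (by simp) (by simp)).trans d2
          have f3 : t₂.dbl k (vV i) = s'.dbl k (vV i) :=
            (hc₂.dbl_eq (by simp) (by simp)).trans d3
          have p2 := hc₂.peak_eq (by simp) (by simp)
          rw [d1, d2] at hlt₂
          obtain ⟨t, m, hc, hm, hp, hI⟩ := BigStep.branch hlt₂
            (p := copyD k vBest (vA (i * g + g))) (q := skip k)
            (Q := fun t m => m ≤ 4 ∧ t.peak ≤ pk ∧ Inv (X ∪ {j}) t)
            (by
              intro hlt2
              obtain ⟨t, hc, hcp⟩ := copyD_spec k vBest (vA (i * g + g)) t₂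
              have e1 : t.dbl k vBest = s'.dbl k (vA (i * g + g)) := hcp.trans f1
              have e2 : t.dbl k (vV i) = s'.dbl k (vV i) :=
                (hc.dbl_eq (by simp) (by simp)).trans f3
              refine ⟨t, _, hc, by omega, ?_, ?_⟩
              · rw [hc.peak_eq (by simp) (by simp), p2, p1]; exact hs'.peak_le
              · simp only [Inv, e1, e2]
                refine ⟨h1, .inr ⟨hmemj, by omega⟩, hlt, ?_⟩
                rintro j' (hj' | rfl) hvj
                · exact hlt2.le.trans (h4 j' hj' hvj)
                · exact hsum.le)
            (by
              intro hnlt2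
              obtain ⟨t, hc⟩ := skip_spec k t₂
              have e1 : t.dbl k vBest = s'.dbl k vBest :=
                (hc.dbl_eq (by simp) (by simp)).trans f2
              have e2 : t.dbl k (vV i) = s'.dbl k (vV i) :=
                (hc.dbl_eq (by simp) (by simp)).trans f3
              refine ⟨t, _, hc, by omega, ?_, ?_⟩
              · rw [hc.peak_eq (by simp) (by simp), p2, p1]; exact hs'.peak_le
              · simp only [Inv, e1, e2]
                refine ⟨h1, h2, h3, ?_⟩
                rintro j' (hj' | rfl) hvj
                · exact h4 j' hj' hvj
                · omega)
          exact ⟨t, _, .seq hc₂ hc, by omega, hp, hI⟩)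
      exact ⟨t', _, .seq hc₁ hc', by omega, hp', hI'⟩)
    hs₂ hmem (by
      have e1 : s₂.dbl k vBest = k * 2 ^ w := by
        rw [hb₂.dbl_eq (by simp) (by simp), hv₁, Nat.add_zero]
      have e2 : s₂.dbl k (vV i) = v := by
        rw [hb₂.dbl_eq (by simp) (by simp), hb₁.dbl_eq (by simp) (by simp), hv]
      simp [Inv, e1, e2]) (by simpa using hv₂)
  refine ⟨s₃, _, .seq hb₁ (.seq hb₂ hb₃), ?_, hp, ?_⟩
  · rw [nestSum_const] at hm
    have : 1 ≤ n ^ g := Nat.one_le_pow _ _ P.n_pos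
    rw [Nat.add_mul]
    omega
  · refine (nextGE_eq hbest hle ?_).symm
    rintro d ⟨j, hj, rfl⟩ hvd
    -- The loops treat only sequences that vanish outside of the group; truncation does not change
    -- the sum.
    have hj' : (fun x => if i * g ≤ x ∧ x < i * g + g then j x else 0) ∈
        tuples n g (i * g) fun _ => 0 := by
      refine ⟨fun x h1 h2 => ?_, fun x hx => ?_⟩
      · simpa [h1, h2] using hj x h1 h2
      · simp only [if_neg hx]
    have hsum : ∑ x ∈ Finset.Ico (i * g) (i * g + g),
        U x (if i * g ≤ x ∧ x < i * g + g then j x else 0) =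
          ∑ x ∈ Finset.Ico (i * g) (i * g + g), U x (j x) :=
      Finset.sum_congr rfl fun x hx => by rw [Finset.mem_Ico] at hx; rw [if_pos hx]
    have := hall _ (.inr hj')
    rw [hsum] at this
    exact this hvd

end WordRAM

/-! ### Filling the block of a group. -/

namespace WordRAM

variable {w k g r n T pk : ℕ}

/-- The addresses stay below `2 ^ w`, so they do not wrap, and division by `n` recovers the array
and the position. -/
theorem Params.cell_inj (P : Params w k g r n T pk) {a a' j j' : ℕ} (ha : a < k + 2 * r)
    (ha' : a' < k + 2 * r) (hj : j < n) (hj' : j' < n) :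
    BitVec.ofNat w (a * n + j) = BitVec.ofNat w (a' * n + j') ↔ a = a' ∧ j = j' := by
  have cell : ∀ a j, a < k + 2 * r → j < n → a * n + j < 2 ^ w := by
    intro a j ha hj
    have h1 := Nat.mul_le_mul_right n (Nat.succ_le_of_lt ha)
    have h2 := P.cells_le
    have h3 := P.pk_le
    rw [Nat.succ_mul] at h1
    omega
  rw [← BitVec.toNat_inj, BitVec.toNat_ofNat, BitVec.toNat_ofNat,
    Nat.mod_eq_of_lt (cell a j ha hj), Nat.mod_eq_of_lt (cell a' j' ha' hj')]
  constructor
  · intro h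
    have h1 := congrArg (· / n) h
    have h2 := congrArg (· % n) h
    simp only [Nat.mul_comm _ n, Nat.mul_add_div P.n_pos, Nat.div_eq_of_lt hj,
      Nat.div_eq_of_lt hj', Nat.mul_add_mod, Nat.mod_eq_of_lt hj, Nat.mod_eq_of_lt hj',
      Nat.add_zero] at h1 h2
    exact ⟨h1, h2⟩
  · rintro ⟨rfl, rfl⟩; rfl

theorem Params.levelVal_update (P : Params w k g r n T pk) (μ : BitVec w → BitVec w)
    (h l : BitVec w) {x i p a : ℕ} (hx : x < k + r) (hi : i < r) (hp : p < n) (ha : a < n) :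
    levelVal k n (Function.update (Function.update μ
      (BitVec.ofNat w ((k + 2 * i) * n + a)) l)
      (BitVec.ofNat w ((k + 2 * i + 1) * n + a)) h) x p =
      if x = k + i ∧ p = a then dword h l else levelVal k n μ x p := by
  unfold levelVal
  simp only [Function.update_apply]
  by_cases hxk : x < k
  · have e1 := P.cell_inj (a := x) (a' := k + 2 * i + 1) (by omega) (by omega) hp ha
    have e2 := P.cell_inj (a := x) (a' := k + 2 * i) (by omega) (by omega) hp ha
    simp only [if_pos hxk, e1, e2]
    rw [if_neg (by omega), if_neg (by omega), if_neg (by omega)]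
  · have e : ∀ u v, u < 2 → v < 2 → (BitVec.ofNat w ((k + 2 * (x - k) + u) * n + p) =
        BitVec.ofNat w ((k + 2 * i + v) * n + a) ↔
        k + 2 * (x - k) + u = k + 2 * i + v ∧ p = a) := fun u v hu hv =>
      P.cell_inj (by omega) (by omega) hp ha
    have e1 := e 1 1 (by omega) (by omega)
    have e2 := e 1 0 (by omega) (by omega)
    have e3 := e 0 1 (by omega) (by omega)
    have e4 := e 0 0 (by omega) (by omega)
    simp only [Nat.add_zero] at e2 e3 e4
    simp only [if_neg hxk, e1, e2, e3, e4]
    by_cases h' : x = k + i ∧ p = a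
    · obtain ⟨rfl, rfl⟩ := h'
      simp
    · rw [if_neg h', if_neg (by omega), if_neg (by omega), if_neg (by omega), if_neg (by omega)]

/-- The sums of group `i`. -/
abbrev groupSums (n g : ℕ) (U : ℕ → ℕ → ℕ) (i : ℕ) : Set ℕ := rangeSums n U g (i * g)

/-- Fill the block of group `i` with the next `n` sums. -/
def fetch (k g i : ℕ) : Cmd :=
  forN k (vF i) (search k g i ;; storeCell k (lo k vBest) (k + 2 * i) (vF i) ;;
    storeCell k (hi k vBest) (k + 2 * i + 1) (vF i) ;; addD k (vV i) vBest vOne)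

theorem writes_fetch {i ρ : ℕ} (h : (fetch k g i).Writes ρ) :
    ρ = lo k (vF i) ∨ ρ = lo k (vV i) ∨ ρ = hi k (vV i) ∨
      ρ = lo k vBest ∨ ρ = hi k vBest ∨ ρ = lo k (vA (i * g)) ∨ ρ = hi k (vA (i * g)) ∨
      NestReg k g (i * g) ρ := by
  simp only [fetch, writes_forN, writes_seq, writes_storeCell, writes_addD] at h
  have h1 := writes_search (k := k) (g := g) (i := i) (ρ := ρ)
  have h2 : ρ = lo k vTmp → NestReg k g (i * g) ρ := .inl
  tauto

theorem keepsConst_search {i : ℕ} : (search k g i).KeepsConst k := by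
  intro ρ hρ h
  have hn := not_nestReg_constReg (c := g) (l := i * g) hρ
  rcases hρ with rfl | rfl | rfl | rfl | rfl | rfl <;> simpa [hn] using writes_search h

theorem keepsConst_fetch {i : ℕ} : (fetch k g i).KeepsConst k := by
  intro ρ hρ h
  have hn := not_nestReg_constReg (c := g) (l := i * g) hρ
  rcases hρ with rfl | rfl | rfl | rfl | rfl | rfl <;> simpa [hn] using writes_fetch h

theorem Base.dbl_one {s : State w} (hs : Base k n T pk s) (hw : 0 < w) : s.dbl k vOne = 1 := by
  have : 1 < 2 ^ w := Nat.one_lt_two_pow hw.ne'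
  simp [State.dbl, hs.one_lo, hs.one_hi, dword, Nat.mod_eq_of_lt this]

theorem Params.fetch_spec (P : Params w k g r n T pk) {U : ℕ → ℕ → ℕ} {i q : ℕ} (hir : i < r)
    {s : State w} (hs : Base k n T pk s) (hU : HasInput k n U s.mem)
    (hv : s.dbl k (vV i) = lowerBd (groupSums n g U i) (k * 2 ^ w) q) :
    ∃ s' m, BigStep (fetch k g i) s s' m ∧ m ≤ (30 * g + 70) * n ^ (g + 1) ∧ s'.peak ≤ pk ∧
      s'.dbl k (vV i) = lowerBd (groupSums n g U i) (k * 2 ^ w) (q + n) ∧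
      s'.dbl k vBest = nthElt (groupSums n g U i) (k * 2 ^ w) (q + (n - 1)) ∧
      (∀ p < n, levelVal k n s'.mem (k + i) p =
        nthElt (groupSums n g U i) (k * 2 ^ w) (q + (n - 1 - p))) ∧
      ∀ x < k + r, x ≠ k + i → ∀ p < n, levelVal k n s'.mem x p = levelVal k n s.mem x p := by
  have hw := P.pos
  set D := groupSums n g U i with hD
  set b := k * 2 ^ w with hb
  -- With `a` passes left, the positions from `a` on are filled. As the counter descends, the block
  -- is stored in reverse: position `p` holds the element `q + (n - 1 - p)`. The guard `a < n` is
  -- there because `vBest` has no meaning before the first search.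
  let Inv : ℕ → State w → Prop := fun a t => Base k n T pk t ∧
    t.dbl k (vV i) = lowerBd D b (q + (n - a)) ∧
    (a < n → t.dbl k vBest = nthElt D b (q + (n - 1 - a))) ∧
    (∀ p < n, a ≤ p → levelVal k n t.mem (k + i) p = nthElt D b (q + (n - 1 - p))) ∧
    ∀ x < k + r, x ≠ k + i → ∀ p < n, levelVal k n t.mem x p = levelVal k n s.mem x p
  have hnr : ∀ c l ρ, (ρ = lo k (vF i) ∨ ρ = lo k (vV i) ∨ ρ = hi k (vV i)) →
      ¬ NestReg k c l ρ := by
    rintro c l ρ h (h' | h' | ⟨x, -, -, h'⟩) <;> rcases h with rfl | rfl | rfl <;> simp at h'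
  have hsF : ¬ (search k g i).Writes (lo k (vF i)) := fun h => by
    simpa [hnr] using writes_search h
  obtain ⟨s', m, h1, h2, h3, h4, h5, h6, h7⟩ := forN_spec (k := k) (i := vF i) (s := s)
    (body := search k g i ;; storeCell k (lo k vBest) (k + 2 * i) (vF i) ;;
      storeCell k (hi k vBest) (k + 2 * i + 1) (vF i) ;; addD k (vV i) vBest vOne)
    (fun _ => (30 * g + 40) * n ^ g + 24) Inv P.n_lt (by simp)
    (by simp [hsF])
    (by
      have := keepsConst_search (k := k) (g := g) (i := i)
      rw [keepsConst_iff] at this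
      simp [this.2.1])
    (by
      rintro a t x ⟨h1, h2, h3, h4⟩
      refine ⟨h1.of_reg_eq (fun ρ hρ => ?_) h1.peak_le, ?_, ?_, h4⟩
      · exact Function.update_of_ne (by rcases hρ with rfl | rfl | rfl | rfl | rfl | rfl <;> simp)
          _ _
      · simpa [State.dbl, State.setReg] using h2
      · simpa [State.dbl, State.setReg] using h3)
    (by
      rintro a t han ⟨ht, hV, -, hblk, hoth⟩ hidx
      have hUt : HasInput k n U t.mem := fun x hx j hj => by
        rw [hoth x (by omega) (by omega) j hj]; exact hU x hx j hj
      obtain ⟨t₁, m₁, hc₁, hm₁, hp₁, hB₁⟩ := search_spec P hir ht hUt hV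
      have ht₁ := ht.of_bigStep hc₁ keepsConst_search hp₁
      have hmem₁ := hc₁.mem_eq noStore_search
      have hidx₁ : t₁.reg (lo k (vF i)) = BitVec.ofNat w a := by rw [hc₁.reg_eq hsF, hidx]
      obtain ⟨t₂, hc₂, hmem₂, hp₂⟩ := storeCell_spec (k := k) (n := n) (d := lo k vBest)
        (a := k + 2 * i) (i := vF i) (j := a) (s := t₁) (by simp) (by simp) ht₁.n_eq hidx₁
      obtain ⟨t₃, hc₃, hmem₃, hp₃⟩ := storeCell_spec (k := k) (n := n) (d := hi k vBest)
        (a := k + 2 * i + 1) (i := vF i) (j := a) (s := t₂) (by simp) (by simp)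
        (by rw [hc₂.reg_eq (by simp), ht₁.n_eq]) (by rw [hc₂.reg_eq (by simp), hidx₁])
      have hcell : ∀ x, x < k + 2 * r → x * n + a + 1 ≤ pk := fun x hx => by
        have h1 := Nat.mul_le_mul_right n (Nat.succ_le_of_lt hx)
        have h2 := P.cells_le
        rw [Nat.succ_mul] at h1
        omega
      have hp₂ : t₂.peak ≤ pk := hp₂.trans (max_le ht₁.peak_le (hcell _ (by omega)))
      have hp₃ : t₃.peak ≤ pk := hp₃.trans (max_le hp₂ (hcell _ (by omega)))
      have ht₃ : Base k n T pk t₃ := by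
        exact (ht₁.of_bigStep hc₂ (keepsConst_iff.2 (by simp)) hp₂).of_bigStep hc₃
          (keepsConst_iff.2 (by simp)) hp₃
      have hV₃ : t₃.dbl k (vV i) = lowerBd D b (q + (n - (a + 1))) := by
        rw [hc₃.dbl_eq (by simp) (by simp), hc₂.dbl_eq (by simp) (by simp), hc₁.dbl_eq, hV]
        · intro h; simpa [hnr] using writes_search h
        · intro h; simpa [hnr] using writes_search h
      have hB₃ : t₃.dbl k vBest = nthElt D b (q + (n - (a + 1))) := by
        rw [hc₃.dbl_eq (by simp) (by simp), hc₂.dbl_eq (by simp) (by simp), hB₁]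
        rfl
      obtain ⟨t₄, hc₄, hV₄⟩ := addD_spec (k := k) (x := vV i) (a := vBest) (b := vOne) t₃
        (by simp) (by simp) (by
          rw [hB₃, ht₃.dbl_one hw]
          have h1 := nthElt_le (D := D) (b := b) (q + (n - (a + 1)))
          have h2 := Nat.mul_le_mul_right (2 ^ w) (Nat.succ_le_of_lt P.le_of_lt)
          have h3 := Nat.two_pow_pos w
          simp only [Nat.succ_mul] at h2
          omega)
      have hmem₄ : t₄.mem = Function.update (Function.update t.mem
          (BitVec.ofNat w ((k + 2 * i) * n + a)) (t₁.reg (lo k vBest)))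
          (BitVec.ofNat w ((k + 2 * i + 1) * n + a)) (t₁.reg (hi k vBest)) := by
        rw [hc₄.mem_eq (by simp), hmem₃, hmem₂, hmem₁, hc₂.reg_eq (by simp)]
      have hlv : ∀ x < k + r, ∀ p < n, levelVal k n t₄.mem x p =
          if x = k + i ∧ p = a then t₁.dbl k vBest else levelVal k n t.mem x p := by
        intro x hx p hp
        rw [hmem₄, P.levelVal_update _ _ _ hx hir hp han]
        rfl
      refine ⟨t₄, _, .seq hc₁ (.seq hc₂ (.seq hc₃ hc₄)), by omega, ?_, ?_, ?_, ?_, ?_⟩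
      · exact ht₃.of_noMem hc₄ (by simp) (by simp) (by simp)
      · rw [hV₄, hB₃, ht₃.dbl_one hw, ← lowerBd_succ]
        congr 1
        omega
      · intro _
        rw [hc₄.dbl_eq (by simp) (by simp), hB₃]
        congr 1
        omega
      · intro p hp hap
        rw [hlv _ (by omega) p hp]
        by_cases hpa : p = a
        · rw [if_pos ⟨rfl, hpa⟩, hB₁, hpa]
          change nthElt D b _ = _
          congr 1
          omega
        · rw [if_neg (by omega)]
          exact hblk p hp (by omega)
      · intro x hx hxi p hp
        rw [hlv x hx p hp, if_neg (by omega)]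
        exact hoth x hx hxi p hp)
    hs.n_eq hs.one_lo
    ⟨hs, by simpa using hv, fun h => absurd h (lt_irrefl _), fun p hp hp' => by omega,
      fun _ _ _ _ _ => rfl⟩
  refine ⟨s', m, h1, h2.trans ?_, h3.peak_le, h4, h5 P.n_pos, fun p hp => h6 p hp (Nat.zero_le _),
    h7⟩
  rw [Finset.sum_const, Finset.card_range, smul_eq_mul]
  have : n * 1 ≤ n * n ^ g := Nat.mul_le_mul_left n (Nat.one_le_pow _ _ P.n_pos)
  have := P.n_pos
  calc n * ((30 * g + 40) * n ^ g + 24 + 3) + 3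
      = (30 * g + 40) * (n * n ^ g) + 27 * n + 3 := by ring
    _ ≤ (30 * g + 40) * (n * n ^ g) + 30 * (n * n ^ g) := by omega
    _ = (30 * g + 70) * n ^ (g + 1) := by ring

end WordRAM

/-! ### Trying the block entries and recording a solution. -/

namespace WordRAM

variable {w k g r n T pk : ℕ}

/-- A scratch register pair. -/
abbrev vX : ℕ := Nat.pair 0 6

/-- The sum of the lower bounds of the current blocks of the groups below `i`. -/
abbrev vLS (i : ℕ) : ℕ := Nat.pair 5 i

/-- The sum of the last entries of the current blocks of the groups below `i`. -/
abbrev vUS (i : ℕ) : ℕ := Nat.pair 6 i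

/-- The contribution of group `i` to the solution found. -/
abbrev vW (i : ℕ) : ℕ := Nat.pair 7 i

/-- Write the original values of the current entries of the `c` levels from `l` on to the output
registers. -/
def outs (k : ℕ) : ℕ → ℕ → Cmd
  | 0, _ => skip k
  | c + 1, l => .op .sub (l + 1) (lo k (vE l)) (lo k vMsb) ;; outs k c (l + 1)

/-- Save the current block entries of the `c` groups from `i` on. -/
def saves (k : ℕ) : ℕ → ℕ → Cmd
  | 0, _ => skip k
  | c + 1, i => copyD k (vW i) (vE (k + i)) ;; saves k c (i + 1)

/-- The original value of an array entry that has been shifted to `u`. -/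
def outVal (w u : ℕ) : BitVec w := BitVec.ofNat w u - BitVec.ofNat w (2 ^ (w - 1))

/-- Shifted input entries have high word zero, so their low word can be computed from the value of
the pair; this identifies the words written to the output. -/
theorem State.reg_lo (s : State w) (x : ℕ) : s.reg (lo k x) = BitVec.ofNat w (s.dbl k x) := by
  apply BitVec.eq_of_toNat_eq
  rw [BitVec.toNat_ofNat, State.dbl, dword, Nat.mul_comm, Nat.mul_add_mod,
    Nat.mod_eq_of_lt (BitVec.isLt _)]

theorem writes_outs {c l ρ : ℕ} (h : (outs k c l).Writes ρ) :
    ρ = lo k vTmp ∨ ∃ x, l ≤ x ∧ x < l + c ∧ ρ = x + 1 := by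
  induction c generalizing l with
  | zero => exact .inl h
  | succ c ih =>
    rcases h with h | h
    · exact .inr ⟨l, le_rfl, by omega, h⟩
    · rcases ih h with h | ⟨x, h1, h2, h3⟩
      · exact .inl h
      · exact .inr ⟨x, by omega, by omega, h3⟩

theorem writes_outs_lo {c l x : ℕ} (hl : l + c ≤ k) (hx : x ≠ vTmp) :
    ¬ (outs k c l).Writes (lo k x) := by
  intro h
  rcases writes_outs h with h | ⟨y, h1, h2, h3⟩
  · simp [hx] at h
  · have := lo_gt k x; omega

theorem writes_outs_hi {c l x : ℕ} (hl : l + c ≤ k) : ¬ (outs k c l).Writes (hi k x) := by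
  intro h
  rcases writes_outs h with h | ⟨y, h1, h2, h3⟩
  · simp at h
  · have := hi_gt k x; omega

@[simp] theorem noStore_outs {c l : ℕ} : (outs k c l).NoStore := by
  induction c generalizing l with
  | zero => simp [outs]
  | succ c ih => simp [outs, ih]

@[simp] theorem noLoad_outs {c l : ℕ} : (outs k c l).NoLoad := by
  induction c generalizing l with
  | zero => simp [outs]
  | succ c ih => simp [outs, ih]

theorem outs_spec {c l : ℕ} (hl : l + c ≤ k) (s : State w) :
    ∃ s', BigStep (outs k c l) s s' (2 * c + 1) ∧ ∀ x, l ≤ x → x < l + c →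
      s'.reg (x + 1) = s.reg (lo k (vE x)) - s.reg (lo k vMsb) := by
  induction c generalizing l s with
  | zero =>
    obtain ⟨s', hb⟩ := skip_spec k s
    exact ⟨s', hb, fun x _ _ => by omega⟩
  | succ c ih =>
    obtain ⟨s', hb, h⟩ := ih (l := l + 1) (by omega)
      (s.setReg (l + 1) (Op.sub.eval (s.reg (lo k (vE l))) (s.reg (lo k vMsb))))
    refine ⟨s', ?_, fun x h1 h2 => ?_⟩
    · have := BigStep.seq (.op .sub (l + 1) (lo k (vE l)) (lo k vMsb) s) hb
      rwa [show 1 + (2 * c + 1) + 1 = 2 * (c + 1) + 1 by ring] at this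
    · rcases h1.eq_or_lt with rfl | h1
      · rw [hb.reg_eq]
        · simp [State.setReg, Op.eval]
        · intro h
          rcases writes_outs h with h | ⟨y, h1, h2, h3⟩
          · have := lo_gt k vTmp; omega
          · omega
      · rw [h x (by omega) (by omega)]
        have h3 := lo_gt k (vE x)
        have h4 := lo_gt k vMsb
        simp only [State.setReg]
        rw [Function.update_of_ne (by omega), Function.update_of_ne (by omega)]

theorem writes_saves {c i ρ : ℕ} (h : (saves k c i).Writes ρ) :
    ρ = lo k vTmp ∨ ∃ x, i ≤ x ∧ x < i + c ∧ (ρ = lo k (vW x) ∨ ρ = hi k (vW x)) := by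
  induction c generalizing i with
  | zero => exact .inl h
  | succ c ih =>
    simp only [saves, writes_seq, writes_copyD] at h
    rcases h with h | h
    · exact .inr ⟨i, le_rfl, by omega, h.symm⟩
    · rcases ih h with h | ⟨x, h1, h2, h3⟩
      · exact .inl h
      · exact .inr ⟨x, by omega, by omega, h3⟩

@[simp] theorem noStore_saves {c i : ℕ} : (saves k c i).NoStore := by
  induction c generalizing i with
  | zero => simp [saves]
  | succ c ih => simp [saves, ih]

@[simp] theorem noLoad_saves {c i : ℕ} : (saves k c i).NoLoad := by
  induction c generalizing i with
  | zero => simp [saves]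
  | succ c ih => simp [saves, ih]

theorem saves_spec (c i : ℕ) (s : State w) :
    ∃ s', BigStep (saves k c i) s s' (4 * c + 1) ∧ ∀ x, i ≤ x → x < i + c →
      s'.dbl k (vW x) = s.dbl k (vE (k + x)) := by
  induction c generalizing i s with
  | zero =>
    obtain ⟨s', hb⟩ := skip_spec k s
    exact ⟨s', hb, fun x _ _ => by omega⟩
  | succ c ih =>
    obtain ⟨s₁, hb₁, h₁⟩ := copyD_spec k (vW i) (vE (k + i)) s
    obtain ⟨s', hb, h⟩ := ih (i + 1) s₁
    refine ⟨s', ?_, fun x h1 h2 => ?_⟩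
    · have := BigStep.seq hb₁ hb
      rwa [show 3 + (4 * c + 1) + 1 = 4 * (c + 1) + 1 by ring] at this
    · rcases h1.eq_or_lt with rfl | h1
      · rw [hb.dbl_eq, h₁] <;>
        · intro h
          rcases writes_saves h with h | ⟨y, h1, h2, h3⟩
          · simp at h
          · simp at h3; omega
      · rw [h x (by omega) (by omega), hb₁.dbl_eq (by simp) (by simp)]

/-- Record the current choice of entries as a solution. -/
def record (k g r : ℕ) : Cmd := .const 0 1 ;; outs k (k - r * g) (r * g) ;; saves k r 0

theorem writes_record (hrg : r * g ≤ k) {ρ : ℕ} (h : (record k g r).Writes ρ) :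
    ρ ≤ k ∨ ρ = lo k vTmp ∨ ∃ x, ρ = lo k (vW x) ∨ ρ = hi k (vW x) := by
  rcases h with h | h | h
  · left; rw [h]; omega
  · rcases writes_outs h with h | ⟨x, h1, h2, h3⟩
    · exact .inr (.inl h)
    · left; omega
  · rcases writes_saves h with h | ⟨x, -, -, h⟩
    · exact .inr (.inl h)
    · exact .inr (.inr ⟨x, h⟩)

theorem record_spec (hrg : r * g ≤ k) (s : State w) :
    ∃ s' m, BigStep (record k g r) s s' m ∧ m ≤ 2 * k + 4 * r + 5 ∧ s'.peak = s.peak ∧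
      s'.reg 0 = 1#w ∧
      (∀ x, r * g ≤ x → x < k →
        s'.reg (x + 1) = s.reg (lo k (vE x)) - s.reg (lo k vMsb)) ∧
      ∀ i < r, s'.dbl k (vW i) = s.dbl k (vE (k + i)) := by
  have hlo := lo_gt k
  have hhi := hi_gt k
  have hne : ∀ x (y : BitVec w), (s.setReg 0 y).dbl k x = s.dbl k x := by
    intro x y
    simp only [State.dbl, State.setReg]
    have := hlo x
    have := hhi x
    rw [Function.update_of_ne (by omega), Function.update_of_ne (by omega)]
  obtain ⟨s₁, hb₁, h₁⟩ := outs_spec (k := k) (c := k - r * g) (l := r * g) (by omega)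
    (s.setReg 0 (BitVec.ofNat w 1))
  obtain ⟨s₂, hb₂, h₂⟩ := saves_spec (k := k) r 0 s₁
  have hsv : ∀ ρ ≤ k, ¬ (saves k r 0).Writes ρ := by
    intro ρ hρ h
    rcases writes_saves h with h | ⟨x, -, -, h | h⟩
    · have := hlo vTmp; omega
    · have := hlo (vW x); omega
    · have := hhi (vW x); omega
  refine ⟨s₂, _, .seq (.const _ _ _) (.seq hb₁ hb₂), by omega, ?_, ?_, ?_, ?_⟩
  · rw [hb₂.peak_eq (by simp) (by simp), hb₁.peak_eq (by simp) (by simp)]; rfl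
  · rw [hb₂.reg_eq (hsv 0 (by omega)), hb₁.reg_eq]
    · simp [State.setReg]
    · intro h
      rcases writes_outs h with h | ⟨x, -, -, h⟩
      · have := hlo vTmp; omega
      · omega
  · intro x hx hxk
    rw [hb₂.reg_eq (hsv _ (by omega)), h₁ x hx (by omega)]
    have := hlo (vE x)
    have := hlo vMsb
    simp only [State.setReg]
    rw [Function.update_of_ne (by omega), Function.update_of_ne (by omega)]
  · intro i hi
    rw [h₂ i (Nat.zero_le _) (by omega), hb₁.dbl_eq (writes_outs_lo (by omega) (by simp))
      (writes_outs_hi (by omega)), hne]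

/-- Either no solution has been recorded, or the recorded one is right: the output registers of the
arrays outside of the groups contain entries that give the target together with a sum of each
group. -/
def Good (k g r n T : ℕ) (U : ℕ → ℕ → ℕ) (s : State w) : Prop :=
  s.reg 0 = 0#w ∨ s.reg 0 = 1#w ∧ ∃ j : ℕ → ℕ,
    (∀ x, r * g ≤ x → x < k → j x < n ∧ s.reg (x + 1) = outVal w (U x (j x))) ∧
    (∀ i < r, s.dbl k (vW i) ∈ groupSums n g U i) ∧
    ∑ i ∈ Finset.range r, s.dbl k (vW i) + ∑ x ∈ Finset.Ico (r * g) k, U x (j x) = T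

/-- The registers that hold the recorded solution. -/
def OutReg (k ρ : ℕ) : Prop := ρ ≤ k ∨ ∃ i, ρ = lo k (vW i) ∨ ρ = hi k (vW i)

theorem Good.congr {U : ℕ → ℕ → ℕ} {s s' : State w} (h : Good k g r n T U s)
    (hreg : ∀ ρ, OutReg k ρ → s'.reg ρ = s.reg ρ) : Good k g r n T U s' := by
  have hd : ∀ i, s'.dbl k (vW i) = s.dbl k (vW i) := by
    intro i
    unfold State.dbl
    rw [hreg _ (.inr ⟨i, .inl rfl⟩), hreg _ (.inr ⟨i, .inr rfl⟩)]
  unfold Good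
  simp only [hd]
  rw [hreg 0 (.inl (by omega))]
  refine h.imp_right fun ⟨h1, j, h2, h3⟩ => ⟨h1, j, fun x hx hxk => ?_, h3⟩
  rw [hreg (x + 1) (.inl (by omega))]
  exact h2 x hx hxk

/-- Loops do not damage a recorded solution, since it lives in the registers up to `k` and in pairs
with a tag of their own. -/
theorem not_nestReg_outReg {c l ρ : ℕ} (h : OutReg k ρ) : ¬ NestReg k c l ρ := by
  have hlo := lo_gt k
  have hhi := hi_gt k
  rintro (h' | h' | ⟨x, -, -, h' | h' | h' | h' | h'⟩) <;>
  · rcases h with h | ⟨i, h | h⟩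
    · rw [h'] at h
      first
      | exact absurd h (not_le.2 (lt_of_le_of_lt (by omega) (hlo _)))
      | exact absurd h (not_le.2 (lt_of_le_of_lt (by omega) (hhi _)))
    all_goals · rw [h'] at h; simp at h

/-- The blocks number `J i'` of the groups `i' < i` are in memory. -/
structure Blocks (k g n : ℕ) (U : ℕ → ℕ → ℕ) (i : ℕ) (J : ℕ → ℕ) (s : State w) : Prop where
  input : HasInput k n U s.mem
  vals : ∀ i' < i, ∀ p < n, levelVal k n s.mem (k + i') p =
    nthElt (groupSums n g U i') (k * 2 ^ w) (J i' * n + (n - 1 - p))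
  lower : s.dbl k (vLS i) =
    ∑ i' ∈ Finset.range i, lowerBd (groupSums n g U i') (k * 2 ^ w) (J i' * n)
  upper : s.dbl k (vUS i) =
    ∑ i' ∈ Finset.range i, nthElt (groupSums n g U i') (k * 2 ^ w) (J i' * n + (n - 1))

/-- The largest quantity to be added up consists of `r` lower bounds, each at most `k * 2 ^ w + 1`,
and a sum of entries outside the groups, at most `k * 2 ^ w`. -/
theorem Params.bound (P : Params w k g r n T pk) :
    (r + 1) * (k * 2 ^ w) + r < 2 ^ w * 2 ^ w := by
  have h1 := P.word
  have h2 : r < 2 ^ w := by nlinarith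
  have h3 : ((r + 1) * k + 1) * 2 ^ w ≤ 2 ^ w * 2 ^ w :=
    Nat.mul_le_mul_right _ (by nlinarith)
  calc (r + 1) * (k * 2 ^ w) + r < ((r + 1) * k + 1) * 2 ^ w := by
        rw [Nat.add_mul _ 1 (2 ^ w), Nat.mul_assoc]; omega
    _ ≤ _ := h3

theorem HasInput.sum_le {U : ℕ → ℕ → ℕ} {μ : BitVec w → BitVec w} (h : HasInput k n U μ)
    {l : ℕ} {j : ℕ → ℕ} (hj : ∀ x, l ≤ x → x < k → j x < n) :
    ∑ x ∈ Finset.Ico l k, U x (j x) ≤ k * 2 ^ w := by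
  have : ∑ x ∈ Finset.Ico l k, U x (j x) ≤ ∑ x ∈ Finset.Ico l k, 2 ^ w :=
    Finset.sum_le_sum fun x hx => by
      rw [Finset.mem_Ico] at hx
      exact (h.lt hx.2 (hj x hx.1 hx.2)).le
  refine this.trans ?_
  rw [Finset.sum_const, Nat.card_Ico, smul_eq_mul]
  exact Nat.mul_le_mul_right _ (Nat.sub_le _ _)

/-- Look for a solution with the current sum in `vA k` and one entry of every current block. -/
def join (k g r : ℕ) : Cmd :=
  nest k r k (eqD k (vA (k + r)) vT ;; .branch (lo k vTmp) (record k g r) (skip k))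

theorem noStore_record : (record k g r).NoStore := by simp [record]

theorem noStore_join : (join k g r).NoStore := noStore_nest (by simp [noStore_record])

/-- A record is made only on equality with the target, so `Good` is preserved, and register 0 is
never reset to zero. There is no early exit: later hits merely replace the record by another correct
one. -/
theorem Params.join_spec (P : Params w k g r n T pk) {U : ℕ → ℕ → ℕ} {J j : ℕ → ℕ} {s : State w}
    (hs : Base k n T pk s) (hB : Blocks k g n U r J s) (hG : Good k g r n T U s)
    (hj : ∀ x, r * g ≤ x → x < k → j x < n ∧ s.dbl k (vE x) = U x (j x))
    (hA : s.dbl k (vA k) = ∑ x ∈ Finset.Ico (r * g) k, U x (j x)) :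
    ∃ s' m, BigStep (join k g r) s s' m ∧ m ≤ (2 * k + 34 * r + 15) * n ^ r ∧ s'.peak ≤ pk ∧
      Good k g r n T U s' ∧ (s.reg 0 = 1#w → s'.reg 0 = 1#w) ∧
      ∀ p : ℕ → ℕ, (∀ i < r, p i < n) →
        ∑ i ∈ Finset.range r, levelVal k n s.mem (k + i) (p i) +
          ∑ x ∈ Finset.Ico (r * g) k, U x (j x) = T → s'.reg 0 = 1#w := by
  have hw := P.pos
  have hlo := lo_gt k
  have hhi := hi_gt k
  have hval : ∀ x, k ≤ x → x < k + r → ∀ p, p < n → levelVal k n s.mem x p ≤ k * 2 ^ w := by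
    intro x hx hx' p hp
    obtain ⟨i, rfl⟩ := Nat.exists_eq_add_of_le hx
    rw [hB.vals i (by omega) p hp]
    exact nthElt_le _
  have hy := hB.input.sum_le (l := r * g) (j := j) (fun x h1 h2 => (hj x h1 h2).1)
  let Inv : Set (ℕ → ℕ) → State w → Prop := fun X t =>
    Good k g r n T U t ∧ (∀ x, r * g ≤ x → x < k → t.dbl k (vE x) = U x (j x)) ∧
    (s.reg 0 = 1#w → t.reg 0 = 1#w) ∧
    ∀ p ∈ X, ∑ x ∈ Finset.Ico (r * g) k, U x (j x) +
      ∑ x ∈ Finset.Ico k (k + r), levelVal k n s.mem x (p x) = T → t.reg 0 = 1#w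
  obtain ⟨s', m, hb, hm, hp, hG', -, hmono, hall⟩ := nest_spec (k := k) (T := T) (pk := pk)
    (r := r) (bnd := k * 2 ^ w) (μ := s.mem)
    (body := eqD k (vA (k + r)) vT ;; .branch (lo k vTmp) (record k g r) (skip k))
    P.n_lt P.cells_le P.n_pos (by simp [noStore_record]) (fun _ => 2 * k + 4 * r + 15) r k
    (∑ x ∈ Finset.Ico (r * g) k, U x (j x)) Inv ∅ (fun _ => 0) s le_rfl hval
    (by have := P.bound; rw [Nat.add_mul, Nat.one_mul] at this; omega)
    (by
      intro ρ hρ h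
      simp only [writes_seq, writes_eqD, writes_branch, writes_skip] at h
      have h' : ρ ≤ k ∨ ρ = lo k vTmp ∨ ρ = hi k vTmp ∨ ∃ x, ρ = lo k (vW x) ∨ ρ = hi k (vW x) := by
        rcases h with (h | h) | h | h
        · exact .inr (.inl h)
        · exact .inr (.inr (.inl h))
        · exact (writes_record P.groups_le h).imp_right (Or.imp_right .inr)
        · exact .inr (.inl h)
      have key : ρ > k := by
        rcases hρ with (h | h | h | h | h | h) | ⟨x, -, -, h | h | h | h | h⟩ <;> rw [h] <;>
        first
        | exact lt_of_le_of_lt (by omega) (hlo _)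
        | exact lt_of_le_of_lt (by omega) (hhi _)
      rcases h' with h' | rfl | rfl | ⟨x, rfl | rfl⟩
      · omega
      all_goals
        rcases hρ with (h | h | h | h | h | h) | ⟨x, -, -, h | h | h | h | h⟩ <;> simp at h)
    (by
      rintro X t t' hreg - ⟨h1, h2, h3, h4⟩
      have e0 : t'.reg 0 = t.reg 0 := hreg 0 (not_nestReg_outReg (.inl (by omega)))
      refine ⟨h1.congr fun ρ hρ => hreg ρ (not_nestReg_outReg hρ), fun x hx hxk => ?_, ?_, ?_⟩
      · rw [← h2 x hx hxk]
        unfold State.dbl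
        rw [hreg, hreg] <;>
        · rintro (h | h | ⟨y, h1, -, h⟩)
          · simp at h
          · simp at h
          · simp at h; omega
      · rwa [e0]
      · rwa [e0])
    (by
      rintro X p t hp ht hμ ⟨h1, h2, h3, h4⟩ hE hsum
      obtain ⟨t₁, hc₁, hT⟩ := eqD_spec (k := k) (a := vA (k + r)) (b := vT) hw t
      have d1 : ∀ x, t₁.dbl k (vE x) = t.dbl k (vE x) := fun x => hc₁.dbl_eq (by simp) (by simp)
      have r1 : ∀ ρ, OutReg k ρ → t₁.reg ρ = t.reg ρ := fun ρ hρ => hc₁.reg_eq (by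
        rw [writes_eqD]
        rintro (h | h)
        · exact not_nestReg_outReg (c := 0) (l := 0) hρ (.inl h)
        · exact not_nestReg_outReg (c := 0) (l := 0) hρ (.inr (.inl h)))
      have p1 := hc₁.peak_eq (by simp) (by simp)
      rw [hsum, ht.target] at hT
      have hmsb : t₁.reg (lo k vMsb) = BitVec.ofNat w (2 ^ (w - 1)) := by
        rw [hc₁.reg_eq (by simp), ht.msb]
      obtain ⟨t', m', hc', hm', hp', hI'⟩ := BigStep.branch hT (p := record k g r) (q := skip k)
        (Q := fun u m => m ≤ 2 * k + 4 * r + 6 ∧ u.peak ≤ pk ∧ Inv (X ∪ {p}) u)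
        (by
          intro hsumT
          obtain ⟨u, m, hc, hm, hpu, hu0, huo, hus⟩ := record_spec P.groups_le t₁
          refine ⟨u, m, hc, by omega, ?_, .inr ⟨hu0, j, ?_, ?_, ?_⟩, ?_, fun _ => hu0,
            fun _ _ _ => hu0⟩
          · rw [hpu, p1]; exact ht.peak_le
          · intro x hx hxk
            refine ⟨(hj x hx hxk).1, ?_⟩
            rw [huo x hx hxk, hmsb, State.reg_lo, d1, h2 x hx hxk]
            rfl
          · intro i hi
            rw [hus i hi, d1, hE (k + i) (by omega) (by omega),
              hB.vals i hi _ (hp.1 _ (by omega) (by omega))]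
            -- A sentinel among the entries would by itself exceed the target, so the entries of a
            -- hit are genuine group sums.
            apply nthElt_mem
            intro heq
            have hle : levelVal k n s.mem (k + i) (p (k + i)) ≤
                ∑ x ∈ Finset.Ico k (k + r), levelVal k n s.mem x (p x) :=
              Finset.single_le_sum (f := fun x => levelVal k n s.mem x (p x))
                (fun _ _ => Nat.zero_le _) (Finset.mem_Ico.2 ⟨by omega, by omega⟩)
            rw [hB.vals i hi _ (hp.1 _ (by omega) (by omega)), heq] at hle
            have := P.target_lt
            omega
          · rw [← hsumT, Nat.add_comm, Finset.sum_Ico_eq_sum_range _ k, Nat.add_sub_cancel_left]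
            congr 1
            refine Finset.sum_congr rfl fun i hi => ?_
            have hi := Finset.mem_range.1 hi
            rw [hus i hi, d1, hE (k + i) (by omega) (by omega)]
          · intro x hx hxk
            rw [hc.dbl_eq, d1, h2 x hx hxk] <;>
            · intro h
              rcases writes_record P.groups_le h with h | h | ⟨y, h | h⟩
              · have := hlo (vE x)
                have := hhi (vE x)
                omega
              all_goals simp at h)
        (by
          intro hne
          obtain ⟨u, hc⟩ := skip_spec k t₁
          have r2 : ∀ ρ, OutReg k ρ → u.reg ρ = t.reg ρ := fun ρ hρ => (hc.reg_eq (by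
            rw [writes_skip]
            exact fun h => not_nestReg_outReg (c := 0) (l := 0) hρ (.inl h))).trans (r1 ρ hρ)
          have e0 : u.reg 0 = t.reg 0 := r2 0 (.inl (by omega))
          refine ⟨u, _, hc, by omega, ?_, h1.congr r2, ?_, ?_, ?_⟩
          · rw [hc.peak_eq (by simp) (by simp), p1]; exact ht.peak_le
          · intro x hx hxk
            rw [hc.dbl_eq (by simp) (by simp), d1, h2 x hx hxk]
          · rwa [e0]
          · rw [e0]
            rintro p' (hp' | rfl) h
            · exact h4 p' hp' h
            · exact absurd h hne)
      exact ⟨t', _, .seq hc₁ hc', by omega, hp', hI'⟩)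
    hs rfl ⟨hG, fun x hx hxk => (hj x hx hxk).2, id, fun _ h => h.elim⟩ hA
  refine ⟨s', m, hb, ?_, hp, hG', hmono, ?_⟩
  · rw [nestSum_const] at hm
    refine hm.trans (le_of_eq ?_)
    ring
  · intro p hpn hsum
    refine hall (fun x => if k ≤ x ∧ x < k + r then p (x - k) else 0) (.inr ?_) ?_
    · refine ⟨fun x h1 h2 => ?_, fun x hx => ?_⟩
      · simpa [h1, h2] using hpn _ (by omega)
      · simp only [if_neg hx]
    · rw [← hsum, Nat.add_comm, Finset.sum_Ico_eq_sum_range _ k, Nat.add_sub_cancel_left]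
      congr 1
      refine Finset.sum_congr rfl fun i hi => ?_
      have hi := Finset.mem_range.1 hi
      rw [if_pos (by omega), Nat.add_sub_cancel_left]

end WordRAM

/-! ### Running through the arrays outside the groups. -/

namespace WordRAM

variable {w k g r n T pk : ℕ}

/-- For every choice of entries outside of the groups that can be completed with the current blocks
according to the bounds for the block sums, look for a completion. -/
def stream (k g r : ℕ) : Cmd :=
  setD k (vA (r * g)) 0 0 ;; nest k (k - r * g) (r * g)
    (addD k vX (vA k) (vLS r) ;; ltD k vT vX ;; .branch (lo k vTmp) (skip k)
      (addD k vX (vA k) (vUS r) ;; ltD k vX vT ;; .branch (lo k vTmp) (skip k) (join k g r)))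

/-- There is a solution with an entry from each of the blocks number `J i`. -/
def BlockSol (k g r n T b : ℕ) (U : ℕ → ℕ → ℕ) (J : ℕ → ℕ) : Prop :=
  ∃ q j : ℕ → ℕ, (∀ i < r, J i * n ≤ q i ∧ q i < J i * n + n) ∧
    (∀ x, r * g ≤ x → x < k → j x < n) ∧
    ∑ i ∈ Finset.range r, nthElt (groupSums n g U i) b (q i) +
      ∑ x ∈ Finset.Ico (r * g) k, U x (j x) = T

/-- The number of choices of entries outside of the groups for which the blocks number `J i` are
searched. -/
noncomputable def candidates (k g r n T b : ℕ) (U : ℕ → ℕ → ℕ) (J : ℕ → ℕ) : ℕ :=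
  nestSum n (k - r * g) (r * g) (fun j =>
    if ∑ i ∈ Finset.range r, lowerBd (groupSums n g U i) b (J i * n) +
        ∑ x ∈ Finset.Ico (r * g) k, U x (j x) ≤ T ∧
      T ≤ ∑ i ∈ Finset.range r, nthElt (groupSums n g U i) b (J i * n + (n - 1)) +
        ∑ x ∈ Finset.Ico (r * g) k, U x (j x) then 1 else 0) fun _ => 0

theorem OutReg.ne_lo {ρ x : ℕ} (h : OutReg k ρ) (hx : ∀ i, x ≠ vW i) : ρ ≠ lo k x := by
  rintro rfl
  have := lo_gt k x
  rcases h with h | ⟨i, h | h⟩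
  · omega
  · exact hx i (lo_inj.1 h)
  · simp at h

theorem OutReg.ne_hi {ρ x : ℕ} (h : OutReg k ρ) (hx : ∀ i, x ≠ vW i) : ρ ≠ hi k x := by
  rintro rfl
  have := hi_gt k x
  rcases h with h | ⟨i, h | h⟩
  · omega
  · simp at h
  · exact hx i (hi_inj.1 h)

/-- The state `s'` arises from `s` by computations that leave memory and output alone and change
only scratch registers. -/
structure SameData (k r : ℕ) (s s' : State w) : Prop where
  mem : s'.mem = s.mem
  peak : s'.peak = s.peak
  out : ∀ ρ, OutReg k ρ → s'.reg ρ = s.reg ρ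
  const : ∀ ρ, ConstReg k ρ → s'.reg ρ = s.reg ρ
  cur : ∀ x, s'.dbl k (vE x) = s.dbl k (vE x)
  acc : s'.dbl k (vA k) = s.dbl k (vA k)
  lower : s'.dbl k (vLS r) = s.dbl k (vLS r)
  upper : s'.dbl k (vUS r) = s.dbl k (vUS r)

theorem SameData.trans {s₁ s₂ s₃ : State w} (h : SameData k r s₁ s₂) (h' : SameData k r s₂ s₃) :
    SameData k r s₁ s₃ where
  mem := h'.mem.trans h.mem
  peak := h'.peak.trans h.peak
  out ρ hρ := (h'.out ρ hρ).trans (h.out ρ hρ)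
  const ρ hρ := (h'.const ρ hρ).trans (h.const ρ hρ)
  cur x := (h'.cur x).trans (h.cur x)
  acc := h'.acc.trans h.acc
  lower := h'.lower.trans h.lower
  upper := h'.upper.trans h.upper

theorem BigStep.sameData {p : Cmd} {s s' : State w} {m : ℕ} (hb : BigStep p s s' m)
    (h1 : p.NoStore) (h2 : p.NoLoad) (hp : ∀ ρ, p.Writes ρ →
      ρ = lo k vTmp ∨ ρ = hi k vTmp ∨ ρ = lo k vX ∨ ρ = hi k vX) : SameData k r s s' := by
  have hw : ∀ ρ, ρ ≠ lo k vTmp → ρ ≠ hi k vTmp → ρ ≠ lo k vX → ρ ≠ hi k vX → ¬ p.Writes ρ := by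
    intro ρ a1 a2 a3 a4 h
    rcases hp ρ h with h | h | h | h <;> contradiction
  have hd : ∀ x, x ≠ vTmp → x ≠ vX → s'.dbl k x = s.dbl k x := by
    intro x hx hx'
    exact hb.dbl_eq (hw _ (by simpa using hx) (by simp) (by simpa using hx') (by simp))
      (hw _ (by simp) (by simpa using hx) (by simp) (by simpa using hx'))
  refine ⟨hb.mem_eq h1, hb.peak_eq h1 h2, fun ρ hρ => hb.reg_eq (hw _ ?_ ?_ ?_ ?_),
    fun ρ hρ => hb.reg_eq (hw _ ?_ ?_ ?_ ?_), fun x => hd _ (by simp) (by simp),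
    hd _ (by simp) (by simp), hd _ (by simp) (by simp), hd _ (by simp) (by simp)⟩
  · exact hρ.ne_lo (by simp)
  · exact hρ.ne_hi (by simp)
  · exact hρ.ne_lo (by simp)
  · exact hρ.ne_hi (by simp)
  all_goals rcases hρ with rfl | rfl | rfl | rfl | rfl | rfl <;> simp

theorem SameData.base {s s' : State w} (h : SameData k r s s') (hs : Base k n T pk s) :
    Base k n T pk s' :=
  hs.of_reg_eq h.const (h.peak.trans_le hs.peak_le)

theorem SameData.blocks {U : ℕ → ℕ → ℕ} {J : ℕ → ℕ} {s s' : State w} (h : SameData k r s s')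
    (hB : Blocks k g n U r J s) : Blocks k g n U r J s' where
  input := by rw [h.mem]; exact hB.input
  vals := by rw [h.mem]; exact hB.vals
  lower := by rw [h.lower]; exact hB.lower
  upper := by rw [h.upper]; exact hB.upper

theorem writes_join (hrg : r * g ≤ k) {ρ : ℕ} (h : (join k g r).Writes ρ) :
    NestReg k r k ρ ∨ ρ ≤ k ∨ ∃ x, ρ = lo k (vW x) ∨ ρ = hi k (vW x) := by
  rcases writes_nest h with h | h
  · exact .inl h
  · simp only [writes_seq, writes_eqD, writes_branch, writes_skip] at h
    rcases h with (h | h) | h | h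
    · exact .inl (.inl h)
    · exact .inl (.inr (.inl h))
    · rcases writes_record hrg h with h | h | h
      · exact .inr (.inl h)
      · exact .inl (.inl h)
      · exact .inr (.inr h)
    · exact .inl (.inl h)

theorem keepsConst_join (hrg : r * g ≤ k) : (join k g r).KeepsConst k := by
  have hlo := lo_gt k
  have hhi := hi_gt k
  intro ρ hρ h
  rcases writes_join hrg h with h | h | ⟨x, h⟩
  · exact not_nestReg_constReg hρ h
  · have : k < ρ := by
      rcases hρ with h | h | h | h | h | h <;> rw [h] <;>
      first
      | exact lt_of_le_of_lt (by omega) (hlo _)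
      | exact lt_of_le_of_lt (by omega) (hhi _)
    omega
  · rcases hρ with rfl | rfl | rfl | rfl | rfl | rfl <;> simp at h

theorem noStore_stream : (stream k g r).NoStore :=
  ⟨by simp, noStore_nest (by simp [noStore_join])⟩

/-- The two comparisons are necessary conditions for a completion within the current blocks, so
skipping loses nothing; the cost of `join` is paid only for the choices counted by `candidates`. -/
theorem Params.stream_spec (P : Params w k g r n T pk) {U : ℕ → ℕ → ℕ} {J : ℕ → ℕ} {s : State w}
    (hs : Base k n T pk s) (hB : Blocks k g n U r J s) (hG : Good k g r n T U s) :
    ∃ s' m, BigStep (stream k g r) s s' m ∧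
      m ≤ (30 * k + 50) * n ^ (k - r * g) +
        candidates k g r n T (k * 2 ^ w) U J * ((2 * k + 34 * r + 15) * n ^ r) ∧
      s'.peak ≤ pk ∧ Good k g r n T U s' ∧ (s.reg 0 = 1#w → s'.reg 0 = 1#w) ∧
      (BlockSol k g r n T (k * 2 ^ w) U J → s'.reg 0 = 1#w) := by
  have hw := P.pos
  have hlo := lo_gt k
  have hhi := hi_gt k
  have hR : r * g + (k - r * g) = k := Nat.add_sub_cancel' P.groups_le
  obtain ⟨s₁, hb₁, hv₁, -⟩ := setD_spec k (vA (r * g)) (h := 0) (l := 0) (Nat.two_pow_pos w)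
    (Nat.two_pow_pos w) s
  have hs₁ := hs.of_noMem hb₁ (by simp) (by simp) (by simp)
  have hmem₁ := hb₁.mem_eq (by simp)
  have hout₁ : ∀ ρ, OutReg k ρ → s₁.reg ρ = s.reg ρ := fun ρ hρ => hb₁.reg_eq (by
    rw [writes_setD]
    rintro (h | h)
    · exact hρ.ne_hi (by simp) h
    · exact hρ.ne_lo (by simp) h)
  have hB₁ : Blocks k g n U r J s₁ :=
    ⟨by rw [hmem₁]; exact hB.input, by rw [hmem₁]; exact hB.vals,
      by rw [hb₁.dbl_eq (by simp) (by simp)]; exact hB.lower,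
      by rw [hb₁.dbl_eq (by simp) (by simp)]; exact hB.upper⟩
  set L := ∑ i ∈ Finset.range r, lowerBd (groupSums n g U i) (k * 2 ^ w) (J i * n) with hL
  set M := ∑ i ∈ Finset.range r, nthElt (groupSums n g U i) (k * 2 ^ w) (J i * n + (n - 1)) with hM
  have hLle : L ≤ r * (k * 2 ^ w) + r := by
    have : L ≤ ∑ i ∈ Finset.range r, (k * 2 ^ w + 1) :=
      Finset.sum_le_sum fun i _ => lowerBd_le _
    rw [Finset.sum_const, Finset.card_range, smul_eq_mul, Nat.mul_add, Nat.mul_one] at this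
    exact this
  have hMle : M ≤ r * (k * 2 ^ w) := by
    have : M ≤ ∑ i ∈ Finset.range r, (k * 2 ^ w) :=
      Finset.sum_le_sum fun i _ => nthElt_le _
    rwa [Finset.sum_const, Finset.card_range, smul_eq_mul] at this
  let sol : (ℕ → ℕ) → Prop := fun j => ∃ q : ℕ → ℕ, (∀ i < r, J i * n ≤ q i ∧ q i < J i * n + n) ∧
    ∑ i ∈ Finset.range r, nthElt (groupSums n g U i) (k * 2 ^ w) (q i) +
      ∑ x ∈ Finset.Ico (r * g) k, U x (j x) = T
  have hsol : ∀ j, sol j → L + ∑ x ∈ Finset.Ico (r * g) k, U x (j x) ≤ T ∧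
      T ≤ M + ∑ x ∈ Finset.Ico (r * g) k, U x (j x) := by
    rintro j ⟨q, hq, hsum⟩
    have h1 : L ≤ ∑ i ∈ Finset.range r, nthElt (groupSums n g U i) (k * 2 ^ w) (q i) := by
      refine Finset.sum_le_sum fun i hi => ?_
      have hi' := Finset.mem_range.1 hi
      -- `lowerBd` bounds an element from below only if it is not the sentinel; here it is not,
      -- since the sentinel exceeds the target.
      refine (lowerBd_mono (hq i hi').1).trans (lowerBd_le_nthElt fun heq => ?_)
      have : nthElt (groupSums n g U i) (k * 2 ^ w) (q i) ≤
          ∑ i ∈ Finset.range r, nthElt (groupSums n g U i) (k * 2 ^ w) (q i) :=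
        Finset.single_le_sum (f := fun i => nthElt (groupSums n g U i) (k * 2 ^ w) (q i))
          (fun _ _ => Nat.zero_le _) hi
      have := P.target_lt
      omega
    have h2 : ∑ i ∈ Finset.range r, nthElt (groupSums n g U i) (k * 2 ^ w) (q i) ≤ M := by
      refine Finset.sum_le_sum fun i hi => nthElt_mono ?_
      have := (hq i (Finset.mem_range.1 hi)).2
      omega
    omega
  let Inv : Set (ℕ → ℕ) → State w → Prop := fun X t =>
    Good k g r n T U t ∧ t.dbl k (vLS r) = L ∧ t.dbl k (vUS r) = M ∧
    (s.reg 0 = 1#w → t.reg 0 = 1#w) ∧ ∀ j ∈ X, sol j → t.reg 0 = 1#w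
  have hstab : ∀ (X : Set (ℕ → ℕ)) (t t' : State w), (∀ ρ, OutReg k ρ → t'.reg ρ = t.reg ρ) →
      t'.dbl k (vLS r) = t.dbl k (vLS r) → t'.dbl k (vUS r) = t.dbl k (vUS r) →
      Inv X t → Inv X t' := by
    rintro X t t' hreg e1 e2 ⟨h1, h2, h3, h4⟩
    have e0 : t'.reg 0 = t.reg 0 := hreg 0 (.inl (by omega))
    refine ⟨h1.congr hreg, by rw [e1, h2], by rw [e2, h3], ?_⟩
    rwa [e0]
  have hkeepLS : ∀ ρ, (∃ y, ρ = lo k (vLS y) ∨ ρ = hi k (vLS y) ∨ ρ = lo k (vUS y) ∨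
      ρ = hi k (vUS y)) → (∀ c l, ¬ NestReg k c l ρ) ∧ ¬ (join k g r).Writes ρ := by
    rintro ρ ⟨y, hρ⟩
    have h1 : ∀ c l, ¬ NestReg k c l ρ := by
      rintro c l (h | h | ⟨x, -, -, h⟩) <;> rcases hρ with rfl | rfl | rfl | rfl <;> simp at h
    have h2 : k < ρ := by
      rcases hρ with h | h | h | h <;> rw [h] <;>
      first
      | exact lt_of_le_of_lt (by omega) (hlo _)
      | exact lt_of_le_of_lt (by omega) (hhi _)
    refine ⟨h1, fun h => ?_⟩
    rcases writes_join P.groups_le h with h | h | ⟨x, h⟩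
    · exact h1 _ _ h
    · omega
    · rcases hρ with rfl | rfl | rfl | rfl <;> simp at h
  obtain ⟨s', m, hb, hm, hp, hG', -, -, hmono, hall⟩ := nest_spec (k := k) (T := T) (pk := pk)
    (r := r) (bnd := 2 ^ w) (μ := s.mem)
    (body := addD k vX (vA k) (vLS r) ;; ltD k vT vX ;; .branch (lo k vTmp) (skip k)
      (addD k vX (vA k) (vUS r) ;; ltD k vX vT ;; .branch (lo k vTmp) (skip k) (join k g r)))
    P.n_lt P.cells_le P.n_pos (by simp [noStore_join])
    (fun j => 40 + (if L + ∑ x ∈ Finset.Ico (r * g) k, U x (j x) ≤ T ∧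
      T ≤ M + ∑ x ∈ Finset.Ico (r * g) k, U x (j x) then 1 else 0) *
        ((2 * k + 34 * r + 15) * n ^ r)) (k - r * g) (r * g) 0 Inv ∅ (fun _ => 0) s₁
    (by omega)
    (fun x _ hx j hj => by
      rw [hB.input x (by omega) j hj]; exact (hB.input.lt (by omega) hj).le)
    (by
      have := P.le_of_lt
      rw [Nat.zero_add]; exact Nat.mul_lt_mul_of_pos_right (by omega) (Nat.two_pow_pos w))
    (by
      intro ρ hρ h
      simp only [writes_seq, writes_addD, writes_ltD, writes_branch, writes_skip] at h
      have h' : (join k g r).Writes ρ ∨ ρ = lo k vTmp ∨ ρ = hi k vTmp ∨ ρ = lo k vX ∨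
        ρ = hi k vX := by tauto
      rcases h' with h' | h'
      · rcases hρ with hρ | ⟨x, hx, hxk, hρ⟩
        · exact keepsConst_join P.groups_le ρ hρ h'
        · rcases writes_join P.groups_le h' with h' | h' | ⟨y, h'⟩
          · rcases h' with h' | h' | ⟨y, hy, -, h'⟩
            · rcases hρ with rfl | rfl | rfl | rfl | rfl <;> simp at h'
            · rcases hρ with rfl | rfl | rfl | rfl | rfl <;> simp at h'
            · rcases hρ with rfl | rfl | rfl | rfl | rfl <;> simp at h' <;> omega
          · have : k < ρ := by
              rcases hρ with h | h | h | h | h <;> rw [h] <;>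
              first
              | exact lt_of_le_of_lt (by omega) (hlo _)
              | exact lt_of_le_of_lt (by omega) (hhi _)
            omega
          · rcases hρ with rfl | rfl | rfl | rfl | rfl <;> simp at h'
      · rcases hρ with (hρ | hρ | hρ | hρ | hρ | hρ) | ⟨x, -, -, hρ | hρ | hρ | hρ | hρ⟩ <;>
          rw [hρ] at h' <;> simp at h')
    (by
      intro X t t' hreg hmem hI
      refine hstab X t t' (fun ρ hρ => hreg ρ (not_nestReg_outReg hρ)) ?_ ?_ hI
      · unfold State.dbl
        rw [hreg _ ((hkeepLS _ ⟨r, by simp⟩).1 _ _), hreg _ ((hkeepLS _ ⟨r, by simp⟩).1 _ _)]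
      · unfold State.dbl
        rw [hreg _ ((hkeepLS _ ⟨r, by simp⟩).1 _ _), hreg _ ((hkeepLS _ ⟨r, by simp⟩).1 _ _)])
    (by
      rintro X j t hj ht hμ hI hE hsum
      obtain ⟨hGt, hLt, hMt, hmt, hXt⟩ := id hI
      rw [hR] at hsum hE
      have hjn : ∀ x, r * g ≤ x → x < k → j x < n := fun x h1 h2 => hj.1 x h1 (by omega)
      have hsum' : t.dbl k (vA k) = ∑ x ∈ Finset.Ico (r * g) k, U x (j x) := by
        rw [hsum, Nat.zero_add]
        refine Finset.sum_congr rfl fun x hx => ?_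
        rw [Finset.mem_Ico] at hx
        exact hB.input x hx.2 _ (hjn x hx.1 hx.2)
      set y := ∑ x ∈ Finset.Ico (r * g) k, U x (j x) with hy
      have hyle : y ≤ k * 2 ^ w := hB.input.sum_le hjn
      have hbound := P.bound
      rw [Nat.add_mul, Nat.one_mul] at hbound
      have hskip : ∀ u u' : State w, SameData k r t u → BigStep (skip k) u u' 1 →
          ¬ sol j → u'.peak ≤ pk ∧ Inv (X ∪ {j}) u' := by
        intro u u' hu hc hns
        have hu' := hu.trans (hc.sameData (by simp) (by simp) (by
          intro ρ h; rw [writes_skip] at h; exact .inl h))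
        refine ⟨hu'.peak.trans_le ht.peak_le, ?_⟩
        refine hstab _ t u' hu'.out hu'.lower hu'.upper ⟨hGt, hLt, hMt, hmt, ?_⟩
        rintro j' (hj' | rfl) hs'
        · exact hXt j' hj' hs'
        · exact absurd hs' hns
      obtain ⟨t₁, hc₁, ht₁⟩ := addD_spec (k := k) (x := vX) (a := vA k) (b := vLS r) t (by simp)
        (by simp) (by rw [hsum', hLt]; omega)
      have S₁ : SameData k r t t₁ := hc₁.sameData (by simp) (by simp) (by simp)
      obtain ⟨t₂, hc₂, ht₂⟩ := ltD_spec (k := k) (a := vT) (b := vX) hw t₁ (by simp) (by simp)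
      have S₂ : SameData k r t t₂ := S₁.trans (hc₂.sameData (by simp) (by simp) (by simp))
      rw [ht₁, (S₁.base ht).target, hsum', hLt] at ht₂
      obtain ⟨t', m', hc', hm', hp', hI'⟩ := BigStep.branch ht₂ (p := skip k)
        (q := addD k vX (vA k) (vUS r) ;; ltD k vX vT ;;
          .branch (lo k vTmp) (skip k) (join k g r))
        (Q := fun u m => m ≤ 21 + (if L + y ≤ T ∧ T ≤ M + y then 1 else 0) *
          ((2 * k + 34 * r + 15) * n ^ r) ∧ u.peak ≤ pk ∧ Inv (X ∪ {j}) u)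
        (by
          intro hlt
          obtain ⟨u, hc⟩ := skip_spec k t₂
          exact ⟨u, _, hc, by omega, hskip t₂ u S₂ hc fun h => by
            have := (hsol j h).1
            omega⟩)
        (by
          intro hnlt
          obtain ⟨t₃, hc₃, ht₃⟩ := addD_spec (k := k) (x := vX) (a := vA k) (b := vUS r) t₂
            (by simp) (by simp) (by rw [S₂.acc, S₂.upper, hsum', hMt]; omega)
          rw [S₂.acc, S₂.upper, hsum', hMt] at ht₃
          have S₃ : SameData k r t t₃ :=
            S₂.trans (hc₃.sameData (by simp) (by simp) (by simp))
          obtain ⟨t₄, hc₄, ht₄⟩ := ltD_spec (k := k) (a := vX) (b := vT) hw t₃ (by simp) (by simp)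
          have S₄ : SameData k r t t₄ :=
            S₃.trans (hc₄.sameData (by simp) (by simp) (by simp))
          rw [ht₃, (S₃.base ht).target] at ht₄
          obtain ⟨u, m, hc, hm, hpu, hIu⟩ := BigStep.branch ht₄ (p := skip k) (q := join k g r)
            (Q := fun u m => m ≤ 1 + (if L + y ≤ T ∧ T ≤ M + y then 1 else 0) *
              ((2 * k + 34 * r + 15) * n ^ r) + 1 ∧ u.peak ≤ pk ∧ Inv (X ∪ {j}) u)
            (by
              intro hlt
              obtain ⟨u, hc⟩ := skip_spec k t₄
              exact ⟨u, _, hc, by omega, hskip t₄ u S₄ hc fun h => by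
                have := (hsol j h).2
                omega⟩)
            (by
              intro hnlt2
              have hB₄ : Blocks k g n U r J t₄ := S₄.blocks
                ⟨by rw [hμ]; exact hB.input, by rw [hμ]; exact hB.vals, hLt, hMt⟩
              obtain ⟨u, m, hc, hm, hpu, hGu, hmu, hall⟩ := P.join_spec (S₄.base ht) hB₄
                (hGt.congr S₄.out) (j := j) (fun x hx hxk => ⟨hjn x hx hxk, by
                  rw [S₄.cur, hE x hx hxk]; exact hB.input x hxk _ (hjn x hx hxk)⟩)
                (by rw [S₄.acc, hsum'])
              have e0 : t₄.reg 0 = t.reg 0 := S₄.out 0 (.inl (by omega))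
              have hd : ∀ x, (x = vLS r ∨ x = vUS r) → u.dbl k x = t₄.dbl k x := by
                rintro x (rfl | rfl) <;>
                exact hc.dbl_eq (hkeepLS _ ⟨r, by simp⟩).2 (hkeepLS _ ⟨r, by simp⟩).2
              refine ⟨u, m, hc, ?_, hpu, hGu, ?_, ?_, fun h => hmu (e0.trans (hmt h)), ?_⟩
              · rw [if_pos (by omega)]; omega
              · rw [hd _ (.inl rfl), S₄.lower, hLt]
              · rw [hd _ (.inr rfl), S₄.upper, hMt]
              · rintro j' (hj' | rfl) hs'
                · exact hmu (e0.trans (hXt j' hj' hs'))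
                · obtain ⟨q, hq, hqs⟩ := hs'
                  -- The position of element number `q i` in its reversed block.
                  refine hall (fun i => n - 1 - (q i - J i * n)) (fun i hi => ?_) ?_
                  · have := P.n_pos
                    omega
                  · rw [← hqs]
                    congr 1
                    refine Finset.sum_congr rfl fun i hi => ?_
                    have hi := Finset.mem_range.1 hi
                    have := hq i hi
                    rw [hB₄.vals i hi _ (by omega)]
                    congr 1
                    omega)
          exact ⟨u, _, .seq hc₃ (.seq hc₄ hc), by omega, hpu, hIu⟩)
      exact ⟨t', _, .seq hc₁ (.seq hc₂ hc'), by omega, hp', hI'⟩)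
    hs₁ hmem₁ ⟨hG.congr hout₁, hB₁.lower, hB₁.upper, by rw [hout₁ 0 (.inl (by omega))]; exact id,
      fun _ h => h.elim⟩ (by simpa using hv₁)
  refine ⟨s', _, .seq hb₁ hb, ?_, hp, hG', hmono, ?_⟩
  · rw [nestSum_add, nestSum_const, nestSum_mul_const] at hm
    change m ≤ _ + candidates k g r n T (k * 2 ^ w) U J * _ + _ at hm
    have h1 : 1 ≤ n ^ (k - r * g) := Nat.one_le_pow _ _ P.n_pos
    have h2 : 30 * (k - r * g) * n ^ (k - r * g) ≤ 30 * k * n ^ (k - r * g) :=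
      Nat.mul_le_mul_right _ (by omega)
    rw [Nat.add_mul (30 * k)]
    omega
  · rintro ⟨q, j, hq, hj, hqs⟩
    refine hall (fun x => if r * g ≤ x ∧ x < k then j x else 0) (.inr ?_) ⟨q, hq, ?_⟩
    · refine ⟨fun x h1 h2 => ?_, fun x hx => ?_⟩
      · rw [hR] at h2
        simpa [h1, h2] using hj _ h1 h2
      · rw [hR] at hx
        simp only [if_neg hx]
    · rw [← hqs]
      congr 1
      refine Finset.sum_congr rfl fun x hx => ?_
      simp only [if_pos (Finset.mem_Ico.1 hx)]

end WordRAM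

/-! ### Running through all combinations of blocks. -/

namespace WordRAM

variable {w k g r n T pk : ℕ}

/-- The loop counter number `e` of the loop over the blocks of group `i`. -/
abbrev vR (i e : ℕ) : ℕ := Nat.pair (9 + e) i

/-- Run `body` as often as `e` nested loops of length `n` do. -/
def rep (k i : ℕ) : ℕ → Cmd → Cmd
  | 0, body => body
  | e + 1, body => forN k (vR i e) (rep k i e body)

theorem writes_rep {i e ρ : ℕ} {body : Cmd} (h : (rep k i e body).Writes ρ) :
    (∃ e' < e, ρ = lo k (vR i e')) ∨ body.Writes ρ := by
  induction e with
  | zero => exact .inr h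
  | succ e ih =>
    rw [rep, writes_forN] at h
    rcases h with h | h
    · exact .inl ⟨e, by omega, h⟩
    · rcases ih h with ⟨e', h1, h2⟩ | h
      · exact .inl ⟨e', by omega, h2⟩
      · exact .inr h

theorem sum_range_mul (m n : ℕ) (f : ℕ → ℕ) :
    ∑ a ∈ Finset.range n, ∑ p ∈ Finset.range m, f (a * m + p) =
      ∑ p ∈ Finset.range (n * m), f p := by
  induction n with
  | zero => simp
  | succ n ih => rw [Finset.sum_range_succ, ih, Nat.succ_mul, Finset.sum_range_add]

/-- The number of passes `n ^ e` need not fit into a word, so it is counted by `e` nested counters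
below `n`. The parameter of `Inv` counts completed passes upwards; the reflection of the sum in the
proof translates from the descending counters. -/
theorem rep_spec {i N : ℕ} {body : Cmd} (hn0 : 1 ≤ n) (hn : n < 2 ^ w) (f : ℕ → ℕ)
    (Inv : ℕ → State w → Prop) (hw : ∀ e, ¬ body.Writes (lo k (vR i e)))
    (hc : body.KeepsConst k)
    (hstab : ∀ p s e x, Inv p s → Inv p (s.setReg (lo k (vR i e)) x))
    (hbase : ∀ p s, Inv p s → Base k n T pk s)
    (hbody : ∀ p s, p < N → Inv p s → ∃ s' m, BigStep body s s' m ∧ m ≤ f p ∧ Inv (p + 1) s')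
    (e : ℕ) : ∀ p₀ s, p₀ + n ^ e ≤ N → Inv p₀ s → ∃ s' m, BigStep (rep k i e body) s s' m ∧
      m ≤ ∑ p ∈ Finset.range (n ^ e), f (p₀ + p) + 6 * e * n ^ e ∧ Inv (p₀ + n ^ e) s' := by
  induction e with
  | zero =>
    intro p₀ s hp hI
    obtain ⟨s', m, h1, h2, h3⟩ := hbody p₀ s (by rw [pow_zero] at hp; omega) hI
    exact ⟨s', m, h1, by simpa using h2, by simpa using h3⟩
  | succ e ih =>
    intro p₀ s hp hI
    have hwe : ∀ ρ, (ρ = lo k (vR i e) ∨ ρ = lo k vOne) → ¬ (rep k i e body).Writes ρ := by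
      rintro ρ hρ h
      rcases writes_rep h with ⟨e', h1, h2⟩ | h
      · rcases hρ with rfl | rfl
        · simp at h2; omega
        · simp at h2; omega
      · rcases hρ with rfl | rfl
        · exact hw e h
        · exact hc _ (by simp [ConstReg]) h
    obtain ⟨s', m, h1, h2, h3⟩ := forN_spec (k := k) (i := vR i e) (body := rep k i e body)
      (fun a => ∑ p ∈ Finset.range (n ^ e), f (p₀ + ((n - 1 - a) * n ^ e + p)) + 6 * e * n ^ e)
      (fun a s => Inv (p₀ + (n - a) * n ^ e) s) hn (by simp) (hwe _ (.inl rfl))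
      (hwe _ (.inr rfl)) (fun a s x h => hstab _ s e x h)
      (by
        intro a s ha hI _
        have e1 : n - (a + 1) = n - 1 - a := by omega
        have e2 : n - a = n - 1 - a + 1 := by omega
        have e3 : (n - 1 - a + 1) * n ^ e ≤ n * n ^ e := Nat.mul_le_mul_right _ (by omega)
        rw [e1] at hI
        obtain ⟨s', m, h1, h2, h3⟩ := ih _ s (by
          rw [pow_succ'] at hp
          rw [Nat.add_mul, Nat.one_mul] at e3
          omega) hI
        refine ⟨s', m, h1, ?_, ?_⟩
        · simpa only [Nat.add_assoc] using h2
        · rw [e2, Nat.add_mul, Nat.one_mul, ← Nat.add_assoc]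
          exact h3)
      (hbase _ _ hI).n_eq (hbase _ _ hI).one_lo (s := s) (by simpa using hI)
    refine ⟨s', m, h1, h2.trans ?_, ?_⟩
    · rw [Finset.sum_add_distrib, Finset.sum_add_distrib,
        Finset.sum_range_reflect (fun a => ∑ p ∈ Finset.range (n ^ e), f (p₀ + (a * n ^ e + p))) n,
        sum_range_mul (n ^ e) n fun p => f (p₀ + p), pow_succ']
      simp only [Finset.sum_const, Finset.card_range, smul_eq_mul]
      have : n * 1 ≤ n * n ^ e := Nat.mul_le_mul_left n (Nat.one_le_pow _ _ hn0)
      have : 6 * (e + 1) * (n * n ^ e) = n * (6 * e * n ^ e) + 6 * (n * n ^ e) := by ring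
      omega
    · rw [pow_succ']
      simpa using h3

/-- Search all combinations of blocks of the `c` groups from `i` on. -/
def blocks (k g r : ℕ) : ℕ → ℕ → Cmd
  | 0, _ => stream k g r
  | c + 1, i => setD k (vV i) 0 0 ;; rep k i (g - 1) (addD k (vLS (i + 1)) (vLS i) (vV i) ;;
      fetch k g i ;; addD k (vUS (i + 1)) (vUS i) vBest ;; blocks k g r c (i + 1))

/-- The register pairs that `blocks` may write, from group `i` on. -/
def BlockName (i y : ℕ) : Prop :=
  y = vTmp ∨ y = vX ∨ y = vBest ∨ ∃ x, y = vIdx x ∨ y = vE x ∨ y = vA x ∨ y = vW x ∨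
    i ≤ x ∧ (y = vV x ∨ y = vLS (x + 1) ∨ y = vUS (x + 1) ∨ y = vF x ∨ ∃ e, y = vR x e)

theorem BlockName.succ {i y : ℕ} (h : BlockName (i + 1) y) : BlockName i y := by
  rcases h with h | h | h | ⟨x, h | h | h | h | ⟨h', h⟩⟩
  · exact .inl h
  · exact .inr (.inl h)
  · exact .inr (.inr (.inl h))
  · exact .inr (.inr (.inr ⟨x, .inl h⟩))
  · exact .inr (.inr (.inr ⟨x, .inr (.inl h)⟩))
  · exact .inr (.inr (.inr ⟨x, .inr (.inr (.inl h))⟩))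
  · exact .inr (.inr (.inr ⟨x, .inr (.inr (.inr (.inl h)))⟩))
  · exact .inr (.inr (.inr ⟨x, .inr (.inr (.inr (.inr ⟨by omega, h⟩)))⟩))

theorem blockName_self {i y : ℕ}
    (h : y = vV i ∨ y = vLS (i + 1) ∨ y = vUS (i + 1) ∨ y = vF i ∨ ∃ e, y = vR i e) :
    BlockName i y :=
  .inr (.inr (.inr ⟨i, .inr (.inr (.inr (.inr ⟨le_rfl, h⟩)))⟩))

/-- The inner levels leave alone the partial bounds and the search position of level `i`, so that
level can continue its enumeration afterwards. -/
theorem not_blockName_succ {i y : ℕ} (hy : y = vLS i ∨ y = vUS i ∨ y = vV i) :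
    ¬ BlockName (i + 1) y := by
  rintro (h | h | h | ⟨x, h | h | h | h | ⟨hx, h | h | h | h | ⟨e, h⟩⟩⟩) <;>
  rcases hy with rfl | rfl | rfl <;> simp at h <;> omega

theorem NestReg.blockName {c l ρ : ℕ} (h : NestReg k c l ρ) (i : ℕ) :
    ∃ y, BlockName i y ∧ (ρ = lo k y ∨ ρ = hi k y) := by
  rcases h with h | h | ⟨x, -, -, h | h | h | h | h⟩
  · exact ⟨vTmp, .inl rfl, .inl h⟩
  · exact ⟨vTmp, .inl rfl, .inr h⟩
  · exact ⟨vIdx x, .inr (.inr (.inr ⟨x, .inl rfl⟩)), .inl h⟩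
  · exact ⟨vE x, .inr (.inr (.inr ⟨x, .inr (.inl rfl)⟩)), .inl h⟩
  · exact ⟨vE x, .inr (.inr (.inr ⟨x, .inr (.inl rfl)⟩)), .inr h⟩
  · exact ⟨vA (x + 1), .inr (.inr (.inr ⟨x + 1, .inr (.inr (.inl rfl))⟩)), .inl h⟩
  · exact ⟨vA (x + 1), .inr (.inr (.inr ⟨x + 1, .inr (.inr (.inl rfl))⟩)), .inr h⟩

theorem writes_stream (hrg : r * g ≤ k) (i : ℕ) {ρ : ℕ} (h : (stream k g r).Writes ρ) :
    ρ ≤ k ∨ ∃ y, BlockName i y ∧ (ρ = lo k y ∨ ρ = hi k y) := by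
  rcases h with h | h
  · rw [writes_setD] at h
    exact .inr ⟨vA (r * g), .inr (.inr (.inr ⟨_, .inr (.inr (.inl rfl))⟩)), h.symm⟩
  · rcases writes_nest h with h | h
    · exact .inr (h.blockName i)
    · simp only [writes_seq, writes_addD, writes_ltD, writes_branch, writes_skip] at h
      have h' : (join k g r).Writes ρ ∨ (ρ = lo k vTmp ∨ ρ = hi k vTmp) ∨ (ρ = lo k vX ∨
        ρ = hi k vX) := by tauto
      rcases h' with h | h | h
      · rcases writes_join hrg h with h | h | ⟨x, h⟩
        · exact .inr (h.blockName i)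
        · exact .inl h
        · exact .inr ⟨vW x, .inr (.inr (.inr ⟨x, .inr (.inr (.inr (.inl rfl)))⟩)), h⟩
      · exact .inr ⟨vTmp, .inl rfl, h⟩
      · exact .inr ⟨vX, .inr (.inl rfl), h⟩

theorem fetch_blockName {i ρ : ℕ} (h : (fetch k g i).Writes ρ) :
    ∃ y, BlockName i y ∧ (ρ = lo k y ∨ ρ = hi k y) := by
  rcases writes_fetch h with h | h | h | h | h | h | h | h
  · exact ⟨vF i, blockName_self (by simp), .inl h⟩
  · exact ⟨vV i, blockName_self (by simp), .inl h⟩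
  · exact ⟨vV i, blockName_self (by simp), .inr h⟩
  · exact ⟨vBest, by simp [BlockName], .inl h⟩
  · exact ⟨vBest, by simp [BlockName], .inr h⟩
  · exact ⟨vA (i * g), by simp [BlockName], .inl h⟩
  · exact ⟨vA (i * g), by simp [BlockName], .inr h⟩
  · exact h.blockName i

theorem writes_blocks (hrg : r * g ≤ k) {c i ρ : ℕ} (h : (blocks k g r c i).Writes ρ) :
    ρ ≤ k ∨ ∃ y, BlockName i y ∧ (ρ = lo k y ∨ ρ = hi k y) := by
  induction c generalizing i with
  | zero => exact writes_stream hrg i h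
  | succ c ih =>
    rcases h with h | h
    · exact .inr ⟨vV i, blockName_self (by simp), h.symm⟩
    · rcases writes_rep h with ⟨e, -, h⟩ | h | h | h | h
      · exact .inr ⟨vR i e, blockName_self (by simp), .inl h⟩
      · rcases writes_addD.1 h with h | h | h
        · exact .inr ⟨vLS (i + 1), blockName_self (by simp), .inl h⟩
        · exact .inr ⟨vTmp, .inl rfl, .inl h⟩
        · exact .inr ⟨vLS (i + 1), blockName_self (by simp), .inr h⟩
      · exact .inr (fetch_blockName h)
      · rcases writes_addD.1 h with h | h | h
        · exact .inr ⟨vUS (i + 1), blockName_self (by simp), .inl h⟩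
        · exact .inr ⟨vTmp, .inl rfl, .inl h⟩
        · exact .inr ⟨vUS (i + 1), blockName_self (by simp), .inr h⟩
      · rcases ih h with h | ⟨y, h1, h2⟩
        · exact .inl h
        · exact .inr ⟨y, h1.succ, h2⟩

theorem not_writes_blocks (hrg : r * g ≤ k) {c i y : ℕ} (hy : ¬ BlockName i y) :
    ¬ (blocks k g r c i).Writes (lo k y) ∧ ¬ (blocks k g r c i).Writes (hi k y) := by
  have hlo := lo_gt k y
  have hhi := hi_gt k y
  constructor <;> intro h
  · rcases writes_blocks hrg h with h | ⟨z, hz, h | h⟩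
    · omega
    · exact hy (lo_inj.1 h ▸ hz)
    · simp at h
  · rcases writes_blocks hrg h with h | ⟨z, hz, h | h⟩
    · omega
    · simp at h
    · exact hy (hi_inj.1 h ▸ hz)

theorem keepsConst_blocks (hrg : r * g ≤ k) {c i : ℕ} : (blocks k g r c i).KeepsConst k := by
  have h1 := not_writes_blocks hrg (c := c) (i := i) (y := vN) (by simp [BlockName]; omega)
  have h2 := not_writes_blocks hrg (c := c) (i := i) (y := vOne) (by simp [BlockName]; omega)
  have h3 := not_writes_blocks hrg (c := c) (i := i) (y := vMsb) (by simp [BlockName]; omega)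
  have h4 := not_writes_blocks hrg (c := c) (i := i) (y := vT) (by simp [BlockName]; omega)
  rw [keepsConst_iff]
  tauto

/-- A bound for the number of steps of `stream`. -/
noncomputable def streamCost (k g r n T b : ℕ) (U : ℕ → ℕ → ℕ) (J : ℕ → ℕ) : ℕ :=
  (30 * k + 50) * n ^ (k - r * g) +
    candidates k g r n T b U J * ((2 * k + 34 * r + 15) * n ^ r)

/-- The list of group `i` is enumerated afresh for every combination of blocks of the earlier
groups. On each of `c` levels at most `(n ^ (g - 1)) ^ c` blocks are fetched, which gives the second
summand of the cost. -/
theorem Params.blocks_spec (P : Params w k g r n T pk) {U : ℕ → ℕ → ℕ} (c : ℕ) :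
    ∀ (i : ℕ) (J : ℕ → ℕ) (s : State w), i + c = r → Base k n T pk s →
      Blocks k g n U i J s → Good k g r n T U s →
      ∃ s' m, BigStep (blocks k g r c i) s s' m ∧
        m ≤ nestSum (n ^ (g - 1)) c i (streamCost k g r n T (k * 2 ^ w) U) J +
          c * (n ^ (g - 1)) ^ c * ((40 * g + 100) * n ^ (g + 1)) ∧
        s'.peak ≤ pk ∧
        (∀ x < k + i, ∀ p < n, levelVal k n s'.mem x p = levelVal k n s.mem x p) ∧
        Good k g r n T U s' ∧ (s.reg 0 = 1#w → s'.reg 0 = 1#w) ∧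
        ∀ J' ∈ tuples (n ^ (g - 1)) c i J, BlockSol k g r n T (k * 2 ^ w) U J' →
          s'.reg 0 = 1#w := by
  induction c with
  | zero =>
    intro i J s hi hs hB hG
    obtain rfl : i = r := hi
    obtain ⟨s', m, h1, h2, h3, h4, h5, h6⟩ := P.stream_spec hs hB hG
    refine ⟨s', m, h1, by simpa [nestSum, streamCost] using h2, h3, ?_, h4, h5, ?_⟩
    · intro x _ p _
      rw [h1.mem_eq noStore_stream]
    · rw [tuples_zero]
      rintro J' rfl
      exact h6
  | succ c ih =>
    intro i J s hic hs hB hG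
    have hir : i < r := by omega
    have hw := P.pos
    have hbound := P.bound
    set b := k * 2 ^ w with hb
    set B := n ^ (g - 1) with hBdef
    set D := groupSums n g U with hD
    set K := (40 * g + 100) * n ^ (g + 1) with hK
    set cost := streamCost k g r n T b U with hcost
    obtain ⟨s₁, hb₁, hv₁, -⟩ := setD_spec k (vV i) (h := 0) (l := 0) (Nat.two_pow_pos w)
      (Nat.two_pow_pos w) s
    have hs₁ := hs.of_noMem hb₁ (by simp) (by simp) (by simp)
    have hmem₁ := hb₁.mem_eq (by simp)
    have hout₁ : ∀ ρ, OutReg k ρ → s₁.reg ρ = s.reg ρ := fun ρ hρ => hb₁.reg_eq (by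
      rw [writes_setD]
      rintro (h | h)
      · exact hρ.ne_hi (by simp) h
      · exact hρ.ne_lo (by simp) h)
    -- After `p` passes the next search starts behind the first `p * n` elements, and the
    -- combinations with `J' i < p` are settled.
    let Inv : ℕ → State w → Prop := fun p t => Base k n T pk t ∧
      (∀ x < k + i, ∀ q < n, levelVal k n t.mem x q = levelVal k n s.mem x q) ∧
      t.dbl k (vLS i) = s.dbl k (vLS i) ∧ t.dbl k (vUS i) = s.dbl k (vUS i) ∧
      t.dbl k (vV i) = lowerBd (D i) b (p * n) ∧
      Good k g r n T U t ∧ (s.reg 0 = 1#w → t.reg 0 = 1#w) ∧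
      ∀ J' ∈ tuples B (c + 1) i J, J' i < p → BlockSol k g r n T b U J' → t.reg 0 = 1#w
    have hRlo : ∀ e x y, (∀ e, y ≠ vR i e) → ∀ t : State w,
        (t.setReg (lo k (vR i e)) x).dbl k y = t.dbl k y := by
      intro e x y hy t
      simp only [State.dbl, State.setReg]
      rw [Function.update_of_ne (by simp), Function.update_of_ne (by simpa using hy e)]
    have hLSle : s.dbl k (vLS i) ≤ i * (b + 1) := by
      rw [hB.lower]
      have : ∑ i' ∈ Finset.range i, lowerBd (D i') b (J i' * n) ≤
        ∑ i' ∈ Finset.range i, (b + 1) := Finset.sum_le_sum fun i _ => lowerBd_le _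
      simpa using this
    have hUSle : s.dbl k (vUS i) ≤ i * b := by
      rw [hB.upper]
      have : ∑ i' ∈ Finset.range i, nthElt (D i') b (J i' * n + (n - 1)) ≤
        ∑ i' ∈ Finset.range i, b := Finset.sum_le_sum fun i _ => nthElt_le _
      simpa using this
    have hib : (i + 1) * b ≤ r * b := Nat.mul_le_mul_right _ hir
    have hfw : ∀ y, ¬ BlockName i y → ¬ (fetch k g i).Writes (lo k y) ∧
        ¬ (fetch k g i).Writes (hi k y) := by
      intro y hy
      constructor <;> intro h <;> obtain ⟨z, hz, h | h⟩ := fetch_blockName h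
      · exact hy (lo_inj.1 h ▸ hz)
      · simp at h
      · simp at h
      · exact hy (hi_inj.1 h ▸ hz)
    have hfd : ∀ y, ((y = vLS i ∨ y = vUS i) ∨ y = vLS (i + 1)) →
        ¬ (fetch k g i).Writes (lo k y) ∧ ¬ (fetch k g i).Writes (hi k y) := by
      intro y hy
      constructor <;> intro h <;>
      rcases writes_fetch h with h | h | h | h | h | h | h | h | h | ⟨x, -, -, h⟩ <;>
      rcases hy with (rfl | rfl) | rfl <;> simp at h
    obtain ⟨s', m, hb', hm, hI'⟩ := rep_spec (k := k) (T := T) (pk := pk) (i := i) (N := B)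
      (body := addD k (vLS (i + 1)) (vLS i) (vV i) ;;
        fetch k g i ;; addD k (vUS (i + 1)) (vUS i) vBest ;; blocks k g r c (i + 1))
      P.n_pos P.n_lt (fun p => (30 * g + 90) * n ^ (g + 1) +
        (nestSum B c (i + 1) cost (Function.update J i p) + c * B ^ c * K)) Inv
      (by
        intro e h
        simp only [writes_seq, writes_addD] at h
        rcases h with h | h | h | h
        · simp at h
        · rcases writes_fetch h with h | h | h | h | h | h | h | h | h | ⟨x, -, -, h⟩ <;>
            simp at h <;> omega
        · simp at h
        · exact (not_writes_blocks P.groups_le (by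
            simp [BlockName]
            omega)).1 h)
      (by
        intro ρ hρ h
        simp only [writes_seq, writes_addD] at h
        rcases h with h | h | h | h
        · rcases hρ with rfl | rfl | rfl | rfl | rfl | rfl <;> simp at h
        · exact keepsConst_fetch ρ hρ h
        · rcases hρ with rfl | rfl | rfl | rfl | rfl | rfl <;> simp at h
        · exact keepsConst_blocks P.groups_le ρ hρ h)
      (by
        rintro p t e x ⟨h1, h2, h3, h4, h5, h6, h7, h8⟩
        have hne : ∀ ρ, OutReg k ρ → (t.setReg (lo k (vR i e)) x).reg ρ = t.reg ρ := fun ρ hρ =>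
          Function.update_of_ne (hρ.ne_lo (by simp; omega)) _ _
        have e0 := hne 0 (.inl (by omega))
        refine ⟨h1.of_reg_eq (fun ρ hρ => ?_) h1.peak_le, h2, ?_, ?_, ?_, h6.congr hne, ?_, ?_⟩
        · refine Function.update_of_ne ?_ _ _
          rcases hρ with rfl | rfl | rfl | rfl | rfl | rfl <;> simp <;> omega
        · rw [hRlo _ _ _ (by simp; omega), h3]
        · rw [hRlo _ _ _ (by simp; omega), h4]
        · rw [hRlo _ _ _ (by simp; omega), h5]
        · rwa [e0]
        · rwa [e0])
      (fun p t h => h.1)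
      (by
        rintro p t hp ⟨ht, hlev, hLS, hUS, hV, hGt, hmt, hXt⟩
        have hVle : t.dbl k (vV i) ≤ b + 1 := by rw [hV]; exact lowerBd_le _
        simp only [Nat.mul_add, Nat.mul_one, Nat.add_mul, Nat.one_mul] at hLSle hib hbound
        -- The search position before fetching is the lower bound of the block; the last sum found,
        -- left in `vBest`, is its upper end.
        obtain ⟨t₁, hc₁, ht₁⟩ := addD_spec (k := k) (x := vLS (i + 1)) (a := vLS i) (b := vV i) t
          (by simp) (by simp) (by omega)
        have B₁ := ht.of_noMem hc₁ (by simp) (by simp) (by simp)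
        have M₁ := hc₁.mem_eq (by simp)
        have O₁ : ∀ ρ, OutReg k ρ → t₁.reg ρ = t.reg ρ := fun ρ hρ => hc₁.reg_eq (by
          rw [writes_addD]
          rintro (h | h | h)
          · exact hρ.ne_lo (by simp) h
          · exact hρ.ne_lo (by simp) h
          · exact hρ.ne_hi (by simp) h)
        have hU₁ : HasInput k n U t₁.mem := by
          intro x hx j hj
          rw [M₁, hlev x (by omega) j hj]
          exact hB.input x hx j hj
        obtain ⟨t₂, m₂, hc₂, hm₂, hp₂, hV₂, hBest₂, hblk₂, hoth₂⟩ := P.fetch_spec hir B₁ hU₁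
          (q := p * n) (by rw [hc₁.dbl_eq (by simp) (by simp), hV])
        have B₂ := B₁.of_bigStep hc₂ keepsConst_fetch hp₂
        have O₂ : ∀ ρ, OutReg k ρ → t₂.reg ρ = t.reg ρ := fun ρ hρ => (hc₂.reg_eq (by
          intro h
          rcases writes_fetch h with h | h | h | h | h | h | h | h
          · exact hρ.ne_lo (by simp) h
          · exact hρ.ne_lo (by simp) h
          · exact hρ.ne_hi (by simp) h
          · exact hρ.ne_lo (by simp) h
          · exact hρ.ne_hi (by simp) h
          · exact hρ.ne_lo (by simp) h
          · exact hρ.ne_hi (by simp) h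
          · exact not_nestReg_outReg hρ h)).trans (O₁ ρ hρ)
        have hLS₂ : t₂.dbl k (vLS i) = s.dbl k (vLS i) := by
          rw [hc₂.dbl_eq (hfd _ (by simp)).1 (hfd _ (by simp)).2, hc₁.dbl_eq (by simp) (by simp),
            hLS]
        have hUS₂ : t₂.dbl k (vUS i) = s.dbl k (vUS i) := by
          rw [hc₂.dbl_eq (hfd _ (by simp)).1 (hfd _ (by simp)).2, hc₁.dbl_eq (by simp) (by simp),
            hUS]
        have hLS₂' : t₂.dbl k (vLS (i + 1)) = s.dbl k (vLS i) + lowerBd (D i) b (p * n) := by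
          rw [hc₂.dbl_eq (hfd _ (by simp)).1 (hfd _ (by simp)).2, ht₁, hLS, hV]
        have hBle : t₂.dbl k vBest ≤ b := by rw [hBest₂]; exact nthElt_le _
        obtain ⟨t₃, hc₃, ht₃⟩ := addD_spec (k := k) (x := vUS (i + 1)) (a := vUS i) (b := vBest) t₂
          (by simp) (by simp) (by omega)
        have B₃ := B₂.of_noMem hc₃ (by simp) (by simp) (by simp)
        have M₃ := hc₃.mem_eq (by simp)
        have O₃ : ∀ ρ, OutReg k ρ → t₃.reg ρ = t.reg ρ := fun ρ hρ => (hc₃.reg_eq (by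
          rw [writes_addD]
          rintro (h | h | h)
          · exact hρ.ne_lo (by simp) h
          · exact hρ.ne_lo (by simp) h
          · exact hρ.ne_hi (by simp) h)).trans (O₂ ρ hρ)
        have hlev₃ : ∀ x < k + i, ∀ q < n, levelVal k n t₃.mem x q = levelVal k n s.mem x q := by
          intro x hx q hq
          rw [M₃, hoth₂ x (by omega) (by omega) q hq, M₁, hlev x hx q hq]
        have hblocks : Blocks k g n U (i + 1) (Function.update J i p) t₃ := by
          have hJ : ∀ i' < i, Function.update J i p i' = J i' := fun i' hi' =>
            Function.update_of_ne (by omega) _ _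
          refine ⟨fun x hx j hj => ?_, fun i' hi' q hq => ?_, ?_, ?_⟩
          · rw [hlev₃ x (by omega) j hj]; exact hB.input x hx j hj
          · rcases Nat.lt_succ_iff_lt_or_eq.1 hi' with hi' | rfl
            · rw [hlev₃ _ (by omega) q hq, hJ i' hi', hB.vals i' hi' q hq]
            · rw [M₃, Function.update_self, hblk₂ q hq]
          · rw [hc₃.dbl_eq (by simp) (by simp), hLS₂', Finset.sum_range_succ, Function.update_self,
              hB.lower]
            congr 1
            exact Finset.sum_congr rfl fun i' hi' => by rw [hJ i' (Finset.mem_range.1 hi')]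
          · rw [ht₃, hUS₂, hBest₂, Finset.sum_range_succ, Function.update_self, hB.upper]
            congr 1
            exact Finset.sum_congr rfl fun i' hi' => by rw [hJ i' (Finset.mem_range.1 hi')]
        obtain ⟨t₄, m₄, hc₄, hm₄, hp₄, hlev₄, hG₄, hmono₄, hall₄⟩ := ih (i + 1)
          (Function.update J i p) t₃ (by omega) B₃ hblocks (hGt.congr O₃)
        have e0 : t₃.reg 0 = t.reg 0 := O₃ 0 (.inl (by omega))
        have hk₄ : ∀ y, ¬ BlockName (i + 1) y → t₄.dbl k y = t₃.dbl k y := fun y hy =>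
          hc₄.dbl_eq (not_writes_blocks P.groups_le hy).1 (not_writes_blocks P.groups_le hy).2
        refine ⟨t₄, _, .seq hc₁ (.seq hc₂ (.seq hc₃ hc₄)), ?_, ?_, ?_, ?_, ?_, ?_, hG₄, ?_, ?_⟩
        · have h1 : 1 ≤ n ^ (g + 1) := Nat.one_le_pow _ _ P.n_pos
          have h2 : (30 * g + 90) * n ^ (g + 1) =
            (30 * g + 70) * n ^ (g + 1) + 20 * n ^ (g + 1) := by ring
          omega
        · exact B₃.of_bigStep hc₄ (keepsConst_blocks P.groups_le) hp₄
        · intro x hx q hq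
          rw [hlev₄ x (by omega) q hq, hlev₃ x hx q hq]
        · rw [hk₄ _ (not_blockName_succ (by simp)), hc₃.dbl_eq (by simp) (by simp), hLS₂]
        · rw [hk₄ _ (not_blockName_succ (by simp)), hc₃.dbl_eq (by simp) (by simp), hUS₂]
        · rw [hk₄ _ (not_blockName_succ (by simp)), hc₃.dbl_eq (by simp) (by simp), hV₂,
            Nat.succ_mul]
        · exact fun h => hmono₄ (e0.trans (hmt h))
        · intro J' hJ' hlt hsol
          rcases Nat.lt_succ_iff_lt_or_eq.1 hlt with hlt | heq
          · exact hmono₄ (e0.trans (hXt J' hJ' hlt hsol))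
          · exact hall₄ J' (mem_tuples_succ.2 ⟨hJ', heq⟩).1 hsol)
      (g - 1) 0 s₁ (by simp [hBdef])
      ⟨hs₁, fun x _ q _ => by rw [hmem₁], hb₁.dbl_eq (by simp) (by simp),
        hb₁.dbl_eq (by simp) (by simp), by simp [hv₁, lowerBd], hG.congr hout₁,
        by rw [hout₁ 0 (.inl (by omega))]; exact id, fun _ _ h => absurd h (Nat.not_lt_zero _)⟩
    obtain ⟨h1, h2, h3, h4, h5, h6, h7, h8⟩ := hI'
    refine ⟨s', _, .seq hb₁ hb', ?_, h1.peak_le, h2, h6, h7, fun J' hJ' hsol => ?_⟩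
    · rw [← hBdef, Finset.sum_add_distrib, Finset.sum_add_distrib] at hm
      simp only [Finset.sum_const, Finset.card_range, smul_eq_mul, Nat.zero_add] at hm
      have e1 : nestSum B (c + 1) i cost J =
        ∑ p ∈ Finset.range B, nestSum B c (i + 1) cost (Function.update J i p) := rfl
      have hB1 : 1 ≤ B := Nat.one_le_pow _ _ P.n_pos
      have hn1 : 1 ≤ n ^ (g + 1) := Nat.one_le_pow _ _ P.n_pos
      have hBc : B * 1 ≤ B * B ^ c := Nat.mul_le_mul_left B (Nat.one_le_pow _ _ hB1)
      have hBK : B * K ≤ B ^ (c + 1) * K := by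
        rw [pow_succ']; exact Nat.mul_le_mul_right _ (by omega)
      have e2 : (c + 1) * B ^ (c + 1) * K = B * (c * B ^ c * K) + B ^ (c + 1) * K := by ring
      have e3 : B * K = B * ((30 * g + 90) * n ^ (g + 1)) + B * ((10 * g + 10) * n ^ (g + 1)) := by
        rw [hK]; ring
      have e4 : B * ((10 * g + 10) * 1) ≤ B * ((10 * g + 10) * n ^ (g + 1)) :=
        Nat.mul_le_mul_left _ (Nat.mul_le_mul_left _ hn1)
      have e5 : 6 * (g - 1) * B ≤ 6 * g * B := Nat.mul_le_mul_right _ (by omega)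
      have e6 : B * ((10 * g + 10) * 1) = 6 * g * B + 4 * (g * B) + 10 * B := by ring
      rw [e1, e2]
      omega
    · exact h8 J' hJ' (by
        have := hJ'.1 i le_rfl (by omega)
        omega) hsol

end WordRAM

/-! ### Recovering the entries of the groups, and initialization. -/

namespace WordRAM

variable {w k g r n T pk : ℕ}

/-- For each of the `c` groups from `i` on, find entries with the recorded sum and write them to the
output registers. -/
def recover (k g : ℕ) : ℕ → ℕ → Cmd
  | 0, _ => skip k
  | c + 1, i => (setD k (vA (i * g)) 0 0 ;;
      nest k g (i * g) (eqD k (vA (i * g + g)) (vW i) ;;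
        .branch (lo k vTmp) (outs k g (i * g)) (skip k))) ;; recover k g c (i + 1)

theorem writes_recover {c i ρ : ℕ} (h : (recover k g c i).Writes ρ) :
    (∃ x, i * g ≤ x ∧ x < (i + c) * g ∧ ρ = x + 1) ∨
      ∃ y, (y = vTmp ∨ ∃ x, y = vIdx x ∨ y = vE x ∨ y = vA x) ∧ (ρ = lo k y ∨ ρ = hi k y) := by
  induction c generalizing i with
  | zero => exact .inr ⟨vTmp, .inl rfl, .inl h⟩
  | succ c ih =>
    have e1 : (i + (c + 1)) * g = i * g + g + c * g := by ring
    rcases h with (h | h) | h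
    · exact .inr ⟨vA (i * g), by simp, h.symm⟩
    · rcases writes_nest h with h | h
      · rcases h with h | h | ⟨x, -, -, h | h | h | h | h⟩
        · exact .inr ⟨vTmp, by simp, .inl h⟩
        · exact .inr ⟨vTmp, by simp, .inr h⟩
        · exact .inr ⟨vIdx x, by simp, .inl h⟩
        · exact .inr ⟨vE x, by simp, .inl h⟩
        · exact .inr ⟨vE x, by simp, .inr h⟩
        · exact .inr ⟨vA (x + 1), by simp, .inl h⟩
        · exact .inr ⟨vA (x + 1), by simp, .inr h⟩
      · rcases h with h | h | h
        · exact .inr ⟨vTmp, by simp, writes_eqD.1 h⟩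
        · rcases writes_outs h with h | ⟨x, h1, h2, h3⟩
          · exact .inr ⟨vTmp, by simp, .inl h⟩
          · exact .inl ⟨x, h1, by omega, h3⟩
        · exact .inr ⟨vTmp, by simp, .inl h⟩
    · rcases ih h with ⟨x, h1, h2, h3⟩ | h
      · have e2 : (i + 1) * g = i * g + g := by ring
        have e3 : (i + 1 + c) * g = i * g + g + c * g := by ring
        exact .inl ⟨x, by omega, by omega, h3⟩
      · exact .inr h

/-- The output registers of group `i` contain entries with sum `v`. -/
def Recovered (n g : ℕ) (U : ℕ → ℕ → ℕ) (i v : ℕ) (s : State w) : Prop :=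
  ∃ j : ℕ → ℕ, (∀ x, i * g ≤ x → x < i * g + g → j x < n ∧ s.reg (x + 1) = outVal w (U x (j x))) ∧
    ∑ x ∈ Finset.Ico (i * g) (i * g + g), U x (j x) = v

theorem Params.recover_step (P : Params w k g r n T pk) {U : ℕ → ℕ → ℕ} {i : ℕ} (hir : i < r)
    {s : State w} (hs : Base k n T pk s) (hU : HasInput k n U s.mem) :
    ∃ s' m, BigStep (setD k (vA (i * g)) 0 0 ;;
        nest k g (i * g) (eqD k (vA (i * g + g)) (vW i) ;;
          .branch (lo k vTmp) (outs k g (i * g)) (skip k))) s s' m ∧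
      m ≤ (32 * g + 12) * n ^ g ∧ Base k n T pk s' ∧ s'.mem = s.mem ∧
      (s.dbl k (vW i) ∈ groupSums n g U i → Recovered n g U i (s.dbl k (vW i)) s') := by
  have hw := P.pos
  have hg := P.group_le hir
  have hlo := lo_gt k
  have hhi := hi_gt k
  obtain ⟨s₁, hb₁, hv₁, -⟩ := setD_spec k (vA (i * g)) (h := 0) (l := 0) (Nat.two_pow_pos w)
    (Nat.two_pow_pos w) s
  have hs₁ := hs.of_noMem hb₁ (by simp) (by simp) (by simp)
  have hmem₁ := hb₁.mem_eq (by simp)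
  set v := s.dbl k (vW i) with hv
  let body := eqD k (vA (i * g + g)) (vW i) ;;
    .branch (lo k vTmp) (outs k g (i * g)) (skip k)
  have hbw : ∀ ρ, k < ρ → ρ ≠ lo k vTmp → ρ ≠ hi k vTmp → ¬ body.Writes ρ := by
    intro ρ h1 h2 h3 h
    simp only [body, writes_seq, writes_eqD, writes_branch, writes_skip] at h
    rcases h with (h | h) | h | h
    · exact h2 h
    · exact h3 h
    · rcases writes_outs h with h | ⟨x, -, h4, h⟩
      · exact h2 h
      · omega
    · exact h2 h
  let Inv : Set (ℕ → ℕ) → State w → Prop := fun X t => t.dbl k (vW i) = v ∧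
    ∀ j ∈ X, ∑ x ∈ Finset.Ico (i * g) (i * g + g), U x (j x) = v → Recovered n g U i v t
  obtain ⟨s', m, hb, hm, hp, -, hall⟩ := nest_spec (k := k) (T := T) (pk := pk)
    (r := r) (bnd := 2 ^ w) (μ := s.mem) (body := body)
    P.n_lt P.cells_le P.n_pos (by simp [body]) (fun _ => 2 * g + 8) g (i * g) 0 Inv ∅ (fun _ => 0)
    s₁ (by omega)
    (fun x _ hx j hj => by
      rw [hU x (by omega) j hj]; exact (hU.lt (by omega) hj).le)
    (by
      have := P.le_of_lt
      rw [Nat.zero_add]; exact Nat.mul_lt_mul_of_pos_right (by omega) (Nat.two_pow_pos w))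
    (by
      intro ρ hρ
      refine hbw ρ ?_ ?_ ?_
      · rcases hρ with (h | h | h | h | h | h) | ⟨x, -, -, h | h | h | h | h⟩ <;> rw [h] <;>
        first
        | exact lt_of_le_of_lt (by omega) (hlo _)
        | exact lt_of_le_of_lt (by omega) (hhi _)
      · rcases hρ with (h | h | h | h | h | h) | ⟨x, -, -, h | h | h | h | h⟩ <;> rw [h] <;> simp
      · rcases hρ with (h | h | h | h | h | h) | ⟨x, -, -, h | h | h | h | h⟩ <;> rw [h] <;> simp)
    (by
      rintro X t t' hreg - ⟨h1, h2⟩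
      refine ⟨?_, fun j hj hsum => ?_⟩
      · rw [← h1]
        unfold State.dbl
        rw [hreg _ (by simp [NestReg]), hreg _ (by simp [NestReg])]
      · obtain ⟨j', h3, h4⟩ := h2 j hj hsum
        refine ⟨j', fun x hx hx' => ⟨(h3 x hx hx').1, ?_⟩, h4⟩
        rw [hreg _ (not_nestReg_outReg (.inl (by omega)))]
        exact (h3 x hx hx').2)
    (by
      rintro X j t hj ht hμ ⟨h1, h2⟩ hE hsum
      have hEU : ∀ x, i * g ≤ x → x < i * g + g → t.dbl k (vE x) = U x (j x) := fun x hx hx' => by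
        rw [hE x hx hx', hU x (by omega) _ (hj.1 x hx hx')]
      have hsum' : t.dbl k (vA (i * g + g)) =
          ∑ x ∈ Finset.Ico (i * g) (i * g + g), U x (j x) := by
        rw [hsum, Nat.zero_add]
        refine Finset.sum_congr rfl fun x hx => ?_
        rw [Finset.mem_Ico] at hx
        exact hU x (by omega) _ (hj.1 x hx.1 hx.2)
      obtain ⟨t₁, hc₁, heq⟩ := eqD_spec (k := k) (a := vA (i * g + g)) (b := vW i) hw t
      rw [hsum', h1] at heq
      have p1 := hc₁.peak_eq (by simp) (by simp)
      have d1 : t₁.dbl k (vW i) = v := (hc₁.dbl_eq (by simp) (by simp)).trans h1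
      obtain ⟨t', m', hc', hm', hp', hI'⟩ := BigStep.branch heq (p := outs k g (i * g))
        (q := skip k) (Q := fun u m => m ≤ 2 * g + 2 ∧ u.peak ≤ pk ∧ Inv (X ∪ {j}) u)
        (by
          intro hsumv
          obtain ⟨u, hc, ho⟩ := outs_spec hg t₁
          have hr : Recovered n g U i v u := by
            refine ⟨j, fun x hx hx' => ⟨hj.1 x hx hx', ?_⟩, hsumv⟩
            rw [ho x hx hx', State.reg_lo, hc₁.dbl_eq (by simp) (by simp), hEU x hx hx',
              hc₁.reg_eq (by simp), ht.msb]
            rfl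
          -- Each hit overwrites all output registers of the group, so repeated hits never mix two
          -- choices.
          refine ⟨u, _, hc, by omega, ?_, ?_, fun _ _ _ => hr⟩
          · rw [hc.peak_eq (by simp) (by simp), p1]; exact ht.peak_le
          · rw [hc.dbl_eq (writes_outs_lo hg (by simp)) (writes_outs_hi hg), d1])
        (by
          intro hne
          obtain ⟨u, hc⟩ := skip_spec k t₁
          refine ⟨u, _, hc, by omega, ?_, ?_, ?_⟩
          · rw [hc.peak_eq (by simp) (by simp), p1]; exact ht.peak_le
          · rw [hc.dbl_eq (by simp) (by simp), d1]
          · rintro j' (hj' | rfl) h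
            · obtain ⟨j'', h3, h4⟩ := h2 j' hj' h
              refine ⟨j'', fun x hx hx' => ⟨(h3 x hx hx').1, ?_⟩, h4⟩
              have a1 := hlo vTmp
              have a2 := hhi vTmp
              rw [hc.reg_eq (by rw [writes_skip]; omega),
                hc₁.reg_eq (by rw [writes_eqD]; omega)]
              exact (h3 x hx hx').2
            · exact absurd h hne)
      exact ⟨t', _, .seq hc₁ hc', by omega, hp', hI'⟩)
    hs₁ hmem₁ ⟨hb₁.dbl_eq (by simp) (by simp), fun _ h => h.elim⟩ (by simpa using hv₁)
  refine ⟨s', _, .seq hb₁ hb, ?_, ?_, (hb.mem_eq (noStore_nest (by simp [body]))).trans hmem₁, ?_⟩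
  · rw [nestSum_const] at hm
    have h1 : 1 ≤ n ^ g := Nat.one_le_pow _ _ P.n_pos
    have h2 : (32 * g + 12) * n ^ g = n ^ g * (2 * g + 8) + 30 * g * n ^ g + 4 * n ^ g := by ring
    omega
  · refine hs₁.of_bigStep hb (fun ρ hρ h => ?_) hp
    rcases writes_nest h with h | h
    · exact not_nestReg_constReg hρ h
    · refine hbw ρ ?_ ?_ ?_ h
      · rcases hρ with h | h | h | h | h | h <;> rw [h] <;>
        first
        | exact lt_of_le_of_lt (by omega) (hlo _)
        | exact lt_of_le_of_lt (by omega) (hhi _)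
      · rcases hρ with h | h | h | h | h | h <;> rw [h] <;> simp
      · rcases hρ with h | h | h | h | h | h <;> rw [h] <;> simp
  · rintro ⟨j, hj, hjv⟩
    refine hall (fun x => if i * g ≤ x ∧ x < i * g + g then j x else 0) (.inr ?_) ?_
    · refine ⟨fun x h1 h2 => ?_, fun x hx => ?_⟩
      · simpa [h1, h2] using hj x h1 h2
      · simp only [if_neg hx]
    · rw [← hjv]
      refine Finset.sum_congr rfl fun x hx => ?_
      simp only [if_pos (Finset.mem_Ico.1 hx)]

theorem Params.recover_spec (P : Params w k g r n T pk) {U : ℕ → ℕ → ℕ} (c : ℕ) :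
    ∀ (i : ℕ) (s : State w), i + c = r → Base k n T pk s → HasInput k n U s.mem →
      ∃ s' m, BigStep (recover k g c i) s s' m ∧ m ≤ c * ((32 * g + 13) * n ^ g) + 1 ∧
        s'.peak ≤ pk ∧ ∀ i', i ≤ i' → i' < r → s.dbl k (vW i') ∈ groupSums n g U i' →
          Recovered n g U i' (s.dbl k (vW i')) s' := by
  induction c with
  | zero =>
    intro i s hic hs _
    obtain ⟨s', hb⟩ := skip_spec k s
    refine ⟨s', 1, hb, by omega, ?_, fun i' _ _ => by omega⟩
    rw [hb.peak_eq (by simp) (by simp)]; exact hs.peak_le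
  | succ c ih =>
    intro i s hic hs hU
    obtain ⟨s₁, m₁, hb₁, hm₁, hs₁, hmem₁, hrec₁⟩ := P.recover_step (i := i) (by omega) hs hU
    obtain ⟨s₂, m₂, hb₂, hm₂, hp₂, hrec₂⟩ := ih (i + 1) s₁ (by omega) hs₁ (by rwa [hmem₁])
    have hW : ∀ i', s₁.dbl k (vW i') = s.dbl k (vW i') := by
      intro i'
      -- The code for group `i` is a part of `recover k g 1 i`, whose destinations are already
      -- known.
      have h0 : ∀ ρ, (ρ = lo k (vW i') ∨ ρ = hi k (vW i')) →
          ¬ (recover k g 1 i).Writes ρ := by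
        intro ρ hρ h
        rcases writes_recover h with ⟨x, h1, h2, h3⟩ | ⟨y, h1, h2⟩
        · have := P.group_le (i := i) (by omega)
          have := lo_gt k (vW i')
          have := hi_gt k (vW i')
          rw [Nat.add_mul, Nat.one_mul] at h2
          omega
        · rcases h1 with rfl | ⟨x, rfl | rfl | rfl⟩ <;> rcases hρ with rfl | rfl <;> simp at h2
      exact hb₁.dbl_eq (fun h => h0 _ (.inl rfl) (.inl h)) (fun h => h0 _ (.inr rfl) (.inl h))
    refine ⟨s₂, _, .seq hb₁ hb₂, ?_, hp₂, ?_⟩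
    · have h1 : 1 ≤ n ^ g := Nat.one_le_pow _ _ P.n_pos
      have h2 : (c + 1) * ((32 * g + 13) * n ^ g) =
        c * ((32 * g + 13) * n ^ g) + (32 * g + 12) * n ^ g + n ^ g := by ring
      omega
    · intro i' hi' hir' hmem
      rcases hi'.eq_or_lt with rfl | hlt
      · obtain ⟨j, h1, h2⟩ := hrec₁ hmem
        refine ⟨j, fun x hx hx' => ⟨(h1 x hx hx').1, ?_⟩, h2⟩
        rw [hb₂.reg_eq, (h1 x hx hx').2]
        intro h
        have hk := P.group_le hir'
        -- The later groups write only output registers beyond those of group `i`.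
        rcases writes_recover h with ⟨y, h3, -, h5⟩ | ⟨y, -, h | h⟩
        · rw [Nat.add_mul, Nat.one_mul] at h3
          omega
        · have := lo_gt k y; omega
        · have := hi_gt k y; omega
      · have := hrec₂ i' hlt hir' (by rwa [hW])
        rwa [hW] at this

/-- Set the constant registers; the target is shifted like a sum of `k` entries. -/
def prelude (k : ℕ) : Cmd :=
  (.op .or (lo k vN) 0 0 ;; setD k vOne 0 1 ;; .op .sub (lo k vTmp) 2 (lo k vOne) ;;
    .op .shl (lo k vMsb) (lo k vOne) (lo k vTmp)) ;;
  (setD k vT ((k - 1) / 2) ((k - 1) % 2) ;; .op .mul (lo k vT) (lo k vT) (lo k vMsb) ;;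
    .op .add (lo k vX) 1 (lo k vMsb) ;; .const (hi k vX) 0) ;;
  addD k vBest vT vX ;; copyD k vT vBest ;; .const 0 0 ;; setD k (vLS 0) 0 0 ;; setD k (vUS 0) 0 0

/-- The target, shifted like a sum of `k` entries. -/
def shiftedTarget (k : ℕ) (t : BitVec w) : ℕ :=
  (t + BitVec.ofNat w (2 ^ (w - 1))).toNat + (k - 1) * 2 ^ (w - 1)

theorem two_pow_pred (hw : 0 < w) : 2 ^ w = 2 * 2 ^ (w - 1) := by
  rw [← pow_succ']; congr 1; omega

/-- This places every target below the sentinel, so padding never produces a solution. -/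
theorem shiftedTarget_lt (hw : 0 < w) (hk : 1 ≤ k) (t : BitVec w) :
    shiftedTarget k t < k * 2 ^ w := by
  obtain ⟨k, rfl⟩ := Nat.exists_eq_add_of_le' hk
  have h1 := (t + BitVec.ofNat w (2 ^ (w - 1))).isLt
  have h2 : k * 2 ^ (w - 1) ≤ k * 2 ^ w :=
    Nat.mul_le_mul_left _ (Nat.pow_le_pow_right (by omega) (by omega))
  rw [shiftedTarget, Nat.add_mul, Nat.add_sub_cancel]
  omega

theorem prelude_spec (hw : 0 < w) (hk : 1 ≤ k) (hkw : k + 1 < 2 ^ w) {t : BitVec w} {s : State w}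
    (h0 : s.reg 0 = BitVec.ofNat w n) (h1 : s.reg 1 = t) (h2 : s.reg 2 = BitVec.ofNat w w)
    (hpk : s.peak ≤ pk) :
    ∃ s' m, BigStep (prelude k) s s' m ∧ m ≤ 60 ∧ Base k n (shiftedTarget k t) pk s' ∧
      s'.mem = s.mem ∧ s'.reg 0 = 0#w ∧ s'.dbl k (vLS 0) = 0 ∧ s'.dbl k (vUS 0) = 0 := by
  have hlo := lo_gt k
  have hhi := hi_gt k
  have hpp := two_pow_pred hw
  have hltp : 2 ^ (w - 1) < 2 ^ w := Nat.pow_lt_pow_right (by omega) (by omega)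
  have hww : w < 2 ^ w := Nat.lt_two_pow_self
  have hlt : ∀ x, lo k x ≠ 0 ∧ lo k x ≠ 1 ∧ lo k x ≠ 2 ∧ hi k x ≠ 0 ∧ hi k x ≠ 1 ∧ hi k x ≠ 2 := by
    intro x
    have := hlo x
    have := hhi x
    omega
  have hlt' : ∀ x, 0 ≠ lo k x ∧ 1 ≠ lo k x ∧ 2 ≠ lo k x ∧ 0 ≠ hi k x ∧ 1 ≠ hi k x ∧ 2 ≠ hi k x := by
    intro x
    have := hlo x
    have := hhi x
    omega
  -- The program does not depend on `w`, so `2 ^ (w - 1)` is made by shifting, with the word length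
  -- taken from register 2.
  have hshl : (1#w <<< (BitVec.ofNat w w - 1#w)) = BitVec.ofNat w (2 ^ (w - 1)) := by
    have e : (BitVec.ofNat w w - 1#w).toNat = w - 1 := by
      rw [BitVec.toNat_sub]
      simp only [BitVec.toNat_ofNat]
      rw [Nat.mod_eq_of_lt hww, Nat.mod_eq_of_lt (by omega : 1 < 2 ^ w),
        show 2 ^ w - 1 + w = w - 1 + 2 ^ w by omega, Nat.add_mod_right,
        Nat.mod_eq_of_lt (by omega)]
    apply BitVec.eq_of_toNat_eq
    rw [BitVec.shiftLeft_eq', e, BitVec.toNat_shiftLeft, BitVec.toNat_ofNat, BitVec.toNat_ofNat,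
      Nat.mod_eq_of_lt (by omega : 1 < 2 ^ w), Nat.one_shiftLeft]
  obtain ⟨a₁, hb₁, e1, e2, e3, e4⟩ : ∃ a, BigStep (.op .or (lo k vN) 0 0 ;; setD k vOne 0 1 ;;
      .op .sub (lo k vTmp) 2 (lo k vOne) ;; .op .shl (lo k vMsb) (lo k vOne) (lo k vTmp)) s a 9 ∧
      a.reg (lo k vN) = BitVec.ofNat w n ∧ a.reg (lo k vOne) = 1#w ∧ a.reg (hi k vOne) = 0#w ∧
      a.reg (lo k vMsb) = BitVec.ofNat w (2 ^ (w - 1)) := by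
    refine ⟨_, .seq (.op _ _ _ _ _) (.seq (.seq (.const _ _ _) (.const _ _ _))
      (.seq (.op _ _ _ _ _) (.op _ _ _ _ _))), ?_, ?_, ?_, ?_⟩
    · simp [State.setReg, Op.eval, h0]
    · simp [State.setReg]
    · simp [State.setReg]
    · simpa [State.setReg, Op.eval, h2, hlt' _] using hshl
  -- `(k - 1) * 2 ^ (w - 1)` has high word `(k - 1) / 2`, and its low word is `2 ^ (w - 1)` or `0`
  -- according to the parity of `k - 1`.
  obtain ⟨a₂, hb₂, f1, f2⟩ : ∃ a, BigStep (setD k vT ((k - 1) / 2) ((k - 1) % 2) ;;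
      .op .mul (lo k vT) (lo k vT) (lo k vMsb) ;;
      .op .add (lo k vX) 1 (lo k vMsb) ;; .const (hi k vX) 0) a₁ a 9 ∧
      a.dbl k vT = (k - 1) * 2 ^ (w - 1) ∧
      a.dbl k vX = (t + BitVec.ofNat w (2 ^ (w - 1))).toNat := by
    refine ⟨_, .seq (.seq (.const _ _ _) (.const _ _ _)) (.seq (.op _ _ _ _ _)
      (.seq (.op _ _ _ _ _) (.const _ _ _))), ?_, ?_⟩
    · have e5 : ((k - 1) / 2) % 2 ^ w = (k - 1) / 2 := Nat.mod_eq_of_lt (by omega)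
      have e6 : ((k - 1) % 2 * 2 ^ (w - 1)) % 2 ^ w = (k - 1) % 2 * 2 ^ (w - 1) := by
        apply Nat.mod_eq_of_lt
        rcases Nat.mod_two_eq_zero_or_one (k - 1) with h | h <;> rw [h] <;> omega
      simp only [State.dbl, dword, State.setReg, Op.eval, Function.update_apply, lo_inj, hi_inj,
        lo_ne_hi, hi_ne_lo, if_true, if_false, e4, Nat.pair_eq_pair]
      simp only [Nat.reduceEqDiff, and_false, if_false, ← BitVec.ofNat_mul, BitVec.toNat_ofNat, e5,
        e6]
      rw [hpp]
      have := Nat.div_add_mod (k - 1) 2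
      calc (k - 1) / 2 * (2 * 2 ^ (w - 1)) + (k - 1) % 2 * 2 ^ (w - 1)
          = (2 * ((k - 1) / 2) + (k - 1) % 2) * 2 ^ (w - 1) := by ring
        _ = (k - 1) * 2 ^ (w - 1) := by rw [this]
    · have e5 : a₁.reg 1 = t := by
        rw [hb₁.reg_eq, h1]
        simp [hlt' _]
      simp [State.dbl, dword, State.setReg, Op.eval, hlt' _, e5, e4]
  have hT := shiftedTarget_lt hw hk t
  have hkW : k * 2 ^ w ≤ 2 ^ w * 2 ^ w := Nat.mul_le_mul_right _ (by omega)
  -- The destination of `addD` must differ from its first summand, so the sum goes through `vBest`.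
  obtain ⟨a₃, hb₃, f3⟩ := addD_spec (k := k) (x := vBest) (a := vT) (b := vX) a₂ (by simp)
    (by simp) (by rw [f1, f2]; unfold shiftedTarget at hT; omega)
  obtain ⟨a₄, hb₄, f4⟩ := copyD_spec k vT vBest a₃
  obtain ⟨a₅, hb₅, f5⟩ : ∃ a, BigStep (.const 0 0) a₄ a 1 ∧ a.reg 0 = 0#w :=
    ⟨_, .const _ _ _, by simp [State.setReg]⟩
  obtain ⟨a₆, hb₆, f6, -⟩ := setD_spec k (vLS 0) (h := 0) (l := 0) (Nat.two_pow_pos w)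
    (Nat.two_pow_pos w) a₅
  obtain ⟨a₇, hb₇, f7, -⟩ := setD_spec k (vUS 0) (h := 0) (l := 0) (Nat.two_pow_pos w)
    (Nat.two_pow_pos w) a₆
  refine ⟨a₇, _, .seq hb₁ (.seq hb₂ (.seq hb₃ (.seq hb₄ (.seq hb₅ (.seq hb₆ hb₇))))), by omega,
    ⟨?_, ?_, ?_, ?_, ?_, ?_⟩, ?_, ?_, ?_, ?_⟩
  · rw [hb₇.reg_eq, hb₆.reg_eq, hb₅.reg_eq, hb₄.reg_eq, hb₃.reg_eq, hb₂.reg_eq, e1] <;>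
      simp [hlt _]
  · rw [hb₇.reg_eq, hb₆.reg_eq, hb₅.reg_eq, hb₄.reg_eq, hb₃.reg_eq, hb₂.reg_eq, e2] <;>
      simp [hlt _]
  · rw [hb₇.reg_eq, hb₆.reg_eq, hb₅.reg_eq, hb₄.reg_eq, hb₃.reg_eq, hb₂.reg_eq, e3] <;>
      simp [hlt _]
  · rw [hb₇.reg_eq, hb₆.reg_eq, hb₅.reg_eq, hb₄.reg_eq, hb₃.reg_eq, hb₂.reg_eq, e4] <;>
      simp [hlt _]
  · rw [hb₇.dbl_eq, hb₆.dbl_eq, hb₅.dbl_eq, f4, f3, f1, f2, shiftedTarget, Nat.add_comm] <;>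
      simp [hlt _]
  · rw [hb₇.peak_eq, hb₆.peak_eq, hb₅.peak_eq, hb₄.peak_eq, hb₃.peak_eq, hb₂.peak_eq,
      hb₁.peak_eq] <;> simp [hpk]
  · rw [hb₇.mem_eq, hb₆.mem_eq, hb₅.mem_eq, hb₄.mem_eq, hb₃.mem_eq, hb₂.mem_eq,
      hb₁.mem_eq] <;> simp
  · rw [hb₇.reg_eq, hb₆.reg_eq, f5] <;> simp [hlt' _]
  · rw [hb₇.dbl_eq, f6] <;> simp
  · rw [f7]; simp

end WordRAM

/-! ### Correctness of the whole program and the number of its steps. -/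

namespace WordRAM

variable {w k g r n T pk : ℕ}

theorem sum_groups_add (h : r * g ≤ k) (f : ℕ → ℕ) :
    ∑ i ∈ Finset.range r, ∑ x ∈ Finset.Ico (i * g) (i * g + g), f x +
      ∑ x ∈ Finset.Ico (r * g) k, f x = ∑ x ∈ Finset.range k, f x := by
  rw [← Finset.sum_range_add_sum_Ico f h, ← sum_range_mul]
  simp only [Finset.sum_Ico_eq_sum_range, Nat.add_sub_cancel_left]

/-- The arrays `U` have a choice of entries with sum `T` exactly if some choice of blocks has. -/
theorem Params.exists_blockSol (P : Params w k g r n T pk) {U : ℕ → ℕ → ℕ} {j : ℕ → ℕ}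
    (hj : ∀ x < k, j x < n) (hT : ∑ x ∈ Finset.range k, U x (j x) = T) :
    ∃ J ∈ tuples (n ^ (g - 1)) r 0 (fun _ => 0), BlockSol k g r n T (k * 2 ^ w) U J := by
  have hn := P.n_pos
  have hsum := sum_groups_add P.groups_le fun x => U x (j x)
  -- The contribution of a group is at most the target and hence below the sentinel, so it occurs
  -- among the first `n ^ g` elements of the list.
  have hex : ∀ i, ∃ q, i < r → q < n ^ g ∧ nthElt (groupSums n g U i) (k * 2 ^ w) q =
      ∑ x ∈ Finset.Ico (i * g) (i * g + g), U x (j x) := by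
    intro i
    by_cases hi : i < r
    · obtain ⟨F, hF, hcard⟩ := rangeSums_subset n U g (i * g)
      have hk := P.group_le hi
      have hle := Finset.single_le_sum
        (f := fun i => ∑ x ∈ Finset.Ico (i * g) (i * g + g), U x (j x))
        (fun _ _ => Nat.zero_le _) (Finset.mem_range.2 hi)
      have hlt := P.target_lt
      obtain ⟨q, hq⟩ := exists_nthElt_eq (b := k * 2 ^ w) hF hcard
        ⟨j, fun x _ hx => hj x (by omega), rfl⟩ (by omega)
      exact ⟨q, fun _ => hq⟩
    · exact ⟨0, fun h => absurd h hi⟩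
  choose q hq using hex
  have hpow : n ^ (g - 1) * n = n ^ g := by
    rw [← pow_succ, Nat.sub_add_cancel P.g_pos]
  -- Element number `q i` lies in block number `q i / n`; the zeros beyond `r` agree with the
  -- initial sequence of the loops.
  refine ⟨fun i => if i < r then q i / n else 0, ⟨fun i _ hi => ?_, fun i hi => ?_⟩, q, j,
    fun i hi => ?_, fun x _ hx => hj x hx, ?_⟩
  · rw [Nat.zero_add] at hi
    simp only [if_pos hi]
    exact Nat.div_lt_of_lt_mul (by rw [Nat.mul_comm, hpow]; exact (hq i hi).1)
  · simp only [Nat.zero_add, Nat.zero_le, true_and] at hi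
    simp only [if_neg hi]
  · simp only [if_pos hi]
    have h1 := Nat.div_add_mod (q i) n
    have h2 := Nat.mod_lt (q i) hn
    rw [Nat.mul_comm] at h1
    omega
  · rw [Finset.sum_congr rfl fun i hi => (hq i (Finset.mem_range.1 hi)).2, hsum, hT]

/-- The whole program: an algorithm for `k`-SUM with `r` groups of `g` arrays. -/
def solver (k g r : ℕ) : Cmd := prelude k ;; blocks k g r r 0 ;; recover k g r 0

/-- Every solution lies in some combination of blocks, so register 0 still being zero at the end
proves that there is none. Otherwise the record fixes the single entries and a sum for each group,
which recovery replaces by entries. -/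
theorem Params.solver_spec {t : BitVec w} (P : Params w k g r n (shiftedTarget k t) pk)
    (hk : 1 ≤ k) {U : ℕ → ℕ → ℕ} {s : State w} (h0 : s.reg 0 = BitVec.ofNat w n)
    (h1 : s.reg 1 = t) (h2 : s.reg 2 = BitVec.ofNat w w) (hpk : s.peak ≤ pk)
    (hU : HasInput k n U s.mem) :
    ∃ s' m, BigStep (solver k g r) s s' m ∧
      m ≤ nestSum (n ^ (g - 1)) r 0 (streamCost k g r n (shiftedTarget k t) (k * 2 ^ w) U)
        (fun _ => 0) + r * (n ^ (g - 1)) ^ r * ((40 * g + 100) * n ^ (g + 1)) +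
        r * ((32 * g + 13) * n ^ g) + 63 ∧
      s'.peak ≤ pk ∧
      ((s'.reg 0 = 1#w ∧ ∃ j : ℕ → ℕ,
          (∀ x < k, j x < n ∧ s'.reg (x + 1) = outVal w (U x (j x))) ∧
          ∑ x ∈ Finset.range k, U x (j x) = shiftedTarget k t) ∨
        (s'.reg 0 = 0#w ∧ ¬ ∃ j : ℕ → ℕ, (∀ x < k, j x < n) ∧
          ∑ x ∈ Finset.range k, U x (j x) = shiftedTarget k t)) := by
  have hw := P.pos
  have hrg := P.groups_le
  obtain ⟨s₁, m₁, hb₁, hm₁, hs₁, hmem₁, hz, hL, hR⟩ :=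
    prelude_spec (n := n) hw hk P.le_of_lt h0 h1 h2 hpk
  obtain ⟨s₂, m₂, hb₂, hm₂, hp₂, hlev, hG, -, hall⟩ := P.blocks_spec (U := U) r 0 (fun _ => 0) s₁
    (by omega) hs₁ ⟨by rwa [hmem₁], by omega, by simpa using hL, by simpa using hR⟩ (.inl hz)
  have hU₂ : HasInput k n U s₂.mem := fun x hx j hj => by
    rw [hlev x hx j hj, hmem₁, hU x hx j hj]
  obtain ⟨s₃, m₃, hb₃, hm₃, hp₃, hrec⟩ := P.recover_spec (U := U) r 0 s₂ (by omega)
    (hs₁.of_bigStep hb₂ (keepsConst_blocks hrg) hp₂) hU₂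
  -- Among the output registers, recovery writes only those of the grouped arrays.
  have hkeep : ∀ ρ, ρ = 0 ∨ (r * g < ρ ∧ ρ ≤ k) → s₃.reg ρ = s₂.reg ρ := by
    refine fun ρ hρ => hb₃.reg_eq fun h => ?_
    rcases writes_recover h with ⟨x, -, h3, h4⟩ | ⟨y, -, h | h⟩
    · rw [Nat.zero_add] at h3; omega
    · have := lo_gt k y; omega
    · have := hi_gt k y; omega
  refine ⟨s₃, _, .seq hb₁ (.seq hb₂ hb₃), by omega, hp₃, ?_⟩
  rcases hG with hG | ⟨hG, j, hj, hgr, hsum⟩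
  · refine .inr ⟨(hkeep 0 (.inl rfl)).trans hG, ?_⟩
    rintro ⟨j, hj, hT⟩
    obtain ⟨J, hJ, hS⟩ := P.exists_blockSol hj hT
    have := hall J hJ hS
    rw [hG] at this
    have := congrArg BitVec.toNat this
    simp only [BitVec.toNat_ofNat, Nat.zero_mod] at this
    rw [Nat.mod_eq_of_lt (Nat.one_lt_two_pow (by omega))] at this
    omega
  · refine .inl ⟨(hkeep 0 (.inl rfl)).trans hG, ?_⟩
    have hrec' : ∀ i, ∃ jj : ℕ → ℕ, i < r → (∀ x, i * g ≤ x → x < i * g + g →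
        jj x < n ∧ s₃.reg (x + 1) = outVal w (U x (jj x))) ∧
        ∑ x ∈ Finset.Ico (i * g) (i * g + g), U x (jj x) = s₂.dbl k (vW i) := by
      intro i
      by_cases hi : i < r
      · obtain ⟨jj, h⟩ := hrec i (Nat.zero_le _) hi (hgr i hi)
        exact ⟨jj, fun _ => h⟩
      · exact ⟨fun _ => 0, fun h => absurd h hi⟩
    choose jj hjj using hrec'
    have hg := P.g_pos
    refine ⟨fun x => if x < r * g then jj (x / g) x else j x, fun x hx => ?_, ?_⟩
    · by_cases hxr : x < r * g
      · simp only [if_pos hxr]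
        have h3 : x / g < r := Nat.div_lt_of_lt_mul (by rwa [Nat.mul_comm])
        have h4 := Nat.div_add_mod x g
        have h5 := Nat.mod_lt x hg
        rw [Nat.mul_comm] at h4
        exact (hjj _ h3).1 x (by omega) (by omega)
      · simp only [if_neg hxr]
        have := hj x (by omega) hx
        rwa [hkeep (x + 1) (.inr (by omega))]
    · rw [← sum_groups_add hrg, ← hsum]
      congr 1
      · refine Finset.sum_congr rfl fun i hi => ?_
        rw [Finset.mem_range] at hi
        rw [← (hjj i hi).2]
        refine Finset.sum_congr rfl fun x hx => ?_
        rw [Finset.mem_Ico] at hx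
        have h3 : (i + 1) * g ≤ r * g := Nat.mul_le_mul_right _ hi
        rw [Nat.add_mul, Nat.one_mul] at h3
        have h4 : x / g = i := by
          rw [Nat.div_eq_iff hg]; omega
        simp only [if_pos (show x < r * g by omega), h4]
      · refine Finset.sum_congr rfl fun x hx => ?_
        rw [Finset.mem_Ico] at hx
        simp only [if_neg (show ¬ x < r * g by omega)]

/-- The numbers of steps of all searches for partners of entries outside of the groups. -/
theorem nestSum_streamCost_le {b : ℕ} {U : ℕ → ℕ → ℕ} (hn : 1 ≤ n) (j₀ : ℕ → ℕ) :
    nestSum (n ^ (g - 1)) r 0 (streamCost k g r n T b U) j₀ ≤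
      (n ^ (g - 1)) ^ r * ((30 * k + 50) * n ^ (k - r * g)) +
        n ^ (k - r * g) * ((r + 1) * (n ^ (g - 1)) ^ (r - 1)) *
          ((2 * k + 34 * r + 15) * n ^ r) := by
  unfold streamCost
  rw [nestSum_add, nestSum_const, nestSum_mul_const]
  gcongr
  unfold candidates
  -- Exchange the summations: with the entries outside the groups fixed, the block combinations that
  -- pass the test are few.
  rw [nestSum_comm, ← nestSum_const n (k - r * g) (r * g) _ fun _ => 0]
  refine nestSum_mono (fun j => nestSum_intervals_le
    (L := fun i p => lowerBd (groupSums n g U i) b (p * n))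
    (M := fun i p => nthElt (groupSums n g U i) b (p * n + (n - 1))) (fun i p p' h => ?_) _) _
  apply nthElt_lt_lowerBd
  have := Nat.mul_le_mul_right n (Nat.succ_le_of_lt h)
  rw [Nat.succ_mul] at this
  omega

end WordRAM

/-! ### Exponents, and the shift from signed to nonnegative numbers. -/

namespace WordRAM

theorem solver_steps_le {k g r n : ℕ} (hn : 1 ≤ n) (hg : 1 ≤ g) (hr : r = g - 1)
    (hgk : g * g ≤ k) {T b : ℕ} {U : ℕ → ℕ → ℕ} {m : ℕ} (j₀ : ℕ → ℕ)
    (hm : m ≤ nestSum (n ^ (g - 1)) r 0 (streamCost k g r n T b U) j₀ +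
      r * (n ^ (g - 1)) ^ r * ((40 * g + 100) * n ^ (g + 1)) +
      r * ((32 * g + 13) * n ^ g) + 63) :
    m ≤ ((30 * k + 50) + (r + 1) * (2 * k + 34 * r + 15) + r * (40 * g + 100) + r * (32 * g + 13) +
      63) * n ^ (max (k - g + 1) (g * g - g + 2)) := by
  set e := max (k - g + 1) (g * g - g + 2) with he
  have he1 : k - g + 1 ≤ e := le_max_left _ _
  have he2 : g * g - g + 2 ≤ e := le_max_right _ _
  have h := hm.trans (Nat.add_le_add_right (Nat.add_le_add_right (Nat.add_le_add_right
    (nestSum_streamCost_le (g := g) (r := r) (k := k) (T := T) (b := b) (U := U) hn j₀) _) _) _)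
  have hp : ∀ a, a ≤ e → n ^ a ≤ n ^ e := fun a ha => Nat.pow_le_pow_right hn ha
  obtain ⟨r', rfl⟩ := Nat.exists_eq_add_of_le' hg
  obtain rfl : r = r' := by omega
  simp only [Nat.add_sub_cancel] at h
  have f1 : (r + 1) * (r + 1) = r * r + r + r + 1 := by ring
  have f2 : r * (r + 1) = r * r + r := by ring
  have f3 : r * (r - 1) + r = r * r := by
    rcases r with _ | r
    · rfl
    · rw [Nat.add_sub_cancel]; ring
  -- With `g = r + 1`, the exponents in `p1` and `p2` are at most `k - r = k - g + 1`, and the one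
  -- in `p3` is `r * r + r + 2 = g * g - g + 2`.
  have p1 : (n ^ r) ^ r * n ^ (k - r * (r + 1)) ≤ n ^ e := by
    rw [← pow_mul, ← pow_add]; exact hp _ (by omega)
  have p2 : n ^ (k - r * (r + 1)) * (n ^ r) ^ (r - 1) * n ^ r ≤ n ^ e := by
    rw [← pow_mul, ← pow_add, ← pow_add]; exact hp _ (by omega)
  have p3 : (n ^ r) ^ r * n ^ (r + 1 + 1) ≤ n ^ e := by
    rw [← pow_mul, ← pow_add]; exact hp _ (by omega)
  have p4 : n ^ (r + 1) ≤ n ^ e := hp _ (by omega)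
  have p5 : 1 ≤ n ^ e := Nat.one_le_pow _ _ hn
  calc m ≤ _ := h
    _ = (30 * k + 50) * ((n ^ r) ^ r * n ^ (k - r * (r + 1))) +
        (r + 1) * (2 * k + 34 * r + 15) *
          (n ^ (k - r * (r + 1)) * (n ^ r) ^ (r - 1) * n ^ r) +
        r * (40 * (r + 1) + 100) * ((n ^ r) ^ r * n ^ (r + 1 + 1)) +
        r * (32 * (r + 1) + 13) * n ^ (r + 1) + 63 * 1 := by ring
    _ ≤ (30 * k + 50) * n ^ e + (r + 1) * (2 * k + 34 * r + 15) * n ^ e +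
        r * (40 * (r + 1) + 100) * n ^ e + r * (32 * (r + 1) + 13) * n ^ e + 63 * n ^ e := by
      gcongr
    _ = _ := by ring

/-- The first exponent is bounded by `√k ≤ g + 1`. The second is bounded because `x ^ 2 - x`
increases for `x ≥ 1` and `g ≤ √k`. -/
theorem exponent_le {k g : ℕ} (hg : 1 ≤ g) (h1 : g * g ≤ k) (h2 : k < (g + 1) * (g + 1)) :
    ((max (k - g + 1) (g * g - g + 2) : ℕ) : ℝ) ≤ (k : ℝ) - Real.sqrt k + 2 := by
  have hgg : g ≤ g * g := Nat.le_mul_of_pos_left g hg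
  have hs := Real.sq_sqrt (Nat.cast_nonneg (α := ℝ) k)
  have hlow : (g : ℝ) ≤ Real.sqrt k := Real.le_sqrt_of_sq_le (by rw [sq]; exact_mod_cast h1)
  have hup : Real.sqrt k ≤ (g : ℝ) + 1 := Real.sqrt_le_iff.2 ⟨by positivity, by
    rw [sq]; exact_mod_cast h2.le⟩
  have hg' : (1 : ℝ) ≤ g := by exact_mod_cast hg
  rw [Nat.cast_max, max_le_iff]
  constructor
  · rw [Nat.cast_add, Nat.cast_sub (hgg.trans h1)]
    push_cast
    linarith
  · rw [Nat.cast_add, Nat.cast_sub hgg]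
    push_cast
    nlinarith

section Shift

variable {w : ℕ}

/-- Addition of `2 ^ (w - 1)` modulo `2 ^ w` flips the sign bit, which maps the signed range onto
the unsigned one by a translation. -/
theorem toNat_add_msb (hw : 0 < w) (x : BitVec w) :
    ((x + BitVec.ofNat w (2 ^ (w - 1))).toNat : ℤ) = x.toInt + 2 ^ (w - 1) := by
  have hpp := two_pow_pred hw
  have hx := x.isLt
  rw [BitVec.toInt_eq_toNat_cond, BitVec.toNat_add, BitVec.toNat_ofNat,
    Nat.mod_eq_of_lt (a := 2 ^ (w - 1)) (by omega)]
  have e : (2 : ℤ) ^ (w - 1) = ((2 ^ (w - 1) : ℕ) : ℤ) := by push_cast; rfl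
  rw [e]
  split_ifs with h
  · rw [Nat.mod_eq_of_lt (by omega)]
    push_cast; ring
  · rw [show x.toNat + 2 ^ (w - 1) = x.toNat - 2 ^ (w - 1) + 2 ^ w by omega, Nat.add_mod_right,
      Nat.mod_eq_of_lt (by omega)]
    omega

theorem outVal_toNat (x : BitVec w) :
    outVal w (x + BitVec.ofNat w (2 ^ (w - 1))).toNat = x := by
  rw [outVal, BitVec.ofNat_toNat, BitVec.setWidth_eq, BitVec.add_sub_cancel]

end Shift

end WordRAM

/-! ### Translation to the given instance. -/

namespace KSum

open WordRAM

variable {k n w : ℕ}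

/-- The shifted entries of the arrays. -/
def shifted (S : Fin k → Fin n → BitVec w) (x j : ℕ) : ℕ :=
  if h : x < k ∧ j < n then (S ⟨x, h.1⟩ ⟨j, h.2⟩ + BitVec.ofNat w (2 ^ (w - 1))).toNat else 0

theorem shifted_eq (S : Fin k → Fin n → BitVec w) (x : Fin k) (j : Fin n) :
    shifted S x j = (S x j + BitVec.ofNat w (2 ^ (w - 1))).toNat :=
  dif_pos ⟨x.isLt, j.isLt⟩

theorem hasInput_init (P : Cmd) (S : Fin k → Fin n → BitVec w) (t : BitVec w)
    (h : k * n ≤ 2 ^ w) : HasInput k n (shifted S) (init P S t).state.mem := by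
  intro x hx j hj
  have hlt : x * n + j < k * n := by
    have := Nat.mul_le_mul_right n (Nat.succ_le_of_lt hx)
    rw [Nat.succ_mul] at this
    omega
  have e : (BitVec.ofNat w (x * n + j)).toNat = x * n + j := by
    rw [BitVec.toNat_ofNat, Nat.mod_eq_of_lt (by omega)]
  have hp : finProdFinEquiv.symm (⟨(BitVec.ofNat w (x * n + j)).toNat, by omega⟩ : Fin (k * n)) =
      (⟨x, hx⟩, ⟨j, hj⟩) := by
    rw [Equiv.symm_apply_eq]
    apply Fin.ext
    simp only [finProdFinEquiv_apply_val, e]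
    ring
  rw [levelVal, if_pos hx, shifted, dif_pos ⟨hx, hj⟩]
  congr 2
  simp only [init]
  rw [dif_pos (by omega), hp]

/-- Both sides of the equation are increased by `k * 2 ^ (w - 1)`: the sum once for each term, the
target once through its own shift and `k - 1` times through the added multiple. -/
theorem sum_shifted_eq_iff (hw : 0 < w) (hk : 1 ≤ k) (S : Fin k → Fin n → BitVec w) (t : BitVec w)
    (j : Fin k → Fin n) (j' : ℕ → ℕ) (h : ∀ i : Fin k, j' i = j i) :
    ∑ x ∈ Finset.range k, shifted S x (j' x) = shiftedTarget k t ↔ IsSolution S t j := by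
  have h1 : ∀ i : Fin k, ((shifted S i (j' i) : ℕ) : ℤ) = (S i (j i)).toInt + 2 ^ (w - 1) := by
    intro i
    rw [h, shifted_eq, toNat_add_msb hw]
  rw [Finset.sum_range, IsSolution, ← Nat.cast_inj (R := ℤ), shiftedTarget]
  push_cast
  rw [Finset.sum_congr rfl fun i _ => h1 i, toNat_add_msb hw, Finset.sum_add_distrib,
    Nat.cast_sub hk]
  simp only [Finset.sum_const, Finset.card_univ, Fintype.card_fin, nsmul_eq_mul, Nat.cast_one]
  constructor <;> intro h <;> linarith

theorem correctOutput_of_shifted (hw : 0 < w) (hk : 1 ≤ k) (S : Fin k → Fin n → BitVec w)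
    (t : BitVec w) {s : State w}
    (h : (s.reg 0 = 1#w ∧ ∃ j : ℕ → ℕ,
          (∀ x < k, j x < n ∧ s.reg (x + 1) = outVal w (shifted S x (j x))) ∧
          ∑ x ∈ Finset.range k, shifted S x (j x) = shiftedTarget k t) ∨
        (s.reg 0 = 0#w ∧ ¬ ∃ j : ℕ → ℕ, (∀ x < k, j x < n) ∧
          ∑ x ∈ Finset.range k, shifted S x (j x) = shiftedTarget k t)) :
    CorrectOutput S t s := by
  rcases h with ⟨h0, j, hj, hsum⟩ | ⟨h0, hno⟩
  · let j' : Fin k → Fin n := fun i => ⟨j i, (hj i i.isLt).1⟩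
    refine .inl ⟨h0, j', (sum_shifted_eq_iff hw hk S t j' j fun _ => rfl).1 hsum, fun i => ?_⟩
    rw [(hj i i.isLt).2, show j i = (j' i : ℕ) from rfl, shifted_eq, outVal_toNat]
  · refine .inr ⟨h0, fun ⟨j, hj⟩ => hno ?_⟩
    refine ⟨fun x => if h : x < k then j ⟨x, h⟩ else 0, fun x hx => ?_, ?_⟩
    · simp only [dif_pos hx, Fin.is_lt]
    · exact (sum_shifted_eq_iff hw hk S t j _ fun i => by simp).2 hj

end KSum

theorem mainTheorem3 (k : ℕ) (hk : 1 ≤ k) :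
    ∃ (P : WordRAM.Cmd) (C c : ℕ),
      KSum.IsLasVegas k P
        (fun n => (C : ℝ) * (n : ℝ) ^ ((k : ℝ) - Real.sqrt (k : ℝ) + 2) *
          Real.log ((n : ℝ) + 1) ^ c)
        (fun n => C * n) := by
  -- `g = ⌊√k⌋`; with `r = g - 1` the groups take `g * g - g ≤ k` arrays.
  obtain ⟨g, hg, hgk, hgk'⟩ : ∃ g, 1 ≤ g ∧ g * g ≤ k ∧ k < (g + 1) * (g + 1) :=
    ⟨_, Nat.le_sqrt.2 (by omega), Nat.sqrt_le k, Nat.lt_succ_sqrt k⟩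
  obtain ⟨r, hr⟩ : ∃ r, r = g - 1 := ⟨_, rfl⟩
  obtain ⟨C₀, hC₀⟩ : ∃ C₀, C₀ = (30 * k + 50) + (r + 1) * (2 * k + 34 * r + 15) +
    r * (40 * g + 100) + r * (32 * g + 13) + 63 := ⟨_, rfl⟩
  obtain ⟨P, hP⟩ : ∃ P, P = WordRAM.solver k g r := ⟨_, rfl⟩
  -- The summands of `C` pay for the steps, the registers, the memory cells per entry, and the
  -- condition that double words hold all sums.
  obtain ⟨C, hC⟩ : ∃ C, C = C₀ + P.regCount + (k + 2 * r) + (k + 1) * (r + 2) := ⟨_, rfl⟩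
  -- No logarithmic factor is needed, so its exponent is `0`.
  refine ⟨P, C, 0, fun n w hn hspace S t => ?_⟩
  beta_reduce at hspace ⊢
  have hCn : C ≤ C * n := Nat.le_mul_of_pos_right _ hn
  have hC₀C : C₀ ≤ C := by omega
  -- Gives `n < 2 ^ w`, so the loop length `n` itself fits into a word.
  have hCpos : 2 ≤ C := by omega
  have h2n : 2 * n ≤ C * n := Nat.mul_le_mul_right _ hCpos
  have hcells : P.regCount + (k + 2 * r) * n ≤ C * n := by
    have h1 : P.regCount ≤ P.regCount * n := Nat.le_mul_of_pos_right _ hn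
    have h2 : (P.regCount + (k + 2 * r)) * n ≤ C * n := Nat.mul_le_mul_right _ (by omega)
    rw [Nat.add_mul] at h2
    omega
  have hkn : k * n ≤ (k + 2 * r) * n := Nat.mul_le_mul_right _ (by omega)
  have hw : 0 < w := by
    rcases w with _ | w
    · simp only [pow_zero] at hspace; omega
    · omega
  have hparams : WordRAM.Params w k g r n (WordRAM.shiftedTarget k t) ((k + 2 * r) * n) := by
    refine ⟨hn, by omega, hg, ?_, le_rfl, by omega, by omega, WordRAM.shiftedTarget_lt hw hk t⟩
    exact (Nat.mul_le_mul_right _ (by omega)).trans hgk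
  obtain ⟨s', m, hb, hm, hpeak, hout⟩ := hparams.solver_spec hk (U := KSum.shifted S)
    (s := (KSum.init P S t).state) rfl rfl rfl hkn (KSum.hasInput_init P S t (by omega))
  rw [← hP] at hb
  refine ⟨fun d hd hh => ?_, fun d hd => ?_, ?_⟩
  · rw [hb.eq_of_reachable_of_halted hd hh]
    exact KSum.correctOutput_of_shifted hw hk S t hout
  · have := hb.peak_le_of_reachable hd
    unfold WordRAM.Config.space
    omega
  · refine hb.expectedTime_le.trans ?_
    rw [pow_zero, mul_one, ← ENNReal.ofReal_natCast]
    apply ENNReal.ofReal_le_ofReal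
    have hm' := WordRAM.solver_steps_le hn hg hr hgk _ hm
    rw [← hC₀] at hm'
    have hn' : (1 : ℝ) ≤ n := by exact_mod_cast hn
    calc (m : ℝ) ≤ ((C₀ * n ^ (max (k - g + 1) (g * g - g + 2)) : ℕ) : ℝ) := by exact_mod_cast hm'
      _ = (C₀ : ℝ) * (n : ℝ) ^ ((max (k - g + 1) (g * g - g + 2) : ℕ) : ℝ) := by
        rw [Real.rpow_natCast]; push_cast; ring
      _ ≤ (C : ℝ) * (n : ℝ) ^ ((k : ℝ) - Real.sqrt k + 2) := by
        exact mul_le_mul (Nat.cast_le.2 hC₀C)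
          (Real.rpow_le_rpow_of_exponent_le hn' (WordRAM.exponent_le hg hgk hgk'))
          (by positivity) (by positivity)
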